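/- Let $m\ge 2$, and let $\mathbb M^m(c)$ be the complete simply connected $m$-dimensional Riemannian manifold of constant sectional curvature $c$, where $c=0$, $c=k^2$ or $c=-k^2$ with $k>0$. Let $\kappa_2\ge\kappa_1$ be real numbers with $\kappa_1>0$ if $c=0$, $\kappa_1\ge 0$ if $c=k^2$, and $\kappa_1>k$ if $c=-k^2$. For $i=1,2$ let $R_i$ be the radius of the geodesic spheres of $\mathbb M^m(c)$ that have constant normal curvature $\kappa_i$ with respect to the normal pointing to the centre (this radius exists and is unique). A closed domain $D\subset\mathbb M^m(c)$ (the closure of a non-empty connected open set) with non-empty boundary is called $\kappa_1,\kappa_2$-convex if for every $P\in\partial D$ there are two nested geodesic spheres $S_1,S_2$ through $P$, of normal curvatures $\kappa_1$ and $\kappa_2$ and bounding closed balls $B_2\subseteq B_1$, such that near $P$ the boundary $\partial D$ lies inside $S_1$ and outside $S_2$, where $D$ lies on the inner side of its boundary (near $P$, $B_2$ is contained in $D$, and $D$ in $B_1$). We say that $\partial D$ is enclosed in the spherical shell of centre $O$ and radii $0<r\le R$ if $r\le \operatorname{dist}(O,x)\le R$ for all $x\in\partial D$, and $D$ contains the closed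 ball of radius $r$ about $O$ and is contained in the closed ball of radius $R$ about $O$. Put $$w=\begin{cases}(\sqrt2-1)(R_1-R_2), & c=0,\\[2pt] \dfrac2k\arccos\sqrt{\cos\bigl(k(R_1-R_2)\bigr)}-(R_1-R_2), & c=k^2,\\[6pt] \dfrac2k\operatorname{arccosh}\sqrt{\cosh\bigl(k(R_1-R_2)\bigr)}-(R_1-R_2), & c=-k^2.\end{cases}$$ (a) If $D\subset\mathbb M^m(c)$ is a $\kappa_1,\kappa_2$-convex domain, then $\partial D$ is enclosed in some spherical shell between two concentric spheres of radii $R\ge r$ with $R-r\le w$ (and $R<\pi/k$ if $c=k^2$). (b) This is sharp: there is a $\kappa_1,\kappa_2$-convex domain $D$, bounded by a rounded spindle-shaped hypersurface, such that $\partial D$ is enclosed in a spherical shell with $R-r=w$ (and $R<\pi/k$ if $c=k^2$), while $R-r\ge w$ for every spherical shell that encloses $\partial D$. Here a rounded spindle-shaped hypersurface is obtained as follows: take two balls of radius $R_2$ with centres $C,C'$ at distance at most $2(R_1-R_2)$; join the two balls, in each half-plane bounded by the axis $CC'$, by the arc of the circle of radius $R_1$ that is internally tangent to both of them and whose centre,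 at distance $R_1-R_2$ from $C$ and $C'$, lies in the opposite half-plane; the hypersurface consists of these arcs, which are rotated into one another about the axis, and of the two outer caps of the spheres bounding the balls. (If $C=C'$, or if the distance of $C$ and $C'$ is $2(R_1-R_2)$, it is a geodesic sphere.) -/

import Mathlib

open Set Filter Topology

noncomputable section

namespace ConstCurv

/-! ### Normal curvature of spheres and pinched convexity

The notions of this part are stated for a space `X` with a distance function `d`; they are
used only for the three model spaces that are constructed below. -/

section General

variable {X : Type}

/-- The closed geodesic ball with centre `O` and radius `ρ`. -/
def gball (d : X → X → ℝ) (O : X) (ρ : ℝ) : Set X := {x | d O x ≤ ρ}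

/-- The geodesic sphere with centre `O` and radius `ρ`. -/
def gsphere (d : X → X → ℝ) (O : X) (ρ : ℝ) : Set X := {x | d O x = ρ}

/-- The geodesic segment between `a` and `b` (two points that are not antipodal on a sphere). -/
def gsegment (d : X → X → ℝ) (a b : X) : Set X := {y | d a y + d y b = d a b}

/-- Let `X` sit in a vector space `E` through `ι`, its Riemannian metric being the restriction of
the bilinear form `β` on `E`. The hypersurface `S` of `X` has constant normal curvature `κ` with
respect to the field `N` of unit normals (tangent to `X`): every unit speed `C²` curve in `S` has
acceleration with `N`-component `κ`. As `N` is tangent to `X`, the covariant acceleration and the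
acceleration in `E` have the same `N`-component. -/
def HasConstNormalCurvature {E : Type} [NormedAddCommGroup E] [NormedSpace ℝ E]
    (ι : X → E) (β : E → E → ℝ) (S : Set X) (N : X → E) (κ : ℝ) : Prop :=
  ∀ γ : ℝ → X, ContDiff ℝ 2 (fun t => ι (γ t)) → (∀ t, γ t ∈ S) →
    (∀ t, β (deriv (fun s => ι (γ s)) t) (deriv (fun s => ι (γ s)) t) = 1) →
    ∀ t, β (iteratedDeriv 2 (fun s => ι (γ s)) t) (N (γ t)) = κ

/-- `D` is a `κ₁,κ₂`-convex domain. Here `curv O ρ κ` says that the geodesic sphere with centre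
`O` and radius `ρ` has constant normal curvature `κ` with respect to the normal pointing to `O`.

`D` is a closed domain with non-empty boundary, and through every point `P` of its boundary there
pass two nested geodesic spheres `S₁ ⊇ S₂` of normal curvatures `κ₁` and `κ₂`, such that near `P`
the boundary of `D` lies inside `S₁` and outside `S₂`. The domain lies on the inner side of its
boundary, that is, near `P` it contains the ball bounded by `S₂` and is contained in the ball
bounded by `S₁`. -/
structure IsPinchedConvex [TopologicalSpace X] (d : X → X → ℝ) (curv : X → ℝ → ℝ → Prop)
    (κ₁ κ₂ : ℝ) (D : Set X) : Prop where
  closed_domain : ∃ U : Set X, IsOpen U ∧ IsConnected U ∧ D = closure U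
  frontier_nonempty : (frontier D).Nonempty
  pinched : ∀ P ∈ frontier D, ∃ (O₁ O₂ : X) (ρ₁ ρ₂ : ℝ),
    curv O₁ ρ₁ κ₁ ∧ curv O₂ ρ₂ κ₂ ∧
    P ∈ gsphere d O₁ ρ₁ ∧ P ∈ gsphere d O₂ ρ₂ ∧
    gball d O₂ ρ₂ ⊆ gball d O₁ ρ₁ ∧
    ∀ᶠ x in 𝓝 P,
      (x ∈ frontier D → d O₁ x ≤ ρ₁ ∧ ρ₂ ≤ d O₂ x) ∧
      (d O₂ x ≤ ρ₂ → x ∈ D) ∧ (x ∈ D → d O₁ x ≤ ρ₁)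

/-- The boundary of `D` lies in the spherical shell between the concentric spheres of radii
`r ≤ R` with centre `O`, the inner ball of the shell being contained in `D`, and `D` in the
outer one. -/
structure IsShell [TopologicalSpace X] (d : X → X → ℝ) (D : Set X) (O : X) (r R : ℝ) :
    Prop where
  pos : 0 < r
  le : r ≤ R
  frontier_subset : ∀ x ∈ frontier D, r ≤ d O x ∧ d O x ≤ R
  inner_subset : gball d O r ⊆ D
  subset_outer : D ⊆ gball d O R

/-- `D` is a domain bounded by a rounded spindle-shaped hypersurface, with arcs of radius `R₁`
that are rounded by spherical caps of radius `R₂`.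

The caps belong to the balls of radius `R₂` about `C` and `C'`. In every half-plane bounded by the
axis `CC'`, the boundary contains the arc of a circle of radius `R₁` that is internally tangent to
the spheres bounding the two balls; its centre `Z` has distance `R₁ - R₂` from both `C` and `C'`
and lies in the opposite half-plane, and the arc goes between the rays `ZC` and `ZC'`. Accordingly
`D` is the union of the two balls and, over all centres `Z`, of the parts of the circular sectors
that lie beyond the axis. Rotation about the axis moves the centre `Z` through all points that have
distance `R₁ - R₂` from `C` and `C'`. -/
def IsRoundedSpindle (d : X → X → ℝ) (R₁ R₂ : ℝ) (D : Set X) : Prop :=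
  ∃ C C' : X, (∃ Z, d Z C = R₁ - R₂ ∧ d Z C' = R₁ - R₂) ∧
    D = gball d C R₂ ∪ gball d C' R₂ ∪
      {x | ∃ Z y, d Z C = R₁ - R₂ ∧ d Z C' = R₁ - R₂ ∧
        y ∈ gsegment d C C' ∧ y ∈ gsegment d Z x ∧ d Z x ≤ R₁}

end General

/-! ### Curvature `0`: Euclidean space -/

/-- Euclidean space of dimension `m`. -/
abbrev Euc (m : ℕ) : Type := EuclideanSpace ℝ (Fin m)

/-- The Euclidean distance. -/
def eucDist {m : ℕ} (x y : Euc m) : ℝ := dist x y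

/-- The sphere with centre `O` and radius `ρ` has normal curvature `κ`. At `x` the unit normal
pointing to `O` is `ρ⁻¹ (O - x)`. -/
def eucCurv {m : ℕ} (O : Euc m) (ρ κ : ℝ) : Prop :=
  0 < ρ ∧ HasConstNormalCurvature (fun x : Euc m => x) (fun v w => inner ℝ v w)
    (gsphere eucDist O ρ) (fun x => ρ⁻¹ • (O - x)) κ

/-! ### Curvature `k²`: the round sphere of radius `1 / k` -/

/-- The round `m`-dimensional sphere of radius `1 / k` (for `k > 0`). -/
abbrev Sph (m : ℕ) (k : ℝ) : Type := Metric.sphere (0 : EuclideanSpace ℝ (Fin (m + 1))) (1 / k)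

/-- The geodesic distance, that is `1 / k` times the angle. -/
def sphDist {m : ℕ} {k : ℝ} (x y : Sph m k) : ℝ :=
  InnerProductGeometry.angle (x : EuclideanSpace ℝ (Fin (m + 1))) y / k

/-- The geodesic sphere with centre `O` and radius `ρ` has normal curvature `κ`. At `x` the unit
normal `N` pointing to `O` is determined by `O = cos (k ρ) x + k⁻¹ sin (k ρ) N`. -/
def sphCurv {m : ℕ} {k : ℝ} (O : Sph m k) (ρ κ : ℝ) : Prop :=
  0 < ρ ∧ ρ < Real.pi / k ∧
    HasConstNormalCurvature (fun x : Sph m k => (x : EuclideanSpace ℝ (Fin (m + 1))))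
      (fun v w => inner ℝ v w) (gsphere sphDist O ρ)
      (fun x => (k / Real.sin (k * ρ)) •
        ((O : EuclideanSpace ℝ (Fin (m + 1))) - Real.cos (k * ρ) • (x : EuclideanSpace ℝ (Fin (m + 1)))))
      κ

/-! ### Curvature `-k²`: the hyperboloid model -/

/-- The Lorentz form on `ℝ × ℝᵐ`. -/
def lorentz {m : ℕ} (v w : ℝ × EuclideanSpace ℝ (Fin m)) : ℝ := inner ℝ v.2 w.2 - v.1 * w.1

/-- The upper sheet of the hyperboloid `⟨x, x⟩ = -1 / k²` (for `k > 0`). -/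
abbrev Hyp (m : ℕ) (k : ℝ) : Type :=
  {x : ℝ × EuclideanSpace ℝ (Fin m) // lorentz x x = -(1 / k ^ 2) ∧ 0 < x.1}

/-- The geodesic distance in the hyperboloid model. -/
def hypDist {m : ℕ} {k : ℝ} (x y : Hyp m k) : ℝ :=
  Real.arcosh (-(k ^ 2 * lorentz x.1 y.1)) / k

/-- The geodesic sphere with centre `O` and radius `ρ` has normal curvature `κ`. At `x` the unit
normal `N` pointing to `O` is determined by `O = cosh (k ρ) x + k⁻¹ sinh (k ρ) N`. -/
def hypCurv {m : ℕ} {k : ℝ} (O : Hyp m k) (ρ κ : ℝ) : Prop :=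
  0 < ρ ∧
    HasConstNormalCurvature (fun x : Hyp m k => x.1) lorentz (gsphere hypDist O ρ)
      (fun x => (k / Real.sinh (k * ρ)) • (O.1 - Real.cosh (k * ρ) • x.1)) κ

end ConstCurv

end

/-!
The three geometries are treated together. Let `sn` be the generalized sine of curvature `K` and
`md` its primitive, so that `md s` is `s ^ 2 / 2`, `(1 - cos (k s)) / k ^ 2` or
`(cosh (k s) - 1) / k ^ 2`. In terms of `md` the law of cosines is polynomial in `K`, and it is all
that is used of the geometry (`ConstCurv.SpaceForm`). Write `F x y = md (dist x y)`. Up to the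
factor `λ` and the summand `μ`, which depend on `x`, `y`, `t` only, `F · Z` is affine along the
segment from `x` to `y` (`seg_spec`): on a quadric, `F · Z` is the restriction of an affine
function, and the segment is the central projection of the chord. Hence a function that is supported
from below at every point of a segment by functions `F · Z` behaves like a convex function: a local
support is a global one (`F_le_of_support`). This gives Blaschke's rolling theorems, without any
smoothness of the boundary.

* Outer ball (`dist_le_of_outer`): let `u` be the distance from the boundary. For `R'` slightly
  larger than `R₁`, the function `md (R' - u)` has local supports `F · Z'`, where `Z'` is the centre
  of the ball of radius `R'` that is tangent to an outer ball at a nearest boundary point. It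
  follows that every outer ball of radius `R₁` contains all of `D`.
* Inner ball (`dist_centers_le`): let `f Y` be the distance from `Y` to the farthest point of `D`.
  For `r` slightly smaller than `R₂`, the function `md (f - r)` has local supports `F · O'`, where
  `O'` is the centre of the ball of radius `r` that is tangent to an inner ball at a farthest point.
  It follows that the centres `A` of the inner balls and the centres `B` of the outer balls satisfy
  `dist x z ≤ ρ := R₁ - R₂` for all `x ∈ A`, `z ∈ B`.

For two such sets there are a point `O` and radii `a`, `c`, the legs of a right-angled triangle with
hypotenuse `ρ`, with `A` in the ball of radius `a` about `O` and `B` in the ball of radius `c`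
(`exists_center`); `O` is the centre of the smallest ball containing `A`, and is found by maximizing
a quadratic form over the convex hull of `A` in an ambient vector space. Every boundary point is at
distance `R₂` from a point of `A` and `R₁` from a point of `B`, so its distance from `O` is between
`R₁ - c` and `a + R₂`. The width of this shell is `a + c - ρ`, and `a + c` is at most `2 α`, the
value for the isosceles right-angled triangle (`add_le_two_mul`). This proves the upper bound
(`exists_shell`).

For sharpness, take the spindle with `dist O C = dist O C' = α`. The centres of its arcs form the
rim, the set of the points at distance `ρ` from `C` and from `C'`, which is also the sphere of
radius `α` about `O` in the hyperplane orthogonal to the axis. The spindle is the union of the two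
balls about `C` and `C'` and of a set cut out by two continuous functions `σ`, `φ`
(`isRoundedSpindle_spindle`), from which the tangent balls at its boundary points can be read off
(`pinched_spindle`). Its tips are `2 (α + R₂)` apart, so `R ≥ α + R₂` for every shell; and an inner
ball of radius `r` lies in the balls of radius `R₁` about two opposite points of the rim, which are
`2 α` apart, so `r ≤ R₁ - α` (`le_of_isShell`).

The sphere and the hyperboloid are both quadrics `B x x = 1 / K` in a vector space with a bilinear
form, for which the law of cosines and the normal curvature of geodesic spheres are computed once
(`ConstCurv.Quadric`).
-/

namespace ConstCurv

/-! ### Space forms through the law of cosines -/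

/-- The trigonometry of the complete simply connected surface of constant curvature `K`: the
function `sn` with `sn'' = -K * sn`, `sn 0 = 0`, `sn' 0 = 1`, its primitive `md` with `md 0 = 0`
(so that `sn' = 1 - K * md`), and the interval `dom` of the values that a distance can have. The
functions are used through their addition laws only. In terms of `md` these are polynomial in `K`,
so that no sign of `K` has to be distinguished. -/
structure Trigonometry where
  K : ℝ
  md : ℝ → ℝ
  sn : ℝ → ℝ
  dom : Set ℝ
  md_zero : md 0 = 0
  md_add : ∀ a b, md (a + b) = md a + md b - K * md a * md b + sn a * sn b
  md_sub : ∀ a b, md (a - b) = md a + md b - K * md a * md b - sn a * sn b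
  sn_sub : ∀ a b, sn (a - b) = sn a * (1 - K * md b) - (1 - K * md a) * sn b
  continuous_md : Continuous md
  continuous_sn : Continuous sn
  zero_mem : (0 : ℝ) ∈ dom
  ordConnected_dom : dom.OrdConnected
  nonneg_of_mem : ∀ s ∈ dom, 0 ≤ s
  strictMonoOn_md : StrictMonoOn md dom
  sn_nonneg : ∀ s ∈ dom, 0 ≤ sn s
  exists_md_eq : ∀ f, 0 ≤ f → 0 ≤ 2 * f - K * f ^ 2 → ∃ s ∈ dom, md s = f

/-- `X` is a space form with tangent spaces modelled on `V`. The vector `tan P x` is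
`sn (dist P x)` times the initial unit vector of the geodesic from `P` to `x`; the tangent spaces
at the different points `P` are all identified with `V`. The field `law` is the law of cosines in
the triangle `P x y`, and `exists_exp` provides the point at a given distance from `P` in a given
direction. -/
structure SpaceForm (X V : Type) [MetricSpace X] [NormedAddCommGroup V]
    [InnerProductSpace ℝ V] extends Trigonometry where
  tan : X → X → V
  dist_mem : ∀ x y : X, dist x y ∈ dom
  law : ∀ P x y : X, md (dist x y) = md (dist P x) + md (dist P y)
    - K * md (dist P x) * md (dist P y) - inner ℝ (tan P x) (tan P y)
  exists_exp : ∀ P, ∀ s ∈ dom, ∀ v : V, ‖v‖ = 1 → ∃ x, dist P x = s ∧ tan P x = sn s • v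

namespace SpaceForm

variable {X V : Type} [MetricSpace X] [NormedAddCommGroup V] [InnerProductSpace ℝ V]
variable (S : SpaceForm X V)

/-- The modified distance `md (dist x y)`. -/
def F (x y : X) : ℝ := S.md (dist x y)

lemma F_law (P x y : X) : S.F x y = S.F P x + S.F P y - S.K * S.F P x * S.F P y
    - inner ℝ (S.tan P x) (S.tan P y) := S.law P x y

lemma F_self (x : X) : S.F x x = 0 := by simp [F, S.md_zero]

lemma F_comm (x y : X) : S.F x y = S.F y x := by simp [F, dist_comm]

lemma sn_sq (a : ℝ) : S.sn a ^ 2 = 2 * S.md a - S.K * S.md a ^ 2 := by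
  have := S.md_sub a a
  rw [sub_self, S.md_zero] at this
  linarith

lemma sn_zero : S.sn 0 = 0 := by
  have := S.sn_sq 0
  rw [S.md_zero] at this
  simpa using this

lemma md_nonneg {s : ℝ} (hs : s ∈ S.dom) : 0 ≤ S.md s := by
  have := S.strictMonoOn_md.monotoneOn S.zero_mem hs (S.nonneg_of_mem s hs)
  rwa [S.md_zero] at this

lemma md_pos {s : ℝ} (hs : s ∈ S.dom) (h : 0 < s) : 0 < S.md s := by
  have := S.strictMonoOn_md S.zero_mem hs h
  rwa [S.md_zero] at this

lemma F_nonneg (x y : X) : 0 ≤ S.F x y := S.md_nonneg (S.dist_mem x y)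

lemma mem_of_le {s t : ℝ} (hs : s ∈ S.dom) (h0 : 0 ≤ t) (h : t ≤ s) : t ∈ S.dom :=
  S.ordConnected_dom.out S.zero_mem hs ⟨h0, h⟩

lemma le_iff {s t : ℝ} (hs : s ∈ S.dom) (ht : t ∈ S.dom) : S.md s ≤ S.md t ↔ s ≤ t :=
  S.strictMonoOn_md.le_iff_le hs ht

lemma lt_iff {s t : ℝ} (hs : s ∈ S.dom) (ht : t ∈ S.dom) : S.md s < S.md t ↔ s < t :=
  S.strictMonoOn_md.lt_iff_lt hs ht

lemma md_inj {s t : ℝ} (hs : s ∈ S.dom) (ht : t ∈ S.dom) (h : S.md s = S.md t) : s = t :=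
  S.strictMonoOn_md.injOn hs ht h

lemma dist_le_iff {x y : X} {s : ℝ} (hs : s ∈ S.dom) : dist x y ≤ s ↔ S.F x y ≤ S.md s :=
  (S.le_iff (S.dist_mem x y) hs).symm

lemma dist_lt_iff {x y : X} {s : ℝ} (hs : s ∈ S.dom) : dist x y < s ↔ S.F x y < S.md s :=
  (S.lt_iff (S.dist_mem x y) hs).symm

lemma dist_eq_of_F {x y : X} {s : ℝ} (hs : s ∈ S.dom) (h : S.F x y = S.md s) : dist x y = s :=
  S.md_inj (S.dist_mem x y) hs h

lemma eq_of_F_le {x y : X} (h : S.F x y ≤ 0) : x = y := by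
  have : dist x y ≤ 0 := by
    rw [S.dist_le_iff S.zero_mem, S.md_zero]; exact h
  exact dist_le_zero.1 this

lemma md_two_mul (a : ℝ) : S.md (2 * a) = 2 * S.sn a ^ 2 := by
  rw [two_mul, S.md_add]; linear_combination -S.sn_sq a

lemma norm_tan_sq (P x : X) : ‖S.tan P x‖ ^ 2 = 2 * S.F P x - S.K * S.F P x ^ 2 := by
  have h := S.F_law P x x
  rw [S.F_self, real_inner_self_eq_norm_sq] at h
  linarith

lemma norm_tan (P x : X) : ‖S.tan P x‖ = S.sn (dist P x) := by
  have h : ‖S.tan P x‖ ^ 2 = S.sn (dist P x) ^ 2 := by rw [S.norm_tan_sq, S.sn_sq]; rfl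
  exact (pow_left_inj₀ (norm_nonneg _) (S.sn_nonneg _ (S.dist_mem P x)) two_ne_zero).1 h

lemma K_md_le {s : ℝ} (hs : s ∈ S.dom) : S.K * S.md s ≤ 2 := by
  have h := S.sn_sq s
  have h0 := S.md_nonneg hs
  by_contra! hc
  have : 0 < S.md s := by
    rcases h0.lt_or_eq with h | h
    · exact h
    · rw [← h] at hc; norm_num at hc
  nlinarith [sq_nonneg (S.sn s)]

lemma sn_pos {s : ℝ} (hs : s ∈ S.dom) (h : 0 < s) (hK : S.K * S.md s < 2) : 0 < S.sn s := by
  have h1 := S.sn_sq s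
  have h2 := S.md_pos hs h
  have h3 := S.sn_nonneg s hs
  have : 0 < S.sn s ^ 2 := by rw [h1]; nlinarith
  exact lt_of_le_of_ne h3 fun h => by rw [← h] at this; norm_num at this

/-- A bound on `K md` is inherited by smaller distances. The bound `2` says that the distance is
less than the diameter of the sphere, the bound `1` that it is less than a quarter of a great
circle; for `K ≤ 0` there is no restriction. -/
lemma K_md_lt_of_le {s t b : ℝ} (hb : 0 < b) (hs : s ∈ S.dom) (ht : t ∈ S.dom) (h : s ≤ t)
    (hK : S.K * S.md t < b) : S.K * S.md s < b := by
  have h1 := (S.le_iff hs ht).2 h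
  have h2 := S.md_nonneg hs
  rcases le_total 0 S.K with hc | hc
  · nlinarith
  · nlinarith

lemma K_md_le_of_le {s t b : ℝ} (hb : 0 ≤ b) (hs : s ∈ S.dom) (ht : t ∈ S.dom) (h : s ≤ t)
    (hK : S.K * S.md t ≤ b) : S.K * S.md s ≤ b := by
  have h1 := (S.le_iff hs ht).2 h
  have h2 := S.md_nonneg hs
  rcases le_total 0 S.K with hc | hc
  · nlinarith
  · nlinarith

/-- For `K > 0` the bound `2` on `K md` excludes exactly the maximal distance. -/
lemma exists_gt {s : ℝ} (hs : s ∈ S.dom) (hK : S.K * S.md s < 2) :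
    ∃ t ∈ S.dom, s < t ∧ S.K * S.md t < 2 := by
  have h0 := S.md_nonneg hs
  obtain ⟨f, hf, hKf⟩ : ∃ f, S.md s < f ∧ S.K * f < 2 := by
    rcases le_or_gt S.K 0 with hc | hc
    · exact ⟨S.md s + 1, by linarith, by nlinarith⟩
    · have : S.md s < 2 / S.K := by rw [lt_div_iff₀ hc]; linarith
      obtain ⟨f, h1, h2⟩ := exists_between this
      rw [lt_div_iff₀ hc] at h2
      exact ⟨f, h1, by linarith⟩
  obtain ⟨t, ht, rfl⟩ := S.exists_md_eq f (by linarith) (by nlinarith)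
  exact ⟨t, ht, (S.lt_iff hs ht).1 hf, hKf⟩

/-- The sign of `sn (b - a)` decides the order of `a` and `b`, also where `b` is not in `dom`. -/
lemma le_of_sn_sub_nonneg {a b : ℝ} (ha : a ∈ S.dom) (hb0 : 0 < b)
    (h : 0 ≤ S.sn (b - a)) : a ≤ b := by
  by_contra! hlt
  have hmem : a - b ∈ S.dom := S.mem_of_le ha (by linarith) (by linarith)
  have h1 : S.sn (a - b) = - S.sn (b - a) := by rw [S.sn_sub, S.sn_sub]; ring
  have h2 : S.md (a - b) < S.md a := (S.lt_iff hmem ha).2 (by linarith)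
  have h3 : S.K * S.md (a - b) < 2 := by
    have h4 := S.K_md_le ha
    have h5 := S.md_nonneg hmem
    rcases le_or_gt S.K 0 with hc | hc
    · nlinarith
    · nlinarith
  have := S.sn_pos hmem (by linarith) h3
  linarith

/-- A unit vector in the direction of `tan P x`; any unit vector does if `tan P x = 0`, that is,
if `x = P` or `x` is antipodal to `P`. -/
lemma exists_unit [Nontrivial V] (P x : X) :
    ∃ v : V, ‖v‖ = 1 ∧ S.tan P x = S.sn (dist P x) • v := by
  by_cases h : S.tan P x = 0
  · obtain ⟨v, hv⟩ := exists_norm_eq V (zero_le_one (α := ℝ))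
    refine ⟨v, hv, ?_⟩
    rw [← S.norm_tan, h]; simp
  · refine ⟨‖S.tan P x‖⁻¹ • S.tan P x, norm_smul_inv_norm h, ?_⟩
    rw [← S.norm_tan, smul_smul, mul_inv_cancel₀ (norm_ne_zero_iff.2 h), one_smul]

/-- On the ray from `P` through `x` there is a point at every admissible distance from `P`. -/
lemma exists_on_ray [Nontrivial V] (P x : X) {r : ℝ} (hr : r ∈ S.dom) :
    ∃ q, dist P q = r ∧ dist x q = |r - dist P x| := by
  obtain ⟨v, hv, hx⟩ := S.exists_unit P x
  obtain ⟨q, hq, hq'⟩ := S.exists_exp P r hr v hv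
  refine ⟨q, hq, ?_⟩
  have hm := S.dist_mem P x
  have h1 : S.F x q = S.md (r - dist P x) := by
    rw [S.F_law P, hx, hq', F, F, hq, S.md_sub, real_inner_smul_left, real_inner_smul_right,
      real_inner_self_eq_norm_sq, hv]
    ring
  have h2 : S.md (r - dist P x) = S.md (dist P x - r) := by rw [S.md_sub, S.md_sub]; ring
  rcases le_total (dist P x) r with h | h
  · rw [abs_of_nonneg (by linarith)]
    exact S.dist_eq_of_F (S.mem_of_le hr (by linarith) (by linarith [dist_nonneg (x := P) (y := x)])) h1
  · rw [abs_of_nonpos (by linarith), neg_sub]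
    exact S.dist_eq_of_F (S.mem_of_le hm (by linarith) (by linarith [S.nonneg_of_mem r hr])) (h1.trans h2)

lemma exists_extension [Nontrivial V] (P x : X) {r : ℝ} (hr : r ∈ S.dom) (h : dist P x ≤ r) :
    ∃ q, dist P q = r ∧ dist x q = r - dist P x := by
  obtain ⟨q, h1, h2⟩ := S.exists_on_ray P x hr
  exact ⟨q, h1, by rw [h2, abs_of_nonneg (by linarith)]⟩

lemma exists_between_dist [Nontrivial V] (S : SpaceForm X V) (P x : X) {r : ℝ} (hr : 0 ≤ r) (h : r ≤ dist P x) :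
    ∃ q, dist P q = r ∧ dist q x = dist P x - r := by
  obtain ⟨q, h1, h2⟩ := S.exists_on_ray P x (S.mem_of_le (S.dist_mem P x) hr h)
  exact ⟨q, h1, by rw [dist_comm, h2, abs_of_nonpos (by linarith), neg_sub]⟩

/-- Along a geodesic, the tangents at an inner point are opposite. -/
lemma inner_tan_of_dist_add {a b z : X} (h : dist a z + dist z b = dist a b) :
    inner ℝ (S.tan z a) (S.tan z b) = -(S.sn (dist z a) * S.sn (dist z b)) := by
  have h1 := S.law z a b
  rw [← h, S.md_add, dist_comm a z] at h1
  linarith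

lemma smul_add_smul_eq_zero_of_inner {u w : V} (h : inner ℝ u w = -(‖u‖ * ‖w‖)) :
    ‖w‖ • u + ‖u‖ • w = 0 := by
  rw [← norm_eq_zero, ← sq_eq_zero_iff, norm_add_sq_real, norm_smul, norm_smul,
    real_inner_smul_left, real_inner_smul_right, h, norm_norm, norm_norm]
  ring

lemma tan_opposite {a b z : X} (h : dist a z + dist z b = dist a b) :
    S.sn (dist z b) • S.tan z a + S.sn (dist z a) • S.tan z b = 0 := by
  rw [← S.norm_tan, ← S.norm_tan]
  apply smul_add_smul_eq_zero_of_inner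
  rw [S.inner_tan_of_dist_add h, S.norm_tan, S.norm_tan]

lemma eq_of_tan_eq {P x y : X} (hd : dist P x = dist P y) (h : S.tan P x = S.tan P y) : x = y := by
  apply S.eq_of_F_le
  rw [S.F_law P, h, real_inner_self_eq_norm_sq, S.norm_tan_sq, F, F, hd]
  exact le_of_eq (by ring)

/-- Geodesics do not branch. -/
lemma extension_unique (S : SpaceForm X V) {Z x p q : X} (hx : x ≠ Z) (hp : dist Z x + dist x p = dist Z p)
    (hq : dist Z x + dist x q = dist Z q) (hpq : dist Z p = dist Z q) : p = q := by
  have hd : dist x p = dist x q := by linarith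
  rcases eq_or_ne x p with rfl | hxp
  · rw [dist_self] at hd
    exact dist_eq_zero.1 hd.symm
  have h0 : 0 < dist x Z := dist_pos.2 hx
  have h1 : 0 < dist x p := dist_pos.2 hxp
  have hlt : S.md (dist x Z) < S.md (dist Z p) :=
    (S.lt_iff (S.dist_mem _ _) (S.dist_mem _ _)).2 (by rw [dist_comm x Z]; linarith)
  have hK : S.K * S.md (dist x Z) < 2 := by
    have h4 := S.K_md_le (S.dist_mem Z p)
    have h5 := S.md_nonneg (S.dist_mem x Z)
    rcases le_or_gt S.K 0 with hc | hc <;> nlinarith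
  have hs := S.sn_pos (S.dist_mem x Z) h0 hK
  have e1 := S.tan_opposite hp
  have e2 := S.tan_opposite hq
  rw [← hd] at e2
  have e3 : S.sn (dist x Z) • S.tan x p = S.sn (dist x Z) • S.tan x q := by
    rw [eq_neg_of_add_eq_zero_right e1, eq_neg_of_add_eq_zero_right e2]
  exact S.eq_of_tan_eq hd (smul_right_injective V hs.ne' e3)

/-- Two points in balls of radius at most a quarter of a great circle about `Z`, one of them in
the interior, are not antipodal. -/
lemma not_antipodal {Z x y : X} {C : ℝ} (hC : S.K * C ≤ 1) (hx : S.F Z x < C) (hy : S.F Z y ≤ C) :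
    S.K * S.F x y < 2 := by
  rcases le_or_gt S.K 0 with hc | hc
  · nlinarith [S.F_nonneg x y]
  have h1 := S.F_law Z x y
  have h2 := S.norm_tan_sq Z x
  have h3 := S.norm_tan_sq Z y
  have h4 := real_inner_le_norm (-S.tan Z x) (S.tan Z y)
  rw [inner_neg_left, norm_neg] at h4
  set f := S.F Z x
  set g := S.F Z y
  set a := ‖S.tan Z x‖
  set b := ‖S.tan Z y‖
  have hf : S.K * f < 1 := by nlinarith
  have hg : S.K * g ≤ 1 := by nlinarith
  have hab : S.K * (a * b) < 1 + (1 - S.K * f) * (1 - S.K * g) := by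
    apply lt_of_pow_lt_pow_left₀ 2 (by nlinarith)
    have e : (S.K * (a * b)) ^ 2 = (1 - (1 - S.K * f) ^ 2) * (1 - (1 - S.K * g) ^ 2) := by
      rw [mul_pow, mul_pow, h2, h3]; ring
    rw [e]
    nlinarith [sq_pos_of_pos (show 0 < (1 - S.K * f) + (1 - S.K * g) by linarith)]
  nlinarith

end SpaceForm
end ConstCurv

namespace ConstCurv

/-! ### Geodesic segments -/

/-- A continuous function on `[0, 1]` that is locally supported from below by affine functions
lies below its chord: otherwise its excess over the chord is positive somewhere, and at the first
point where the excess is maximal no supporting line exists. -/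
lemma le_chord_of_local_support {f : ℝ → ℝ} (hf : ContinuousOn f (Icc 0 1))
    (h : ∀ t ∈ Ioo (0 : ℝ) 1, ∃ a b : ℝ, f t = a * t + b ∧ ∀ᶠ s in 𝓝 t, a * s + b ≤ f s) :
    ∀ t ∈ Icc (0 : ℝ) 1, f t ≤ (1 - t) * f 0 + t * f 1 := by
  set p : ℝ → ℝ := fun s => f s - ((1 - s) * f 0 + s * f 1) with hp
  have hpc : ContinuousOn p (Icc 0 1) := hf.sub (by fun_prop)
  by_contra! hcon
  obtain ⟨t, ht, hlt⟩ := hcon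
  have hpt : 0 < p t := by simp only [hp]; linarith
  obtain ⟨m, hm, hmax⟩ := isCompact_Icc.exists_isMaxOn ⟨t, ht⟩ hpc
  have hpm : 0 < p m := hpt.trans_le (hmax ht)
  have hA : IsCompact (Icc (0 : ℝ) 1 ∩ p ⁻¹' {p m}) :=
    isCompact_Icc.of_isClosed_subset (hpc.preimage_isClosed_of_isClosed isClosed_Icc
      isClosed_singleton) inter_subset_left
  obtain ⟨r, ⟨hr, hrm⟩, hleast⟩ := hA.exists_isLeast ⟨m, hm, rfl⟩
  have hrm' : p r = p m := hrm
  have hr0 : r ≠ 0 := by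
    rintro rfl
    simp only [hp] at hrm' hpm
    linarith
  have hr1 : r ≠ 1 := by
    rintro rfl
    simp only [hp] at hrm' hpm
    linarith
  have hro : r ∈ Ioo (0 : ℝ) 1 := ⟨lt_of_le_of_ne hr.1 hr0.symm, lt_of_le_of_ne hr.2 hr1⟩
  obtain ⟨a, b, hab, hsup⟩ := h r hro
  have hev : ∀ᶠ s in 𝓝 r, a * s + b ≤ f s ∧ s ∈ Ioo (0 : ℝ) 1 :=
    hsup.and (isOpen_Ioo.mem_nhds hro)
  obtain ⟨ε, hε, hball⟩ := Metric.eventually_nhds_iff.1 hev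
  have hs1 := hball (y := r - ε / 2) (by rw [Real.dist_eq, abs_lt]; constructor <;> linarith)
  have hs2 := hball (y := r + ε / 2) (by rw [Real.dist_eq, abs_lt]; constructor <;> linarith)
  have m1 : p (r - ε / 2) ≤ p m := hmax ⟨hs1.2.1.le, hs1.2.2.le⟩
  have m2 : p (r + ε / 2) ≤ p m := hmax ⟨hs2.2.1.le, hs2.2.2.le⟩
  have : r - ε / 2 ∈ Icc (0 : ℝ) 1 ∩ p ⁻¹' {p m} := by
    refine ⟨⟨hs1.2.1.le, hs1.2.2.le⟩, le_antisymm m1 ?_⟩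
    simp only [hp] at m1 m2 hrm' ⊢
    linarith [hs1.1, hs2.1]
  have := hleast this
  linarith

namespace SpaceForm

variable {X V : Type} [MetricSpace X] [NormedAddCommGroup V] [InnerProductSpace ℝ V]
variable (S : SpaceForm X V)

/-- In the vector space `ℝ × V` with the chart `x ↦ (F P x, tan P x)`, let
`B v w = v.1 + w.1 - K * v.1 * w.1 - ⟪v.2, w.2⟫`, so that `F x y` is the value of `B` at the images
of `x` and `y`. A vector `v` with `B v v = Q` lies off the image of the space form, and is brought
back to it by a central projection (a parallel one if `K = 0`) with the factor `lam Q`. -/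
noncomputable def lam (Q : ℝ) : ℝ := √(1 - S.K * Q)

/-- The summand that accompanies `lam`. It is `(1 - lam Q) / K`, in a form that makes sense for
`K = 0` as well, where it is `Q / 2`. -/
noncomputable def mu (Q : ℝ) : ℝ := Q / (1 + S.lam Q)

lemma lam_pos {Q : ℝ} (h : S.K * Q < 1) : 0 < S.lam Q := Real.sqrt_pos.2 (by linarith)

lemma lam_nonneg (Q : ℝ) : 0 ≤ S.lam Q := Real.sqrt_nonneg _

lemma lam_sq {Q : ℝ} (h : S.K * Q < 1) : S.lam Q ^ 2 = 1 - S.K * Q :=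
  Real.sq_sqrt (by linarith)

lemma mu_mul (Q : ℝ) : S.mu Q * (1 + S.lam Q) = Q :=
  div_mul_cancel₀ _ (by linarith [S.lam_nonneg Q])

lemma mu_nonneg {Q : ℝ} (h : 0 ≤ Q) : 0 ≤ S.mu Q :=
  div_nonneg h (by linarith [S.lam_nonneg Q])

lemma lam_eq {Q : ℝ} (h : S.K * Q < 1) : S.lam Q = 1 - S.K * S.mu Q := by
  have h1 := S.lam_sq h
  have h2 := S.mu_mul Q
  have h3 := S.lam_nonneg Q
  have : (1 + S.lam Q) * (S.lam Q - (1 - S.K * S.mu Q)) = 0 := by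
    linear_combination h1 + S.K * h2
  rcases mul_eq_zero.1 this with h | h <;> linarith

lemma lam_zero : S.lam 0 = 1 := by simp [lam]

lemma mu_zero : S.mu 0 = 0 := by simp [mu]

/-- The chart `z ↦ (F P z, tan P z)` is onto the vectors `v` with `0 ≤ v.1` and `B v v = 0`. -/
lemma exists_point [Nontrivial V] (P : X) {f : ℝ} {τ : V} (hf : 0 ≤ f)
    (h : ‖τ‖ ^ 2 = 2 * f - S.K * f ^ 2) : ∃ z, S.F P z = f ∧ S.tan P z = τ := by
  obtain ⟨s, hs, rfl⟩ := S.exists_md_eq f hf (by rw [← h]; positivity)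
  have hn : ‖τ‖ = S.sn s := by
    rw [← S.sn_sq] at h
    exact (pow_left_inj₀ (norm_nonneg _) (S.sn_nonneg _ hs) two_ne_zero).1 h
  obtain ⟨v, hv, hτ⟩ : ∃ v : V, ‖v‖ = 1 ∧ τ = S.sn s • v := by
    by_cases h0 : τ = 0
    · obtain ⟨v, hv⟩ := exists_norm_eq V (zero_le_one (α := ℝ))
      refine ⟨v, hv, ?_⟩
      rw [← hn, h0]; simp
    · refine ⟨‖τ‖⁻¹ • τ, norm_smul_inv_norm h0, ?_⟩
      rw [← hn, smul_smul, mul_inv_cancel₀ (norm_ne_zero_iff.2 h0), one_smul]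
  obtain ⟨z, h1, h2⟩ := S.exists_exp P s hs v hv
  exact ⟨z, by rw [F, h1], by rw [h2, hτ]⟩

/-- The central projection of a vector `(f, τ)` to the space form: up to `lam` and `mu`, the
function `F z` is the pairing of `(f, τ)` with the images of the points `Z`. -/
lemma exists_proj [Nontrivial V] (P : X) {f : ℝ} {τ : V} (hf : 0 ≤ f) {Q : ℝ}
    (hQ : Q = 2 * f - S.K * f ^ 2 - ‖τ‖ ^ 2) (hKQ : S.K * Q < 1) :
    ∃ z, S.F P z = (f - S.mu Q) / S.lam Q ∧ S.tan P z = (S.lam Q)⁻¹ • τ ∧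
      ∀ Z, f + S.F P Z - S.K * f * S.F P Z - inner ℝ τ (S.tan P Z)
        = S.lam Q * S.F z Z + S.mu Q := by
  have hl := S.lam_pos hKQ
  have hl1 := S.lam_eq hKQ
  have hl2 := S.mu_mul Q
  have hl3 := S.lam_sq hKQ
  have hg : ‖(S.lam Q)⁻¹ • τ‖ ^ 2 = 2 * ((f - S.mu Q) / S.lam Q)
      - S.K * ((f - S.mu Q) / S.lam Q) ^ 2 := by
    rw [norm_smul, mul_pow, norm_inv, Real.norm_of_nonneg hl.le]
    field_simp
    rw [show ‖τ‖ ^ 2 = 2 * f - S.K * f ^ 2 - Q by linarith]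
    generalize S.lam Q = l at *
    generalize S.mu Q = m at *
    subst hl1
    linear_combination hl2
  have hpos : 0 ≤ (f - S.mu Q) / S.lam Q := by
    set g := (f - S.mu Q) / S.lam Q with hgdef
    by_contra! hneg
    have e : 1 - S.K * g = (1 - S.K * f) / S.lam Q := by
      rw [hgdef]; field_simp; linarith
    have h0 : 0 ≤ g * (2 - S.K * g) := by nlinarith [sq_nonneg ‖(S.lam Q)⁻¹ • τ‖]
    have h1 : 2 - S.K * g ≤ 0 := by nlinarith
    have h2 : S.K < 0 := by nlinarith
    have h3 : 0 < (1 - S.K * f) / S.lam Q := div_pos (by nlinarith) hl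
    linarith
  obtain ⟨z, h1, h2⟩ := S.exists_point P hpos hg
  refine ⟨z, h1, h2, fun Z => ?_⟩
  rw [S.F_law P z Z, h1, h2, real_inner_smul_left]
  field_simp
  rw [hl1]
  ring

/-- The value of `Q` for the point with parameter `t` of the chord from `x` to `y`. -/
def segQ (x y : X) (t : ℝ) : ℝ := 2 * t * (1 - t) * S.F x y

lemma segQ_nonneg (x y : X) {t : ℝ} (ht : t ∈ Icc (0 : ℝ) 1) : 0 ≤ S.segQ x y t :=
  mul_nonneg (mul_nonneg (by linarith [ht.1]) (by linarith [ht.2])) (S.F_nonneg x y)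

lemma K_mul_segQ_lt {x y : X} (h : S.K * S.F x y < 2) {t : ℝ} (ht : t ∈ Icc (0 : ℝ) 1) :
    S.K * S.segQ x y t < 1 := by
  have h1 : 0 ≤ t * (1 - t) := mul_nonneg ht.1 (by linarith [ht.2])
  have h2 : t * (1 - t) ≤ 1 / 4 := by nlinarith [sq_nonneg (t - 1 / 2)]
  have : S.K * S.segQ x y t = 2 * (t * (1 - t)) * (S.K * S.F x y) := by rw [segQ]; ring
  rw [this]
  rcases le_total 0 (S.K * S.F x y) with hc | hc <;> nlinarith

lemma le_of_lam_mul_add_mu_le {x y : X} {t : ℝ} (h : S.K * S.F x y < 2) (ht : t ∈ Icc (0 : ℝ) 1) {a C : ℝ}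
    (hC : S.K * C ≤ 1) (ha : S.lam (S.segQ x y t) * a + S.mu (S.segQ x y t) ≤ C) : a ≤ C := by
  have hQ := S.K_mul_segQ_lt h ht
  have hl := S.lam_pos hQ
  have hl1 := S.lam_eq hQ
  have hm := S.mu_nonneg (S.segQ_nonneg x y ht)
  have : S.lam (S.segQ x y t) * a ≤ S.lam (S.segQ x y t) * C := by
    rw [hl1] at ha ⊢
    nlinarith
  exact le_of_mul_le_mul_left this hl

lemma exists_seg [Nontrivial V] {x y : X} (h : S.K * S.F x y < 2) {t : ℝ}
    (ht : t ∈ Icc (0 : ℝ) 1) :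
    ∃ z, S.F x z = (t * S.F x y - S.mu (S.segQ x y t)) / S.lam (S.segQ x y t) ∧
      S.tan x z = (S.lam (S.segQ x y t))⁻¹ • t • S.tan x y ∧
      ∀ Z, (1 - t) * S.F x Z + t * S.F y Z
        = S.lam (S.segQ x y t) * S.F z Z + S.mu (S.segQ x y t) := by
  obtain ⟨z, h1, h2, h3⟩ := S.exists_proj x (f := t * S.F x y) (τ := t • S.tan x y)
    (mul_nonneg ht.1 (S.F_nonneg x y)) (Q := S.segQ x y t)
    (by
      rw [norm_smul, mul_pow ‖t‖, S.norm_tan_sq, Real.norm_eq_abs, sq_abs, segQ]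
      ring) (S.K_mul_segQ_lt h ht)
  refine ⟨z, h1, h2, fun Z => ?_⟩
  rw [← h3, S.F_law x y Z, real_inner_smul_left]
  ring

open Classical in
/-- The point on the geodesic segment from `x` to `y` that is the projection of the point with
parameter `t` of the chord; `t` is not proportional to the arc length unless `K = 0`. The value is
`x` if `t` is not in `[0, 1]` or if the points are antipodal. -/
noncomputable def seg [Nontrivial V] (x y : X) (t : ℝ) : X :=
  if h : S.K * S.F x y < 2 ∧ t ∈ Icc (0 : ℝ) 1 then (S.exists_seg h.1 h.2).choose else x

section seg

variable [Nontrivial V] {x y : X} {t : ℝ}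

lemma seg_spec' (h : S.K * S.F x y < 2) (ht : t ∈ Icc (0 : ℝ) 1) :
    S.F x (S.seg x y t) = (t * S.F x y - S.mu (S.segQ x y t)) / S.lam (S.segQ x y t) ∧
      S.tan x (S.seg x y t) = (S.lam (S.segQ x y t))⁻¹ • t • S.tan x y ∧
      ∀ Z, (1 - t) * S.F x Z + t * S.F y Z
        = S.lam (S.segQ x y t) * S.F (S.seg x y t) Z + S.mu (S.segQ x y t) := by
  rw [seg, dif_pos ⟨h, ht⟩]
  exact (S.exists_seg h ht).choose_spec

/-- Up to `lam` and `mu`, which do not depend on `Z`, the functions `F · Z` are affine on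
segments. -/
lemma seg_spec (h : S.K * S.F x y < 2) (ht : t ∈ Icc (0 : ℝ) 1) (Z : X) :
    (1 - t) * S.F x Z + t * S.F y Z
      = S.lam (S.segQ x y t) * S.F (S.seg x y t) Z + S.mu (S.segQ x y t) :=
  (S.seg_spec' h ht).2.2 Z

lemma seg_zero (h : S.K * S.F x y < 2) : S.seg x y 0 = x := by
  have := S.seg_spec h ⟨le_rfl, zero_le_one⟩ x
  rw [segQ, F_self] at this
  simp only [mul_zero, zero_mul, S.lam_zero, S.mu_zero] at this
  exact S.eq_of_F_le (by linarith)

lemma seg_one (h : S.K * S.F x y < 2) : S.seg x y 1 = y := by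
  have := S.seg_spec h ⟨zero_le_one, le_rfl⟩ y
  rw [segQ, F_self] at this
  simp only [mul_zero, zero_mul, S.lam_zero, S.mu_zero, sub_self] at this
  exact S.eq_of_F_le (by linarith)

lemma seg_dist (h : S.K * S.F x y < 2) (ht : t ∈ Icc (0 : ℝ) 1) :
    dist x (S.seg x y t) + dist (S.seg x y t) y = dist x y := by
  obtain ⟨h1, h2, h3⟩ := S.seg_spec' h ht
  have hQ := S.K_mul_segQ_lt h ht
  have hl := S.lam_pos hQ
  have hl1 := S.lam_eq hQ
  set z := S.seg x y t
  set l := S.lam (S.segQ x y t)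
  set m := S.mu (S.segQ x y t)
  rcases eq_or_ne x y with rfl | hxy
  · have := h3 x
    have hm : 0 ≤ m := S.mu_nonneg (S.segQ_nonneg x x ht)
    have hz : z = x := by
      apply S.eq_of_F_le
      rw [S.F_self] at this
      nlinarith
    rw [hz]; simp
  have ha : 0 < dist x y := dist_pos.2 hxy
  have hsn := S.sn_pos (S.dist_mem x y) ha h
  have e1 : S.sn (dist x z) = l⁻¹ * t * S.sn (dist x y) := by
    rw [← S.norm_tan, h2, smul_smul, norm_smul, S.norm_tan, Real.norm_of_nonneg
      (mul_nonneg (inv_nonneg.2 hl.le) ht.1)]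
  have e2 : S.F z y = S.md (dist x y - dist x z) := by
    rw [S.F_law x, S.md_sub, e1, h2, smul_smul, real_inner_smul_left, real_inner_self_eq_norm_sq,
      S.norm_tan]
    simp only [F]
    ring
  have e3 : S.sn (dist x y - dist x z) = S.sn (dist x y) * (1 - t) / l := by
    rw [S.sn_sub, e1, show S.md (dist x z) = _ from h1]
    simp only [F]
    field_simp
    linear_combination hl1
  have hle : dist x z ≤ dist x y :=
    S.le_of_sn_sub_nonneg (S.dist_mem x z) ha (by
      rw [e3]; exact div_nonneg (mul_nonneg hsn.le (by linarith [ht.2])) hl.le)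
  have := S.dist_eq_of_F (S.mem_of_le (S.dist_mem x y) (by linarith)
    (by linarith [dist_nonneg (x := x) (y := z)])) e2
  linarith

/-- Balls of radius at most a quarter of a great circle are convex. -/
lemma seg_F_le (h : S.K * S.F x y < 2) (ht : t ∈ Icc (0 : ℝ) 1) {Z : X} {C : ℝ}
    (hC : S.K * C ≤ 1) (hx : S.F x Z ≤ C) (hy : S.F y Z ≤ C) : S.F (S.seg x y t) Z ≤ C := by
  apply S.le_of_lam_mul_add_mu_le h ht hC
  rw [← S.seg_spec h ht Z]
  nlinarith [mul_le_mul_of_nonneg_left hx (sub_nonneg.2 ht.2),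
    mul_le_mul_of_nonneg_left hy ht.1]

end seg

lemma continuous_F {Y : Type*} [TopologicalSpace Y] {f g : Y → X} (hf : Continuous f)
    (hg : Continuous g) : Continuous fun a => S.F (f a) (g a) :=
  S.continuous_md.comp (hf.dist hg)

lemma tendsto_of_F {ι : Type*} {l : Filter ι} {g : ι → X} {z : X}
    (h : Tendsto (fun i => S.F (g i) z) l (𝓝 0)) : Tendsto g l (𝓝 z) := by
  rw [Metric.tendsto_nhds]
  intro ε hε
  by_cases hd : ε ∈ S.dom
  · filter_upwards [h.eventually_lt_const (S.md_pos hd hε)] with i hi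
    exact (S.dist_lt_iff hd).2 hi
  · refine Eventually.of_forall fun i => ?_
    by_contra! hle
    exact hd (S.mem_of_le (S.dist_mem _ _) hε.le hle)

lemma continuous_lam_segQ (x : X) :
    Continuous (fun p : X × ℝ => S.lam (S.segQ x p.1 p.2)) := by
  have : Continuous fun p : X × ℝ => S.F x p.1 := S.continuous_F (by fun_prop) (by fun_prop)
  unfold lam segQ
  fun_prop

lemma continuous_mu_segQ (x : X) :
    Continuous (fun p : X × ℝ => S.mu (S.segQ x p.1 p.2)) := by
  have : Continuous fun p : X × ℝ => S.F x p.1 := S.continuous_F (by fun_prop) (by fun_prop)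
  have h2 := S.continuous_lam_segQ x
  unfold mu
  refine Continuous.div ?_ (by fun_prop) fun p => by linarith [S.lam_nonneg (S.segQ x p.1 p.2)]
  unfold segQ
  fun_prop

lemma continuousOn_seg [Nontrivial V] (x : X) :
    ContinuousOn (fun p : X × ℝ => S.seg x p.1 p.2)
      {p | S.K * S.F x p.1 < 2 ∧ p.2 ∈ Icc (0 : ℝ) 1} := by
  rintro ⟨y, t⟩ ⟨h, ht⟩
  apply S.tendsto_of_F
  set z := S.seg x y t
  have hl := S.lam_pos (S.K_mul_segQ_lt h ht)
  have h1 : Tendsto (fun p : X × ℝ => ((1 - p.2) * S.F x z + p.2 * S.F p.1 z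
      - S.mu (S.segQ x p.1 p.2)) / S.lam (S.segQ x p.1 p.2)) (𝓝 (y, t)) (𝓝 0) := by
    have hc : ContinuousAt (fun p : X × ℝ => ((1 - p.2) * S.F x z + p.2 * S.F p.1 z
      - S.mu (S.segQ x p.1 p.2)) / S.lam (S.segQ x p.1 p.2)) (y, t) := by
      have : Continuous fun p : X × ℝ => S.F p.1 z := S.continuous_F (by fun_prop) (by fun_prop)
      have h2 := S.continuous_lam_segQ x
      have h3 := S.continuous_mu_segQ x
      exact ContinuousAt.div (by fun_prop) h2.continuousAt hl.ne'
    have e : ((1 - t) * S.F x z + t * S.F y z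
      - S.mu (S.segQ x y t)) / S.lam (S.segQ x y t) = 0 := by
      rw [S.seg_spec h ht, S.F_self]; simp
    have := hc.tendsto
    rwa [e] at this
  refine (h1.mono_left nhdsWithin_le_nhds).congr' ?_
  filter_upwards [self_mem_nhdsWithin] with p hp
  have := S.seg_spec hp.1 hp.2 z
  rw [this, add_sub_cancel_right, mul_div_cancel_left₀ _
    (S.lam_pos (S.K_mul_segQ_lt hp.1 hp.2)).ne']

lemma continuousOn_seg_right [Nontrivial V] {x y : X} (h : S.K * S.F x y < 2) :
    ContinuousOn (S.seg x y) (Icc 0 1) :=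
  (S.continuousOn_seg x).comp (f := fun t : ℝ => (y, t)) (by fun_prop) fun _ ht => ⟨h, ht⟩

end SpaceForm
end ConstCurv

namespace ConstCurv

/-! ### Tangent balls and the support principle -/

lemma exists_unit_orthogonal {V : Type*} [NormedAddCommGroup V] [InnerProductSpace ℝ V]
    (hV : 2 ≤ Module.finrank ℝ V) (u : V) : ∃ w : V, ‖w‖ = 1 ∧ inner ℝ u w = 0 := by
  have : FiniteDimensional ℝ V := Module.finite_of_finrank_pos (by omega)
  have h1 := Submodule.finrank_add_finrank_orthogonal (ℝ ∙ u)
  have h2 : Module.finrank ℝ (ℝ ∙ u) ≤ 1 := finrank_span_le_card ({u} : Set V) |>.trans (by simp)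
  have h3 : 0 < Module.finrank ℝ (ℝ ∙ u)ᗮ := by omega
  have : Nontrivial (ℝ ∙ u)ᗮ := Module.finrank_pos_iff.1 h3
  obtain ⟨w, hw⟩ := exists_norm_eq (ℝ ∙ u)ᗮ (zero_le_one (α := ℝ))
  exact ⟨w, by simpa using hw, Submodule.mem_orthogonal_singleton_iff_inner_right.1 w.2⟩

namespace SpaceForm

variable {X V : Type} [MetricSpace X] [NormedAddCommGroup V] [InnerProductSpace ℝ V]
variable (S : SpaceForm X V)

lemma K_md_lt_two_of_lt {s t : ℝ} (hs : s ∈ S.dom) (ht : t ∈ S.dom) (h : s < t) :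
    S.K * S.md s < 2 := by
  have hlt : S.md s < S.md t := (S.lt_iff hs ht).2 h
  have h4 := S.K_md_le ht
  have h5 := S.md_nonneg hs
  rcases le_or_gt S.K 0 with hc | hc <;> nlinarith

/-- The distance from `Z` has no local maximum at a point that is not antipodal to `Z`. -/
lemma not_eventually_dist_le [Nontrivial V] {Z q : X} (h : S.K * S.F Z q < 2) :
    ¬ ∀ᶠ p in 𝓝 q, dist Z p ≤ dist Z q := by
  intro hev
  obtain ⟨ε, hε, hball⟩ := Metric.eventually_nhds_iff.1 hev
  obtain ⟨t, ht, hlt, -⟩ := S.exists_gt (S.dist_mem Z q) h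
  have hr : min t (dist Z q + ε / 2) ∈ S.dom :=
    S.mem_of_le ht (le_min (S.nonneg_of_mem t ht) (by positivity)) (min_le_left _ _)
  have hgt : dist Z q < min t (dist Z q + ε / 2) := lt_min hlt (by linarith)
  obtain ⟨p, hp, hqp⟩ := S.exists_extension Z q hr hgt.le
  have := hball (y := p) (by
    rw [dist_comm, hqp]; linarith [min_le_right t (dist Z q + ε / 2)])
  linarith

/-- Extensions of segments depend continuously on the segments. -/
lemma tendsto_extension [ProperSpace X] (S : SpaceForm X V) {ι : Type*} {l : Filter ι}
    {z y q : ι → X} {z₀ y₀ P : X} (hz : Tendsto z l (𝓝 z₀)) (hy : Tendsto y l (𝓝 y₀))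
    (hne : y₀ ≠ z₀) (hq : ∀ᶠ i in l, dist (z i) (y i) + dist (y i) (q i) = dist (z i) (q i))
    (hd : Tendsto (fun i => dist (y i) (q i)) l (𝓝 (dist y₀ P)))
    (hP : dist z₀ y₀ + dist y₀ P = dist z₀ P) : Tendsto q l (𝓝 P) := by
  have hbd : ∀ᶠ i in l, q i ∈ Metric.closedBall y₀ (dist y₀ P + 2) := by
    filter_upwards [hd.eventually_lt_const (show dist y₀ P < dist y₀ P + 1 by linarith),
      (Metric.tendsto_nhds.1 hy) 1 one_pos] with i h1 h2
    rw [Metric.mem_closedBall]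
    linarith [dist_triangle (q i) (y i) y₀, dist_comm (q i) (y i)]
  refine (isCompact_closedBall y₀ (dist y₀ P + 2)).tendsto_nhds_of_unique_mapClusterPt hbd
    fun p _ hp => ?_
  obtain ⟨U, hU, hUp⟩ := mapClusterPt_iff_ultrafilter.1 hp
  have hz' := hz.mono_left hU
  have hy' := hy.mono_left hU
  have e1 : dist y₀ p = dist y₀ P := tendsto_nhds_unique (hy'.dist hUp) (hd.mono_left hU)
  have e2 : dist z₀ y₀ + dist y₀ p = dist z₀ p :=
    tendsto_nhds_unique_of_eventuallyEq ((hz'.dist hy').add (hy'.dist hUp)) (hz'.dist hUp)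
      (hq.filter_mono hU)
  exact S.extension_unique hne e2 hP (by linarith)

/-- A segment that leaves the interior of `D` meets the boundary of `D`. -/
lemma exists_seg_mem_frontier [Nontrivial V] {D : Set X} {y q : X} (h : S.K * S.F y q < 2)
    (hy : y ∈ interior D) (hq : q ∉ interior D) :
    ∃ t ∈ Icc (0 : ℝ) 1, S.seg y q t ∈ frontier D := by
  by_contra! hcon
  have hpre : IsPreconnected (S.seg y q '' Icc 0 1) :=
    isPreconnected_Icc.image _ (S.continuousOn_seg_right h)
  have h0 : y ∈ S.seg y q '' Icc 0 1 := ⟨0, ⟨le_rfl, zero_le_one⟩, S.seg_zero h⟩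
  have h1 : q ∈ S.seg y q '' Icc 0 1 := ⟨1, ⟨zero_le_one, le_rfl⟩, S.seg_one h⟩
  refine hq (hpre.subset_of_closure_inter_subset isOpen_interior ⟨y, h0, hy⟩ ?_ h1)
  rintro _ ⟨hp, t, ht, rfl⟩
  by_contra hn
  exact hcon t ht ⟨closure_mono interior_subset hp, hn⟩

/-- A point is an inner point of `D` if it is nearer to an inner point than the boundary. -/
lemma mem_interior_of_dist_lt [Nontrivial V] (S : SpaceForm X V) {D : Set X} {x y : X} (hx : x ∈ interior D)
    (hne : (frontier D).Nonempty) (h : dist x y < Metric.infDist x (frontier D)) :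
    y ∈ interior D := by
  obtain ⟨P, hP⟩ := hne
  have hK : S.K * S.F x y < 2 := S.K_md_lt_two_of_lt (S.dist_mem x y) (S.dist_mem x P)
    (h.trans_le (Metric.infDist_le_dist_of_mem hP))
  by_contra hy
  obtain ⟨t, ht, hf⟩ := S.exists_seg_mem_frontier hK hx hy
  have h1 := Metric.infDist_le_dist_of_mem (x := x) hf
  have h2 := S.seg_dist hK ht
  linarith [dist_nonneg (x := S.seg x y t) (y := y)]

/-- If the ball about `x` through `P` lies near `P` inside the ball about `Z` through `P`, then
`x` lies on the segment from `Z` to `P`. This compares first the normals of the two spheres at `P`,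
then their curvatures. -/
lemma dist_add_dist_of_locally_inside (hV : 2 ≤ Module.finrank ℝ V) {x Z P : X}
    (ha : x ≠ P) (hb : Z ≠ P) (hbK : S.K * S.F P Z < 2)
    (h : ∀ᶠ p in 𝓝 P, dist x p < dist x P → dist Z p ≤ dist Z P) :
    dist Z x + dist x P = dist Z P := by
  have : Nontrivial V := Module.nontrivial_of_finrank_pos (R := ℝ) (by omega)
  have ha' : 0 < dist P x := dist_pos.2 ha.symm
  have hb' : 0 < dist P Z := dist_pos.2 hb.symm
  set u := S.tan P x with hu
  set w := S.tan P Z with hw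
  set ca := 1 - S.K * S.F P x with hca
  set cb := 1 - S.K * S.F P Z with hcb
  have hsb : 0 < S.sn (dist P Z) := S.sn_pos (S.dist_mem P Z) hb' hbK
  -- `k s = md s / sn s`, in a form that is continuous at `0`
  set k : ℝ → ℝ := fun s => S.sn s / (2 - S.K * S.md s) with hk
  have hkt : Tendsto k (𝓝[>] 0) (𝓝 0) := by
    have : ContinuousAt k 0 := by
      refine S.continuous_sn.continuousAt.div
        (continuous_const.sub (continuous_const.mul S.continuous_md)).continuousAt ?_
      rw [S.md_zero]; norm_num
    have h2 := this.tendsto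
    rw [show k 0 = 0 by simp [hk, S.sn_zero]] at h2
    exact h2.mono_left nhdsWithin_le_nhds
  -- the hypothesis, for the point at the small distance `s` from `P` in the direction `v`
  obtain ⟨ε, hε, hball⟩ := Metric.eventually_nhds_iff.1 h
  obtain ⟨t₀, ht₀, ht₀0, ht₀K⟩ := S.exists_gt S.zero_mem (by rw [S.md_zero]; norm_num)
  have key : ∀ᶠ s in 𝓝[>] (0 : ℝ), 0 < k s ∧ ∀ v : V, ‖v‖ = 1 →
      k s * ca < inner ℝ u v → k s * cb ≤ inner ℝ w v := by
    filter_upwards [Ioo_mem_nhdsGT (lt_min ht₀0 hε)] with s hs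
    have hsd : s ∈ S.dom := S.mem_of_le ht₀ hs.1.le (hs.2.le.trans (min_le_left _ _))
    have hsK : S.K * S.md s < 2 := S.K_md_lt_of_le two_pos hsd ht₀
      (hs.2.le.trans (min_le_left _ _)) ht₀K
    have hsn : 0 < S.sn s := S.sn_pos hsd hs.1 hsK
    have hks : 0 < k s := div_pos hsn (by linarith)
    have hmd : S.md s = k s * S.sn s := by
      simp only [hk]
      have := S.sn_sq s
      have h2 : 2 - S.K * S.md s ≠ 0 := by linarith
      rw [div_mul_eq_mul_div, eq_div_iff h2]
      linarith
    refine ⟨hks, fun v hv hlt => ?_⟩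
    obtain ⟨p, hp, hpt⟩ := S.exists_exp P s hsd v hv
    have hFp : S.F P p = k s * S.sn s := by rw [F, hp, hmd]
    have e1 : S.F x p = S.F P x + S.sn s * (k s * ca - inner ℝ u v) := by
      rw [S.F_law P, hFp, hpt, real_inner_smul_right, hca, hu]; ring
    have e2 : S.F Z p = S.F P Z + S.sn s * (k s * cb - inner ℝ w v) := by
      rw [S.F_law P, hFp, hpt, real_inner_smul_right, hcb, hw]; ring
    have h1 : dist x p < dist x P := by
      rw [S.dist_lt_iff (S.dist_mem x P)]
      change _ < S.F x P
      rw [e1, S.F_comm x P]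
      nlinarith
    have h2 := hball (y := p) (by rw [dist_comm, hp]; exact hs.2.trans_le (min_le_right _ _)) h1
    rw [S.dist_le_iff (S.dist_mem Z P)] at h2
    change _ ≤ S.F Z P at h2
    rw [e2, S.F_comm Z P] at h2
    nlinarith
  have hlim : ∀ c, Tendsto (fun s => k s * c) (𝓝[>] 0) (𝓝 0) := fun c => by
    simpa using hkt.mul_const c
  have hnu : ‖u‖ = S.sn (dist P x) := S.norm_tan P x
  have hnw : ‖w‖ = S.sn (dist P Z) := S.norm_tan P Z
  have hu0 : u ≠ 0 := by
    intro h0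
    -- otherwise `x` is antipodal to `P`, and all points near `P` are nearer to `x` than `P`
    have hca' : ca = -1 := by
      have h1 := S.norm_tan_sq P x
      rw [← hu, h0, norm_zero] at h1
      have h2 : 0 < S.F P x := S.md_pos (S.dist_mem P x) ha'
      have : S.F P x * (2 - S.K * S.F P x) = 0 := by linarith
      rcases mul_eq_zero.1 this with h | h <;> linarith
    have hw0 : w ≠ 0 := by rw [← norm_ne_zero_iff, hnw]; exact hsb.ne'
    have hle : ∀ᶠ s in 𝓝[>] (0 : ℝ), k s * cb ≤ inner ℝ w (-(‖w‖⁻¹ • w)) := by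
      filter_upwards [key] with s hs
      refine hs.2 _ (by rw [norm_neg]; exact norm_smul_inv_norm hw0) ?_
      rw [h0, inner_zero_left, hca']
      linarith [hs.1]
    have := le_of_tendsto (hlim cb) hle
    rw [inner_neg_right, real_inner_smul_right, real_inner_self_eq_norm_sq, hnw] at this
    have h3 : (S.sn (dist P Z))⁻¹ * S.sn (dist P Z) ^ 2 = S.sn (dist P Z) := by field_simp
    linarith
  have hsa : 0 < S.sn (dist P x) := by rw [← hnu]; exact norm_pos_iff.2 hu0
  -- the limit `s → 0`: the half-spaces bounded by the tangent hyperplanes are nested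
  have hdir : ∀ v : V, 0 < inner ℝ u v → 0 ≤ inner ℝ w v := by
    intro v hv
    have hv0 : v ≠ 0 := by rintro rfl; simp at hv
    have hv' : 0 < inner ℝ u (‖v‖⁻¹ • v) := by
      rw [real_inner_smul_right]; exact mul_pos (inv_pos.2 (norm_pos_iff.2 hv0)) hv
    have hle : ∀ᶠ s in 𝓝[>] (0 : ℝ), k s * cb ≤ inner ℝ w (‖v‖⁻¹ • v) := by
      filter_upwards [key, (hlim ca).eventually_lt_const hv'] with s hs hs2
      exact hs.2 _ (norm_smul_inv_norm hv0) hs2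
    have := le_of_tendsto (hlim cb) hle
    rw [real_inner_smul_right] at this
    exact nonneg_of_mul_nonneg_right this (inv_pos.2 (norm_pos_iff.2 hv0))
  -- hence `w` is a non-negative multiple of `u`
  set β := inner ℝ w u / ‖u‖ ^ 2 with hβ
  have hun : 0 < ‖u‖ ^ 2 := by positivity
  have hβ0 : 0 ≤ β := div_nonneg (hdir u (by rw [real_inner_self_eq_norm_sq]; exact hun)) hun.le
  have hwβ : w = β • u := by
    set d := w - β • u with hd
    have hdu : inner ℝ u d = 0 := by
      rw [hd, inner_sub_right, real_inner_smul_right, real_inner_self_eq_norm_sq, hβ,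
        real_inner_comm]
      field_simp
      ring
    have hwd : w = d + β • u := by rw [hd]; abel
    have hwd2 : inner ℝ w d = ‖d‖ ^ 2 := by
      conv_lhs => rw [hwd]
      rw [inner_add_left, real_inner_smul_left, hdu, real_inner_self_eq_norm_sq]; ring
    by_contra hne
    have hd0 : 0 < ‖d‖ ^ 2 := by
      have : d ≠ 0 := fun h0 => hne (by rw [hwd, h0, zero_add])
      positivity
    set η := ‖d‖ ^ 2 / (2 * (β * ‖u‖ ^ 2 + 1)) with hη
    have hden : 0 < 2 * (β * ‖u‖ ^ 2 + 1) := by positivity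
    have hη0 : 0 < η := div_pos hd0 hden
    have h1 := hdir (-d + η • u) (by
      rw [inner_add_right, inner_neg_right, hdu, real_inner_smul_right,
        real_inner_self_eq_norm_sq]
      simp only [neg_zero, zero_add]; positivity)
    rw [inner_add_right, inner_neg_right, real_inner_smul_right, hwd2] at h1
    have h2 : inner ℝ w u = β * ‖u‖ ^ 2 := by rw [hβ]; field_simp
    rw [h2] at h1
    have h3 : η * (2 * (β * ‖u‖ ^ 2 + 1)) = ‖d‖ ^ 2 := by rw [hη]; field_simp
    nlinarith
  -- comparison of the curvatures: let a direction tend to the point at distance `s` from `P`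
  -- on the sphere about `x`, in a plane that contains `u`
  have hcurv : cb ≤ β * ca := by
    obtain ⟨n, hn1, hn2⟩ := exists_unit_orthogonal hV u
    obtain ⟨s, ⟨hks, hs⟩, hs1, hs2⟩ := (key.and (((hlim ca).eventually_lt_const hsa).and
      ((hlim ca).eventually_const_lt (neg_lt_zero.2 hsa)))).exists
    have hθ : ∀ᶠ θ in 𝓝[>] (k s * ca / S.sn (dist P x)), k s * cb ≤ β * (θ * S.sn (dist P x)) := by
      have hlt1 : k s * ca / S.sn (dist P x) < 1 := by rwa [div_lt_one hsa]
      have hlt2 : -1 < k s * ca / S.sn (dist P x) := by rw [lt_div_iff₀ hsa]; linarith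
      filter_upwards [Ioo_mem_nhdsGT hlt1] with θ hθ
      have hθ1 : 0 ≤ 1 - θ ^ 2 := by nlinarith [hθ.1, hθ.2]
      have hin : inner ℝ u (θ • (‖u‖⁻¹ • u) + √(1 - θ ^ 2) • n) = θ * S.sn (dist P x) := by
        rw [inner_add_right, real_inner_smul_right, real_inner_smul_right, real_inner_smul_right,
          hn2, real_inner_self_eq_norm_sq, ← hnu]
        have := norm_ne_zero_iff.2 hu0
        field_simp
        ring
      have hnorm : ‖θ • (‖u‖⁻¹ • u) + √(1 - θ ^ 2) • n‖ = 1 := by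
        have hunit : ‖‖u‖⁻¹ • u‖ = 1 := norm_smul_inv_norm hu0
        have : ‖θ • (‖u‖⁻¹ • u) + √(1 - θ ^ 2) • n‖ ^ 2 = 1 := by
          rw [norm_add_sq_real, norm_smul θ, norm_smul (√(1 - θ ^ 2)), hunit, hn1,
            real_inner_smul_left, real_inner_smul_left, real_inner_smul_right, hn2,
            Real.norm_eq_abs, Real.norm_eq_abs, mul_one, mul_one, sq_abs, sq_abs,
            Real.sq_sqrt hθ1]
          ring
        exact (pow_eq_one_iff_of_nonneg (norm_nonneg _) two_ne_zero).1 this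
      have h1 := hs _ hnorm (by rw [hin]; have := hθ.1; rwa [div_lt_iff₀ hsa] at this)
      rwa [hwβ, real_inner_smul_left, hin] at h1
    have hcont : Tendsto (fun θ => β * (θ * S.sn (dist P x)))
        (𝓝[>] (k s * ca / S.sn (dist P x)))
        (𝓝 (β * (k s * ca / S.sn (dist P x) * S.sn (dist P x)))) :=
      ((continuous_const.mul (continuous_id.mul continuous_const)).tendsto _).mono_left
        nhdsWithin_le_nhds
    have := ge_of_tendsto hcont hθ
    rw [div_mul_cancel₀ _ hsa.ne'] at this
    nlinarith
  have hsβ : S.sn (dist P Z) = β * S.sn (dist P x) := by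
    rw [← hnw, ← hnu, hwβ, norm_smul, Real.norm_of_nonneg hβ0]
  have hle : dist P x ≤ dist P Z := by
    apply S.le_of_sn_sub_nonneg (S.dist_mem P x) hb'
    rw [S.sn_sub, hsβ]
    have : 0 ≤ S.sn (dist P x) * (β * ca - cb) := mul_nonneg hsa.le (by linarith)
    simp only [hca, hcb, F] at this
    linarith
  have hF : S.F Z x = S.md (dist P Z - dist P x) := by
    rw [S.F_law P, S.md_sub, ← hw, ← hu, hwβ, real_inner_smul_left, real_inner_self_eq_norm_sq,
      hnu, hsβ]
    simp only [F]
    ring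
  have := S.dist_eq_of_F (S.mem_of_le (S.dist_mem P Z) (by linarith) (by linarith)) hF
  rw [this, dist_comm x P, dist_comm Z P]
  ring

/-- If `g` is locally supported from below by functions `F · Z` along the segment from `x` to `y`,
then it satisfies the inequality of convexity for which the functions `F · Z` give equality. -/
lemma le_chord_of_support [Nontrivial V] {g : X → ℝ} {x y : X} (h : S.K * S.F x y < 2)
    (hg : ContinuousOn (fun t => g (S.seg x y t)) (Icc 0 1))
    (hsup : ∀ t ∈ Ioo (0 : ℝ) 1, ∃ Z, S.F (S.seg x y t) Z = g (S.seg x y t) ∧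
      ∀ᶠ p in 𝓝 (S.seg x y t), S.F p Z ≤ g p) {t : ℝ} (ht : t ∈ Icc (0 : ℝ) 1) :
    S.lam (S.segQ x y t) * g (S.seg x y t) + S.mu (S.segQ x y t) ≤ (1 - t) * g x + t * g y := by
  set f : ℝ → ℝ := fun t => S.lam (S.segQ x y t) * g (S.seg x y t) + S.mu (S.segQ x y t) with hf
  have hfc : ContinuousOn f (Icc 0 1) := by
    have h1 : Continuous fun t : ℝ => S.lam (S.segQ x y t) :=
      (S.continuous_lam_segQ x).comp (f := fun t : ℝ => (y, t)) (by fun_prop)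
    have h2 : Continuous fun t : ℝ => S.mu (S.segQ x y t) :=
      (S.continuous_mu_segQ x).comp (f := fun t : ℝ => (y, t)) (by fun_prop)
    exact (h1.continuousOn.mul hg).add h2.continuousOn
  have h0 : f 0 = g x := by
    simp only [hf, S.seg_zero h, segQ]
    simp [S.lam_zero, S.mu_zero]
  have h1 : f 1 = g y := by
    simp only [hf, S.seg_one h, segQ]
    simp [S.lam_zero, S.mu_zero]
  have := le_chord_of_local_support hfc (fun s hs => ?_) t ht
  · rwa [h0, h1] at this
  · obtain ⟨Z, hZ, hev⟩ := hsup s hs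
    refine ⟨S.F y Z - S.F x Z, S.F x Z, ?_, ?_⟩
    · simp only [hf]
      rw [← hZ, ← S.seg_spec h (Ioo_subset_Icc_self hs)]
      ring
    · have hc : ContinuousAt (S.seg x y) s :=
        (S.continuousOn_seg_right h).continuousAt (Icc_mem_nhds hs.1 hs.2)
      filter_upwards [hc.eventually hev, Ioo_mem_nhds hs.1 hs.2] with r hr hr2
      have hr3 := Ioo_subset_Icc_self hr2
      have e := S.seg_spec h hr3 Z
      simp only [hf]
      have := mul_le_mul_of_nonneg_left hr (S.lam_nonneg (S.segQ x y r))
      linarith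

/-- A local support of `g` at `x` is a support on the whole segment from `x` to `y`. -/
lemma F_le_of_support [Nontrivial V] {g : X → ℝ} {x y : X} (h : S.K * S.F x y < 2)
    (hg : ContinuousOn (fun t => g (S.seg x y t)) (Icc 0 1))
    (hsup : ∀ t ∈ Ioo (0 : ℝ) 1, ∃ Z, S.F (S.seg x y t) Z = g (S.seg x y t) ∧
      ∀ᶠ p in 𝓝 (S.seg x y t), S.F p Z ≤ g p) {Z : X} (hZ : S.F x Z = g x)
    (hZ' : ∀ᶠ p in 𝓝 x, S.F p Z ≤ g p) : S.F y Z ≤ g y := by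
  have hc : Tendsto (S.seg x y) (𝓝[>] 0) (𝓝 x) := by
    have := (S.continuousOn_seg_right h).continuousWithinAt (left_mem_Icc.2 zero_le_one)
    rw [ContinuousWithinAt, S.seg_zero h] at this
    exact this.mono_left (by
      rw [← nhdsWithin_Ioo_eq_nhdsGT (zero_lt_one' ℝ)]
      exact nhdsWithin_mono _ Ioo_subset_Icc_self)
  obtain ⟨t, hr, ht⟩ := ((hc.eventually hZ').and (Ioo_mem_nhdsGT (zero_lt_one' ℝ))).exists
  have ht' := Ioo_subset_Icc_self ht
  have h1 := S.le_chord_of_support h hg hsup ht'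
  have h2 := S.seg_spec h ht' Z
  have h3 := mul_le_mul_of_nonneg_left hr (S.lam_nonneg (S.segQ x y t))
  rw [hZ] at h2
  have : t * S.F y Z ≤ t * g y := by linarith
  exact le_of_mul_le_mul_left this ht.1

end SpaceForm
end ConstCurv

namespace ConstCurv

/-! ### Rolling in an outer ball -/

namespace SpaceForm

variable {X V : Type} [MetricSpace X] [NormedAddCommGroup V] [InnerProductSpace ℝ V]
variable (S : SpaceForm X V)

/-- Near a boundary point with a locally inscribed ball there are inner points whose nearest
boundary point it is. -/
lemma exists_nearest_eq [Nontrivial V] (S : SpaceForm X V) {D : Set X} {P O : X} {R : ℝ}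
    (hP : P ∈ frontier D) (hR : 0 < R) (hO : dist O P = R)
    (hin : ∀ᶠ x in 𝓝 P, dist O x ≤ R → x ∈ D) :
    ∃ x ∈ interior D, dist x P = Metric.infDist x (frontier D) := by
  obtain ⟨ε, hε, hball⟩ := Metric.eventually_nhds_iff.1 hin
  set s := min (ε / 2) R with hs
  have hs0 : 0 < s := lt_min (by positivity) hR
  have hs1 : s ≤ ε / 2 := min_le_left _ _
  obtain ⟨x, hx, hxO⟩ := S.exists_between_dist P O hs0.le
    (by rw [dist_comm P O, hO]; exact min_le_right _ _)
  have hsub : Metric.ball x s ⊆ D := by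
    intro y hy
    rw [Metric.mem_ball] at hy
    apply hball
    · linarith [dist_triangle y x P, dist_comm x P]
    · linarith [dist_triangle O x y, dist_comm O x, dist_comm y x, dist_comm P O]
  have hint : Metric.ball x s ⊆ interior D := interior_maximal hsub Metric.isOpen_ball
  refine ⟨x, hint (Metric.mem_ball_self hs0), le_antisymm ?_ (Metric.infDist_le_dist_of_mem hP)⟩
  refine (Metric.le_infDist ⟨P, hP⟩).2 fun {Q} hQ => ?_
  by_contra! hlt
  refine hQ.2 (hint ?_)
  rw [Metric.mem_ball]
  linarith [dist_comm Q x, dist_comm P x]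

section Outer

variable {D : Set X} {x P Z Z' : X} {R R' : ℝ}

/-- The centre of an outer ball at `P` lies on the extension beyond `x` of the segment from `P` to
`x`, for any inner point `x` with nearest boundary point `P`. -/
lemma dist_add_of_nearest (hV : 2 ≤ Module.finrank ℝ V) (hx : x ∈ interior D)
    (hP : P ∈ frontier D) (hn : dist x P = Metric.infDist x (frontier D)) (hR : 0 < R)
    (hRK : S.K * S.md R < 2) (hZ : dist Z P = R) (hout : ∀ᶠ p in 𝓝 P, p ∈ D → dist Z p ≤ R) :
    dist Z x + dist x P = R := by
  have : Nontrivial V := Module.nontrivial_of_finrank_pos (R := ℝ) (by omega)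
  rw [← hZ]
  apply S.dist_add_dist_of_locally_inside hV
  · rintro rfl; exact hP.2 hx
  · rintro rfl; rw [dist_self] at hZ; linarith
  · rw [F, dist_comm, hZ]; exact hRK
  · filter_upwards [hout] with p hp hlt
    rw [hZ]
    rw [hn] at hlt
    exact hp (interior_subset (S.mem_interior_of_dist_lt hx ⟨P, hP⟩ hlt))

/-- The larger ball of radius `R'` about `Z'`, tangent at `P` to the outer ball, bounds the distance
from the boundary near `x`: for `y` near `x`, the point of its sphere on the ray from `Z'` through `y`
is near `P`, hence not an inner point of `D`. As `R < R'`, the point `x` differs from `Z'`, so that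
this ray depends continuously on `y`. -/
lemma eventually_dist_add_infDist_le [ProperSpace X] (hV : 2 ≤ Module.finrank ℝ V)
    (hx : x ∈ interior D) (hP : P ∈ frontier D)
    (hn : dist x P = Metric.infDist x (frontier D)) (hR : 0 < R)
    (hRR' : R < R') (hR' : R' ∈ S.dom) (hRK : S.K * S.md R' < 2) (hZ : dist Z P = R)
    (hout : ∀ᶠ p in 𝓝 P, p ∈ D → dist Z p ≤ R) (hZ' : dist Z' P = R')
    (hZZ' : dist Z Z' = R' - R) :
    dist Z' x + Metric.infDist x (frontier D) = R' ∧
      ∀ᶠ y in 𝓝 x, dist Z' y + Metric.infDist y (frontier D) ≤ R' := by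
  have : Nontrivial V := Module.nontrivial_of_finrank_pos (R := ℝ) (by omega)
  have hRK' : S.K * S.md R < 2 :=
    S.K_md_lt_of_le two_pos (S.mem_of_le hR' hR.le hRR'.le) hR' hRR'.le hRK
  have hadd := S.dist_add_of_nearest hV hx hP hn hR hRK' hZ hout
  have hxP : 0 < dist x P := dist_pos.2 (by rintro rfl; exact hP.2 hx)
  have hadd' : dist Z' x + dist x P = R' := by
    apply le_antisymm
    · linarith [dist_triangle Z' Z x, dist_comm Z Z']
    · linarith [dist_triangle Z' x P]
  refine ⟨by rw [← hn]; exact hadd', ?_⟩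
  have hclose : ∀ᶠ y in 𝓝 x, dist Z' y < R' :=
    (continuous_const.dist continuous_id).continuousAt.eventually_lt_const
      (show dist Z' x < R' by linarith)
  have hq : ∀ y, ∃ q, dist Z' y < R' → dist Z' q = R' ∧ dist y q = R' - dist Z' y := by
    intro y
    by_cases h : dist Z' y < R'
    · obtain ⟨q, h1, h2⟩ := S.exists_extension Z' y hR' h.le
      exact ⟨q, fun _ => ⟨h1, h2⟩⟩
    · exact ⟨y, fun h' => absurd h' h⟩
  choose q hq using hq
  have hqP : Tendsto q (𝓝 x) (𝓝 P) := by
    refine S.tendsto_extension (z := fun _ => Z') (y := id) tendsto_const_nhds tendsto_id ?_ ?_ ?_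
      (hadd'.trans hZ'.symm)
    · rintro rfl
      rw [dist_self] at hadd'
      linarith [dist_nonneg (x := Z) (y := x)]
    · filter_upwards [hclose] with y hy
      obtain ⟨h1, h2⟩ := hq y hy
      simp only [id]
      linarith
    · have : Tendsto (fun y => R' - dist Z' y) (𝓝 x) (𝓝 (R' - dist Z' x)) :=
        (continuous_const.sub (continuous_const.dist continuous_id)).tendsto x
      rw [show dist x P = R' - dist Z' x by linarith]
      refine this.congr' ?_
      filter_upwards [hclose] with y hy
      exact (hq y hy).2.symm
  -- points at distance `R'` from `Z'` near `P` are not inner points of `D`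
  have hnot : ∀ᶠ p in 𝓝 P, dist Z' p = R' → p ∉ interior D := by
    filter_upwards [eventually_eventually_nhds.2 hout] with p hp hpR hpint
    apply S.not_eventually_dist_le (Z := Z') (q := p) (by rw [F, hpR]; exact hRK)
    filter_upwards [hp, mem_interior_iff_mem_nhds.1 hpint] with r hr hrD
    linarith [hr hrD, dist_triangle Z' Z r, dist_comm Z Z']
  filter_upwards [hclose, hqP.eventually hnot, isOpen_interior.mem_nhds hx] with y hy hny hyD
  obtain ⟨h1, h2⟩ := hq y hy
  have hK : S.K * S.F y (q y) < 2 := S.K_md_lt_of_le two_pos (S.dist_mem _ _) hR'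
    (by rw [h2]; linarith [dist_nonneg (x := Z') (y := y)]) hRK
  obtain ⟨t, ht, hf⟩ := S.exists_seg_mem_frontier hK hyD (hny h1)
  have h3 := S.seg_dist hK ht
  have h4 := Metric.infDist_le_dist_of_mem (x := y) hf
  linarith [dist_nonneg (x := S.seg y (q y) t) (y := q y)]

/-- Support of `md (R' - u)` at `x`, where `u` is the distance from the boundary of `D`. -/
lemma support_outer [ProperSpace X] (hV : 2 ≤ Module.finrank ℝ V)
    (hx : x ∈ interior D) (hP : P ∈ frontier D)
    (hn : dist x P = Metric.infDist x (frontier D)) (hR : 0 < R)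
    (hRR' : R < R') (hR' : R' ∈ S.dom) (hRK : S.K * S.md R' < 2) (hZ : dist Z P = R)
    (hout : ∀ᶠ p in 𝓝 P, p ∈ D → dist Z p ≤ R) (hZ' : dist Z' P = R')
    (hZZ' : dist Z Z' = R' - R) :
    S.F x Z' = S.md (R' - Metric.infDist x (frontier D)) ∧
      ∀ᶠ y in 𝓝 x, S.F y Z' ≤ S.md (R' - Metric.infDist y (frontier D)) := by
  obtain ⟨h1, h2⟩ := S.eventually_dist_add_infDist_le hV hx hP hn hR hRR' hR' hRK hZ hout hZ' hZZ'
  refine ⟨by rw [F, dist_comm, ← h1, add_sub_cancel_right], ?_⟩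
  filter_upwards [h2] with y hy
  have h0 : 0 ≤ Metric.infDist y (frontier D) := Metric.infDist_nonneg
  refine (S.le_iff (S.dist_mem _ _) (S.mem_of_le hR' ?_ (by linarith))).2 ?_
  · linarith [dist_nonneg (x := Z') (y := y)]
  · rw [dist_comm]; linarith

/-- Every boundary point of `D` has a ball of radius `R` that contains `D` locally. -/
def HasOuterBalls (D : Set X) (R : ℝ) : Prop :=
  ∀ P ∈ frontier D, ∃ Z, dist Z P = R ∧ ∀ᶠ p in 𝓝 P, p ∈ D → dist Z p ≤ R

lemma exists_nearest [ProperSpace X] (D : Set X) (hne : (frontier D).Nonempty) (x : X) :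
    ∃ P ∈ frontier D, dist x P = Metric.infDist x (frontier D) := by
  obtain ⟨P, hP, h⟩ := isClosed_frontier.exists_infDist_eq_dist hne x
  exact ⟨P, hP, h.symm⟩

lemma exists_support_outer [ProperSpace X] (hV : 2 ≤ Module.finrank ℝ V)
    (hD : HasOuterBalls D R) (hne : (frontier D).Nonempty)
    (hx : x ∈ interior D) (hR : 0 < R)
    (hRR' : R < R') (hR' : R' ∈ S.dom) (hRK : S.K * S.md R' < 2) :
    ∃ W, S.F x W = S.md (R' - Metric.infDist x (frontier D)) ∧
      ∀ᶠ y in 𝓝 x, S.F y W ≤ S.md (R' - Metric.infDist y (frontier D)) := by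
  have : Nontrivial V := Module.nontrivial_of_finrank_pos (R := ℝ) (by omega)
  obtain ⟨P, hP, hn⟩ := exists_nearest D hne x
  obtain ⟨Z, hZ, hout⟩ := hD P hP
  obtain ⟨W, h1, h2⟩ := S.exists_extension P Z hR' (by rw [dist_comm, hZ]; exact hRR'.le)
  exact ⟨W, S.support_outer hV hx hP hn hR hRR' hR' hRK hZ hout (by rw [dist_comm, h1])
    (by rw [h2, dist_comm P, hZ])⟩

lemma infDist_le_of_outer [ProperSpace X] (hV : 2 ≤ Module.finrank ℝ V)
    (hD : HasOuterBalls D R) (hne : (frontier D).Nonempty)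
    (hx : x ∈ interior D) (hR : 0 < R) (hRK : S.K * S.md R < 2) :
    Metric.infDist x (frontier D) ≤ R := by
  obtain ⟨P, hP, hn⟩ := exists_nearest D hne x
  obtain ⟨Z, hZ, hout⟩ := hD P hP
  have := S.dist_add_of_nearest hV hx hP hn hR hRK hZ hout
  linarith [dist_nonneg (x := Z) (y := x)]

/-- **Blaschke's rolling theorem**, outer part: an outer ball that contains `D` near `P` contains all
of `D`, if its radius `R` is at most a quarter of a great circle. That `P` is the nearest boundary
point for some `x` is no restriction if there is an inner ball at `P`. The proof shows that `D` is
star-shaped about `x`: the set `G` of the points visible from `x` is open and closed in the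
interior. -/
theorem dist_le_of_outer [ProperSpace X] (hV : 2 ≤ Module.finrank ℝ V)
    (hD : HasOuterBalls D R) (hcl : D ⊆ closure (interior D)) (hDc : IsClosed D)
    (hconn : IsPreconnected (interior D)) (hR : 0 < R) (hRd : R ∈ S.dom) (hRK : S.K * S.md R ≤ 1)
    (hx : x ∈ interior D) (hP : P ∈ frontier D)
    (hn : dist x P = Metric.infDist x (frontier D)) (hZ : dist Z P = R)
    (hout : ∀ᶠ p in 𝓝 P, p ∈ D → dist Z p ≤ R) : ∀ y ∈ D, dist Z y ≤ R := by
  have : Nontrivial V := Module.nontrivial_of_finrank_pos (R := ℝ) (by omega)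
  have hne : (frontier D).Nonempty := ⟨P, hP⟩
  have hRK2 : S.K * S.md R < 2 := by linarith
  set u : X → ℝ := fun y => Metric.infDist y (frontier D) with hu
  have huc : Continuous u := Metric.continuous_infDist_pt _
  have hupos : ∀ y ∈ interior D, 0 < u y := by
    intro y hy
    obtain ⟨Q, hQ, hQn⟩ := exists_nearest D hne y
    change 0 < Metric.infDist y (frontier D)
    rw [← hQn, dist_pos]
    rintro rfl
    exact hQ.2 hy
  have huR : ∀ y ∈ interior D, u y ≤ R := fun y hy =>
    S.infDist_le_of_outer hV hD hne hy hR hRK2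
  obtain ⟨R₀, hR₀, hRR₀, hR₀K⟩ := S.exists_gt hRd hRK2
  have hZx : dist Z x + dist x P = R := S.dist_add_of_nearest hV hx hP hn hR hRK2 hZ hout
  have hxP : 0 < dist x P := dist_pos.2 (by rintro rfl; exact hP.2 hx)
  set G : Set X := {y | S.K * S.F x y < 2 ∧ ∀ t ∈ Icc (0 : ℝ) 1, S.seg x y t ∈ interior D} with hG
  have hgc : ∀ {y} r, S.K * S.F x y < 2 →
      ContinuousOn (fun t => S.md (r - u (S.seg x y t))) (Icc 0 1) := fun r hy =>
    S.continuous_md.comp_continuousOn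
      (continuousOn_const.sub (huc.comp_continuousOn (S.continuousOn_seg_right hy)))
  have hGint : ∀ y ∈ G, y ∈ interior D := fun y hy => by
    have := hy.2 1 ⟨zero_le_one, le_rfl⟩
    rwa [S.seg_one hy.1] at this
  -- the part of the interior that is visible from `x` lies in the ball about `Z`
  have hGZ : ∀ y ∈ G, dist Z y ≤ R := by
    intro y hy
    by_contra! hlt
    -- the support at `x` gives `dist Z y ≤ dist Z W + dist W y < (r - R) + r`
    obtain ⟨r, hr1, hr2⟩ := exists_between (lt_min hRR₀ (show R < (R + dist Z y) / 2 by linarith))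
    have hrR₀ : r ≤ R₀ := hr2.le.trans (min_le_left _ _)
    have hrd : r ∈ S.dom := S.mem_of_le hR₀ (by linarith) hrR₀
    have hrK : S.K * S.md r < 2 := S.K_md_lt_of_le two_pos hrd hR₀ hrR₀ hR₀K
    obtain ⟨W, hW1, hW2⟩ := S.exists_extension P Z hrd (by rw [dist_comm, hZ]; exact hr1.le)
    obtain ⟨h1, h2⟩ := S.support_outer hV hx hP hn hR hr1 hrd hrK hZ hout
      (by rw [dist_comm, hW1]) (by rw [hW2, dist_comm P, hZ])
    have h3 := S.F_le_of_support (g := fun p => S.md (r - u p)) hy.1 (hgc r hy.1)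
      (fun t ht => S.exists_support_outer hV hD hne (hy.2 t (Ioo_subset_Icc_self ht)) hR hr1 hrd
        hrK) h1 h2
    have h0 := hupos y (hGint y hy)
    have h4 : dist y W ≤ r - u y := (S.dist_le_iff (S.mem_of_le hrd
      (by linarith [huR y (hGint y hy)]) (by linarith))).2 h3
    have h5 := hr2.trans_le (min_le_right _ _)
    have h6 : dist Z W = r - R := by rw [hW2, dist_comm P, hZ]
    linarith [dist_triangle Z W y, dist_comm W y]
  have hGopen : IsOpen G := by
    rw [isOpen_iff_mem_nhds]
    intro y hy
    have hK : ∀ᶠ p in 𝓝 y, S.K * S.F x p < 2 :=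
      (continuous_const.mul (S.continuous_F continuous_const continuous_id)).continuousAt.eventually_lt_const hy.1
    have hseg : ∀ᶠ p in 𝓝 y, ∀ t ∈ Icc (0 : ℝ) 1, t ∈ Icc (0 : ℝ) 1 → S.seg x p t ∈ interior D := by
      apply isCompact_Icc.eventually_forall_of_forall_eventually
      intro t ht
      have hc := (S.continuousOn_seg x) (y, t) ⟨hy.1, ht⟩
      have := hc.eventually (isOpen_interior.mem_nhds (hy.2 t ht))
      rw [eventually_nhdsWithin_iff] at this
      filter_upwards [this, continuousAt_fst.eventually hK] with z hz hz2 hz3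
      exact hz ⟨hz2, hz3⟩
    filter_upwards [hK, hseg] with p h1 h2
    exact ⟨h1, fun t ht => h2 t ht ht⟩
  have hxG : x ∈ G := by
    have hK : S.K * S.F x x < 2 := by rw [S.F_self]; norm_num
    refine ⟨hK, fun t ht => ?_⟩
    have h1 := S.seg_dist hK ht
    rw [dist_self] at h1
    have h2 : dist x (S.seg x x t) = 0 := le_antisymm
      (by linarith [dist_nonneg (x := S.seg x x t) (y := x)]) dist_nonneg
    rwa [← dist_eq_zero.1 h2]
  have hGcl : closure G ∩ interior D ⊆ G := by
    rintro y ⟨hyG, hyD⟩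
    have hyZ : dist Z y ≤ R := by
      have : closure G ⊆ {p | dist Z p ≤ R} :=
        closure_minimal hGZ (isClosed_le (continuous_const.dist continuous_id) continuous_const)
      exact this hyG
    have hK : S.K * S.F x y < 2 := S.not_antipodal (Z := Z) hRK
      ((S.dist_lt_iff hRd).1 (by linarith)) ((S.dist_le_iff hRd).1 hyZ)
    refine ⟨hK, fun t ht => ?_⟩
    -- the segments from `x` to points of `G` near `y` will have distance at least `δ` from the
    -- boundary, which carries over to the limit
    obtain ⟨δ, hδ0, hδ⟩ := exists_between (lt_min (lt_min (hupos x hx) (hupos y hyD))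
      (sub_pos.2 hRR₀))
    have hδx : δ < u x := hδ.trans_le ((min_le_left _ _).trans (min_le_left _ _))
    have hδy : δ < u y := hδ.trans_le ((min_le_left _ _).trans (min_le_right _ _))
    have hδR : R + δ < R₀ := by linarith [hδ.trans_le (min_le_right _ _)]
    have hrd : R + δ ∈ S.dom := S.mem_of_le hR₀ (by linarith) hδR.le
    have hrK : S.K * S.md (R + δ) < 2 := S.K_md_lt_of_le two_pos hrd hR₀ hδR.le hR₀K
    have hmem : ∀ p ∈ interior D, R + δ - u p ∈ S.dom := fun p hp =>
      S.mem_of_le hrd (by linarith [huR p hp]) (by linarith [hupos p hp])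
    -- along the segments from `x`, the distance from the boundary stays at least `δ`
    have hstay : ∀ p ∈ G, δ < u p → δ ≤ u (S.seg x p t) := by
      intro p hp hup
      have h1 := S.le_chord_of_support (g := fun p => S.md (R + δ - u p)) hp.1 (hgc _ hp.1)
        (fun s hs => S.exists_support_outer hV hD hne (hp.2 s (Ioo_subset_Icc_self hs)) hR
          (by linarith) hrd hrK) ht
      have h2 : S.md (R + δ - u x) ≤ S.md R :=
        (S.le_iff (hmem x hx) hRd).2 (by linarith)
      have h3 : S.md (R + δ - u p) ≤ S.md R :=
        (S.le_iff (hmem p (hGint p hp)) hRd).2 (by linarith)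
      have h4 := S.le_of_lam_mul_add_mu_le hp.1 ht hRK (h1.trans (by
        nlinarith [mul_le_mul_of_nonneg_left h2 (sub_nonneg.2 ht.2),
          mul_le_mul_of_nonneg_left h3 ht.1]))
      have := (S.le_iff (hmem _ (hp.2 t ht)) hRd).1 h4
      linarith
    have : (𝓝[G] y).NeBot := mem_closure_iff_nhdsWithin_neBot.1 hyG
    have hcont : Tendsto (fun p => S.seg x p t) (𝓝[G] y) (𝓝 (S.seg x y t)) := by
      refine ((S.continuousOn_seg x) (y, t) ⟨hK, ht⟩).tendsto.comp (f := fun p => (p, t))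
        (tendsto_nhdsWithin_iff.2 ⟨?_, ?_⟩)
      · exact ((continuous_id.prodMk continuous_const).tendsto y).mono_left nhdsWithin_le_nhds
      · filter_upwards [self_mem_nhdsWithin] with p hp
        exact ⟨hp.1, ht⟩
    have h1 : δ ≤ u (S.seg x y t) := by
      refine ge_of_tendsto ((huc.tendsto _).comp hcont) ?_
      filter_upwards [self_mem_nhdsWithin,
        nhdsWithin_le_nhds (huc.continuousAt.eventually_const_lt hδy)] with p hp hp2
      exact hstay p hp hp2
    have h2 : S.seg x y t ∈ D := by
      refine hDc.mem_of_tendsto hcont ?_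
      filter_upwards [self_mem_nhdsWithin] with p hp
      exact interior_subset (hp.2 t ht)
    by_contra hn'
    have h3 : S.seg x y t ∈ frontier D := ⟨subset_closure h2, hn'⟩
    have h4 : u (S.seg x y t) = 0 := Metric.infDist_zero_of_mem h3
    linarith
  have hsub := hconn.subset_of_closure_inter_subset hGopen ⟨x, hx, hxG⟩ hGcl
  intro y hy
  have : closure (interior D) ⊆ {p | dist Z p ≤ R} :=
    closure_minimal (fun p hp => hGZ p (hsub hp))
      (isClosed_le (continuous_const.dist continuous_id) continuous_const)
  exact this (hcl hy)

end Outer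

end SpaceForm
end ConstCurv

namespace ConstCurv

/-! ### Rolling of an inner ball, and the centre of the shell -/

namespace SpaceForm

variable {X V : Type} [MetricSpace X] [NormedAddCommGroup V] [InnerProductSpace ℝ V]
variable (S : SpaceForm X V)

/-- The distance of `Z` from the farthest point of `D` (for compact non-empty `D`). -/
noncomputable def farDist (D : Set X) (Z : X) : ℝ := sSup (dist Z '' D)

section Far

variable {D : Set X} {P Z O O' : X} {R r : ℝ}

lemma continuous_farDist (hD : IsCompact D) : Continuous (farDist D) :=
  hD.continuous_sSup (f := fun Z x => dist Z x) continuous_dist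

lemma dist_le_farDist (hD : IsCompact D) (Z : X) {p : X} (hp : p ∈ D) :
    dist Z p ≤ farDist D Z :=
  le_csSup (hD.image (continuous_const.dist continuous_id)).bddAbove ⟨p, hp, rfl⟩

lemma exists_dist_eq_farDist (hD : IsCompact D) (hne : D.Nonempty) (Z : X) :
    ∃ p ∈ D, dist Z p = farDist D Z := by
  obtain ⟨p, hp, h⟩ := (hD.image (continuous_const.dist continuous_id)).sSup_mem
    (hne.image (dist Z))
  exact ⟨p, hp, h⟩

lemma mem_frontier_of_farthest [Nontrivial V] (hK : S.K * S.F Z P < 2) (hP : P ∈ D)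
    (hfar : ∀ p ∈ D, dist Z p ≤ dist Z P) : P ∈ frontier D := by
  refine ⟨subset_closure hP, fun hint => S.not_eventually_dist_le hK ?_⟩
  filter_upwards [mem_interior_iff_mem_nhds.1 hint] with p hp using hfar p hp

lemma dist_lt_of_mem_interior [Nontrivial V] (hRK : S.K * S.md R < 2)
    (hsub : ∀ p ∈ D, dist Z p ≤ R) (hP : P ∈ interior D) : dist Z P < R := by
  refine lt_of_le_of_ne (hsub P (interior_subset hP)) fun h => ?_
  have hK : S.K * S.F Z P < 2 := by rwa [F, h]
  exact (S.mem_frontier_of_farthest hK (interior_subset hP) (by rwa [h])).2 hP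

/-- Every boundary point of `D` has a ball of radius `R` that is contained in `D` locally. -/
def HasInnerBalls (D : Set X) (R : ℝ) : Prop :=
  ∀ P ∈ frontier D, ∃ O, dist O P = R ∧ ∀ᶠ p in 𝓝 P, dist O p ≤ R → p ∈ D

/-- Support of `md (farDist D - r)` at `Z`, by the distance from the centre `O'` of a ball of radius
`r < R` tangent at a farthest point `P` to an inner ball. -/
lemma support_inner [ProperSpace X] (hV : 2 ≤ Module.finrank ℝ V) (hD : IsCompact D)
    (hP : P ∈ frontier D) (hfar : dist Z P = farDist D Z) (hK : S.K * S.F Z P < 2)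
    (hr : 0 < r) (hrR : r < R) (hO : dist O P = R)
    (hin : ∀ᶠ p in 𝓝 P, dist O p ≤ R → p ∈ D) (hO' : dist P O' = r)
    (hOO' : dist O' O = R - r) :
    r ≤ farDist D Z ∧ S.F Z O' = S.md (farDist D Z - r) ∧
      ∀ᶠ Y in 𝓝 Z, S.F Y O' ≤ S.md (farDist D Y - r) := by
  have : Nontrivial V := Module.nontrivial_of_finrank_pos (R := ℝ) (by omega)
  have hZP : Z ≠ P := by
    rintro rfl
    obtain ⟨x, hx, -⟩ := S.exists_nearest_eq hP (hr.trans hrR) hO hin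
    have := dist_le_farDist hD Z (interior_subset hx)
    rw [← hfar, dist_self] at this
    rw [dist_le_zero.1 this] at hP
    exact hP.2 hx
  have hadd : dist Z O + dist O P = dist Z P := by
    apply S.dist_add_dist_of_locally_inside hV
    · rintro rfl; rw [dist_self] at hO; linarith
    · exact hZP
    · rwa [S.F_comm]
    · filter_upwards [hin] with p hp hlt
      rw [hfar]
      exact dist_le_farDist hD Z (hp (by linarith))
  have hadd' : dist Z O' + dist O' P = dist Z P := by
    apply le_antisymm _ (dist_triangle _ _ _)
    linarith [dist_triangle Z O O', dist_comm O O', dist_comm O' P]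
  have hO'P : dist O' P = r := by rw [dist_comm, hO']
  refine ⟨by linarith [dist_nonneg (x := Z) (y := O')],
    by rw [F, ← hfar, ← hadd', hO'P, add_sub_cancel_right], ?_⟩
  obtain ⟨t, ht, htZ, -⟩ := S.exists_gt (S.dist_mem Z P) hK
  have hclose : ∀ᶠ Y in 𝓝 Z, dist Y O' + r < t :=
    ((continuous_id.dist continuous_const).add continuous_const).continuousAt.eventually_lt_const
      (show dist Z O' + r < t by linarith)
  have hq : ∀ Y, ∃ q, dist Y O' + r < t → dist Y q = dist Y O' + r ∧ dist O' q = r := by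
    intro Y
    by_cases h : dist Y O' + r < t
    · obtain ⟨q, h1, h2⟩ := S.exists_extension Y O' (S.mem_of_le ht (by positivity) h.le)
        (by linarith)
      exact ⟨q, fun _ => ⟨h1, by rw [h2]; ring⟩⟩
    · exact ⟨Y, fun h' => absurd h' h⟩
  choose q hq using hq
  have hqP : Tendsto q (𝓝 Z) (𝓝 P) := by
    refine S.tendsto_extension (z := id) (y := fun _ => O') tendsto_id tendsto_const_nhds ?_ ?_ ?_
      hadd'
    · rintro rfl
      rw [dist_self] at hadd'
      linarith [dist_nonneg (x := O') (y := O)]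
    · filter_upwards [hclose] with Y hY
      obtain ⟨h1, h2⟩ := hq Y hY
      simp only [id]
      linarith
    · rw [hO'P]
      refine tendsto_const_nhds.congr' ?_
      filter_upwards [hclose] with Y hY
      exact (hq Y hY).2.symm
  filter_upwards [hclose, hqP.eventually hin] with Y hY hYin
  obtain ⟨h1, h2⟩ := hq Y hY
  have h3 : q Y ∈ D := hYin (by linarith [dist_triangle O O' (q Y), dist_comm O O'])
  have h4 := dist_le_farDist hD Y h3
  obtain ⟨p, hp, hpf⟩ := exists_dist_eq_farDist hD ⟨_, h3⟩ Y
  have h5 : farDist D Y ∈ S.dom := hpf ▸ S.dist_mem Y p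
  exact (S.le_iff (S.dist_mem _ _) (S.mem_of_le h5 (by linarith [dist_nonneg (x := Y) (y := O')])
    (by linarith))).2 (by linarith)

/-- **Blaschke's rolling theorem**, inner part: let `O` be the centre of an inner ball of radius `R₂`
at `P`. Every ball of radius `R₁` that contains `D` also contains the ball of radius `R₂` about `O`.
The ball of radius `R₁` about `Z` that touches `D` at `P` provides a starting point: `P` is a point
of `D` farthest from `Z`. -/
theorem dist_centers_le [ProperSpace X] (hV : 2 ≤ Module.finrank ℝ V) (hD : IsCompact D)
    {R₁ R₂ : ℝ} (hR₂ : 0 < R₂) (hR₁ : R₁ ∈ S.dom) (hR₁K : S.K * S.md R₁ ≤ 1)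
    (hin : HasInnerBalls D R₂) (hP : P ∈ frontier D) (hO : dist O P = R₂)
    (hOin : ∀ᶠ p in 𝓝 P, dist O p ≤ R₂ → p ∈ D)
    (hZP : dist Z P = R₁) (hZ : ∀ p ∈ D, dist Z p ≤ R₁)
    {Y : X} (hY : ∀ p ∈ D, dist Y p ≤ R₁) : dist Y O ≤ R₁ - R₂ := by
  have : Nontrivial V := Module.nontrivial_of_finrank_pos (R := ℝ) (by omega)
  obtain ⟨x, hx, -⟩ := S.exists_nearest_eq hP hR₂ hO hOin
  have hxD := interior_subset hx
  have hZY : S.K * S.F Z Y < 2 := by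
    refine S.not_antipodal (Z := x) hR₁K ?_ ?_
    · rw [S.F_comm]
      exact (S.dist_lt_iff hR₁).1 (S.dist_lt_of_mem_interior (by linarith) hZ hx)
    · rw [S.F_comm]
      exact (S.dist_le_iff hR₁).1 (hY x hxD)
  have hPD : P ∈ D := hD.isClosed.frontier_subset hP
  have hfarZ : dist Z P = farDist D Z := by
    obtain ⟨p, hp, hpf⟩ := exists_dist_eq_farDist hD ⟨x, hxD⟩ Z
    exact le_antisymm (dist_le_farDist hD Z hPD) (by rw [← hpf, hZP]; exact hZ p hp)
  have hKZP : S.K * S.F Z P < 2 := by rw [F, hZP]; linarith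
  by_contra! hlt
  -- the support at `Z` will give `dist Y O' ≤ R₁ - r`, and `dist O' O = R₂ - r`
  obtain ⟨r, hr1, hr2⟩ := exists_between (max_lt hR₂ (show (R₁ + R₂ - dist Y O) / 2 < R₂ by linarith))
  have hr0 : 0 < r := (le_max_left _ _).trans_lt hr1
  obtain ⟨O', hO'1, hO'2⟩ := S.exists_between_dist P O hr0.le (by rw [dist_comm, hO]; exact hr2.le)
  rw [dist_comm P O, hO] at hO'2
  obtain ⟨-, h1, h2⟩ := S.support_inner hV hD hP hfarZ hKZP hr0 hr2 hO hOin hO'1 hO'2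
  have hsup : ∀ W, (∀ p ∈ D, dist W p ≤ R₁) → r ≤ farDist D W ∧ ∃ A',
      S.F W A' = S.md (farDist D W - r) ∧ ∀ᶠ Y in 𝓝 W, S.F Y A' ≤ S.md (farDist D Y - r) := by
    intro W hW
    obtain ⟨p, hp, hpf⟩ := exists_dist_eq_farDist hD ⟨x, hxD⟩ W
    have hpK : S.K * S.F W p < 2 :=
      (S.K_md_le_of_le zero_le_one (S.dist_mem _ _) hR₁ (hW p hp) hR₁K).trans_lt one_lt_two
    have hpfr : p ∈ frontier D := S.mem_frontier_of_farthest hpK hp fun q hq => by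
      rw [hpf]; exact dist_le_farDist hD _ hq
    obtain ⟨A, hA, hAin⟩ := hin p hpfr
    obtain ⟨A', hA'1, hA'2⟩ := S.exists_between_dist p A hr0.le
      (by rw [dist_comm, hA]; exact hr2.le)
    rw [dist_comm p A, hA] at hA'2
    obtain ⟨h3, h4⟩ := S.support_inner hV hD hpfr hpf hpK hr0 hr2 hA hAin hA'1 hA'2
    exact ⟨h3, A', h4⟩
  have h3 := S.F_le_of_support (g := fun W => S.md (farDist D W - r)) hZY
    (S.continuous_md.comp_continuousOn
      (((continuous_farDist hD).comp_continuousOn (S.continuousOn_seg_right hZY)).sub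
        continuousOn_const)) (fun t ht => (hsup _ fun p hp => ?_).2) h1 h2
  · obtain ⟨p, hp, hpf⟩ := exists_dist_eq_farDist hD ⟨x, hxD⟩ Y
    have h5 : farDist D Y ∈ S.dom := hpf ▸ S.dist_mem Y p
    have h6 : farDist D Y ≤ R₁ := by rw [← hpf]; exact hY p hp
    have h7 := (hsup Y hY).1
    have h4 := (S.le_iff (S.dist_mem _ _) (S.mem_of_le h5 (by linarith) (by linarith))).1 h3
    linarith [dist_triangle Y O' O, (le_max_right _ _).trans_lt hr1]
  · exact (S.dist_le_iff hR₁).2 (S.seg_F_le hZY (Ioo_subset_Icc_self ht) hR₁K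
      ((S.dist_le_iff hR₁).1 (hZ p hp)) ((S.dist_le_iff hR₁).1 (hY p hp)))

end Far

/-- If the points of `A` have distance at most `ρ` from the points of `B`, then `A` and `B` lie in
concentric balls whose radii `a` and `c` are the legs of a right-angled triangle with hypotenuse
`ρ`. The centre is that of the smallest ball about `A`; it is found as the projection of the point
`v` of the closed convex hull `H` of the image of `A` in `ℝ × V` at which the quadratic form `B'`
is maximal. (For the paraboloid of the case `K = 0`, the value of `B'` at `v` is twice the height of
`v` above the paraboloid.) -/
theorem exists_center [FiniteDimensional ℝ V] [Nontrivial V] {A B : Set X} (hA : A.Nonempty)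
    (hB : B.Nonempty) {ρ : ℝ} (hρ : ρ ∈ S.dom) (hρK : S.K * S.md ρ < 1)
    (hAB : ∀ x ∈ A, ∀ z ∈ B, dist x z ≤ ρ) :
    ∃ O, ∃ a ∈ S.dom, ∃ c ∈ S.dom, (∀ x ∈ A, dist O x ≤ a) ∧ (∀ z ∈ B, dist O z ≤ c) ∧
      S.K * S.md a ≤ 1 ∧ S.K * S.md c ≤ 1 ∧
      S.md a + S.md c - S.K * S.md a * S.md c = S.md ρ := by
  obtain ⟨x₀, hx₀⟩ := hA
  obtain ⟨z₀, hz₀⟩ := hB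
  set ι : X → ℝ × V := fun x => (S.F x₀ x, S.tan x₀ x) with hι
  set B' : ℝ × V → ℝ × V → ℝ := fun v w => v.1 + w.1 - S.K * v.1 * w.1 - inner ℝ v.2 w.2 with hB'
  have hBι : ∀ x y, B' (ι x) (ι y) = S.F x y := fun x y => (S.F_law x₀ x y).symm
  set H : Set (ℝ × V) := closure (convexHull ℝ (ι '' A)) with hH
  have hHsub : ι '' A ⊆ H := (subset_convexHull ℝ _).trans subset_closure
  have hHconv : Convex ℝ H := (convex_convexHull ℝ _).closure
  have hHc : IsCompact H := by
    obtain ⟨C₁, hC₁⟩ := (isCompact_Icc (a := (0 : ℝ)) (b := 2 * ρ)).exists_bound_of_continuousOn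
      S.continuous_md.continuousOn
    obtain ⟨C₂, hC₂⟩ := (isCompact_Icc (a := (0 : ℝ)) (b := 2 * ρ)).exists_bound_of_continuousOn
      S.continuous_sn.continuousOn
    have hsub : ι '' A ⊆ Metric.closedBall 0 (max C₁ C₂) := by
      rintro _ ⟨x, hx, rfl⟩
      have hd : dist x₀ x ∈ Icc 0 (2 * ρ) := ⟨dist_nonneg, by
        linarith [dist_triangle x₀ z₀ x, hAB x hx z₀ hz₀, hAB x₀ hx₀ z₀ hz₀, dist_comm x z₀]⟩
      rw [mem_closedBall_zero_iff, Prod.norm_def]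
      refine max_le_max (hC₁ _ hd) ?_
      change ‖S.tan x₀ x‖ ≤ _
      rw [S.norm_tan]
      exact (le_abs_self _).trans (hC₂ _ hd)
    exact (isCompact_closedBall _ _).of_isClosed_subset isClosed_closure
      (closure_minimal (convexHull_min hsub (convex_closedBall _ _)) Metric.isClosed_closedBall)
  have hBaff : ∀ (v w u : ℝ × V) (s t : ℝ), s + t = 1 →
      B' (s • v + t • w) u = s * B' v u + t * B' w u := by
    intro v w u s t hst
    obtain rfl : s = 1 - t := by linarith
    simp only [hB', Prod.fst_add, Prod.snd_add, Prod.smul_fst, Prod.smul_snd, smul_eq_mul,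
      inner_add_left, real_inner_smul_left]
    ring
  have hHB : ∀ v ∈ H, ∀ z ∈ B, B' v (ι z) ≤ S.md ρ := by
    intro v hv z hz
    have hcl : IsClosed {v | B' v (ι z) ≤ S.md ρ} :=
      isClosed_le (by simp only [hB']; fun_prop) continuous_const
    refine closure_minimal (convexHull_min ?_ ?_) hcl hv
    · rintro _ ⟨x, hx, rfl⟩
      change B' (ι x) (ι z) ≤ _
      rw [hBι]
      exact (S.dist_le_iff hρ).1 (hAB x hx z hz)
    · intro v hv w hw s t hs ht hst
      change B' _ _ ≤ _
      rw [hBaff _ _ _ _ _ hst]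
      have h1 := mul_le_mul_of_nonneg_left (show B' v (ι z) ≤ _ from hv) hs
      have h2 := mul_le_mul_of_nonneg_left (show B' w (ι z) ≤ _ from hw) ht
      calc _ ≤ s * S.md ρ + t * S.md ρ := add_le_add h1 h2
        _ = S.md ρ := by rw [← add_mul, hst, one_mul]
  have hHpos : ∀ v ∈ H, 0 ≤ v.1 := by
    intro v hv
    have hcl : IsClosed {v : ℝ × V | 0 ≤ v.1} := isClosed_le continuous_const continuous_fst
    refine closure_minimal (convexHull_min ?_ ?_) hcl hv
    · rintro _ ⟨x, hx, rfl⟩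
      exact S.F_nonneg _ _
    · intro v hv w hw s t hs ht _
      exact add_nonneg (mul_nonneg hs hv) (mul_nonneg ht hw)
  obtain ⟨v, hv, hmax⟩ := hHc.exists_isMaxOn ⟨ι x₀, hHsub ⟨x₀, hx₀, rfl⟩⟩
    (f := fun v => B' v v) (by simp only [hB']; fun_prop)
  set Q := B' v v with hQ
  have hQ0 : 0 ≤ Q := by
    have : B' (ι x₀) (ι x₀) ≤ Q := hmax (hHsub ⟨x₀, hx₀, rfl⟩)
    rwa [hBι, S.F_self] at this
  have hQeq : Q = 2 * v.1 - S.K * v.1 ^ 2 - ‖v.2‖ ^ 2 := by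
    simp only [hQ, hB', real_inner_self_eq_norm_sq]; ring
  -- for `0 < K`, `v` would otherwise be the centre of the projection, and `B' v` would be constant,
  -- equal to `1 / K > md ρ`
  have hKQ : S.K * Q < 1 := by
    rcases le_or_gt S.K 0 with hc | hc
    · nlinarith
    by_contra! hge
    have h1 : (1 - S.K * v.1) ^ 2 + S.K * ‖v.2‖ ^ 2 ≤ 0 := by rw [hQeq] at hge; nlinarith
    have h2 : S.K * ‖v.2‖ ^ 2 = 0 := le_antisymm (by nlinarith [sq_nonneg (1 - S.K * v.1)])
      (by positivity)
    have h3 : v.2 = 0 := by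
      have := (mul_eq_zero.1 h2).resolve_left hc.ne'
      exact norm_eq_zero.1 (pow_eq_zero_iff two_ne_zero |>.1 this)
    have h4 : 1 - S.K * v.1 = 0 := by
      rw [h2, add_zero] at h1
      exact pow_eq_zero_iff two_ne_zero |>.1 (le_antisymm h1 (sq_nonneg _))
    have h5 := hHB v hv z₀ hz₀
    have h6 : S.K * B' v (ι z₀) = 1 := by
      simp only [hB', h3, inner_zero_left]
      linear_combination (1 - S.K * (ι z₀).1) * (-h4)
    nlinarith
  obtain ⟨O, -, -, hOrel⟩ := S.exists_proj x₀ (hHpos v hv) hQeq hKQ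
  have hOrel' : ∀ z, B' v (ι z) = S.lam Q * S.F O z + S.mu Q := hOrel
  have hl := S.lam_pos hKQ
  have hl1 := S.lam_eq hKQ
  have hm := S.mu_nonneg hQ0
  have hmul := S.mu_mul Q
  -- the first-order condition at the maximum, for the step from `v` towards a point of `A`
  have hfirst : ∀ x ∈ A, B' v (ι x) ≤ Q := by
    intro x hx
    by_contra! hlt
    set b := B' v (ι x) with hb
    have hden : 0 < 2 * b - Q := by linarith
    set s := (b - Q) / (2 * b - Q) with hs
    have hs0 : 0 < s := div_pos (by linarith) hden
    have hs1 : s < 1 := by rw [hs, div_lt_one hden]; linarith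
    have hsm : s * (2 * b - Q) = b - Q := div_mul_cancel₀ _ hden.ne'
    have hmem : (1 - s) • v + s • ι x ∈ H :=
      hHconv hv (hHsub ⟨x, hx, rfl⟩) (by linarith) hs0.le (by ring)
    have h1 : B' ((1 - s) • v + s • ι x) ((1 - s) • v + s • ι x) ≤ Q := hmax hmem
    have hcomm : ∀ v w, B' v w = B' w v := fun v w => by
      simp only [hB', real_inner_comm]; ring
    rw [hBaff _ _ _ _ _ (by ring), hcomm v, hcomm (ι x), hBaff _ _ _ _ _ (by ring),
      hBaff _ _ _ _ _ (by ring), hcomm (ι x) v, hBι, S.F_self, ← hQ, ← hb] at h1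
    nlinarith
  -- `md a = mu Q`; then `cos a = lam Q`, and `md c` is determined by the right-angled triangle
  obtain ⟨a, ha, hamd⟩ := S.exists_md_eq (S.mu Q) hm (by
    rw [hl1] at hmul; nlinarith)
  have hO0 := hOrel' z₀
  have hz0 := hHB v hv z₀ hz₀
  have hc0 : 0 ≤ (S.md ρ - S.mu Q) / S.lam Q :=
    div_nonneg (by nlinarith [S.F_nonneg O z₀]) hl.le
  have hc1 : S.K * ((S.md ρ - S.mu Q) / S.lam Q) ≤ 1 := by
    rw [mul_div_assoc', div_le_one hl, hl1]; linarith
  obtain ⟨c, hc, hcmd⟩ := S.exists_md_eq _ hc0 (by nlinarith)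
  refine ⟨O, a, ha, c, hc, fun x hx => ?_, fun z hz => ?_, by rw [hamd]; linarith,
    by rwa [hcmd], ?_⟩
  · rw [S.dist_le_iff ha, hamd]
    have h1 := hfirst x hx
    rw [hOrel'] at h1
    have : S.lam Q * S.F O x ≤ S.lam Q * S.mu Q := by linarith
    exact le_of_mul_le_mul_left this hl
  · rw [S.dist_le_iff hc, hcmd, le_div_iff₀ hl]
    have h1 := hHB v hv z hz
    rw [hOrel'] at h1
    linarith
  · rw [hamd, hcmd]
    have : (S.md ρ - S.mu Q) / S.lam Q * S.lam Q = S.md ρ - S.mu Q := div_mul_cancel₀ _ hl.ne'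
    rw [hl1] at this ⊢
    linarith

/-- The legs of a right-angled triangle with hypotenuse `ρ` have a sum of at most `2 α`, the
value for the isosceles right-angled triangle. The law of cosines gives
`md (a + c) + md (a - c) = 2 * md ρ`, and `md (2 * α) = 2 * md ρ`. -/
lemma add_le_two_mul {a c α ρ : ℝ} (ha : a ∈ S.dom) (hc : c ∈ S.dom) (hα : α ∈ S.dom)
    (hρ : ρ ∈ S.dom) (hρK : S.K * S.md ρ < 1) (hαρ : S.sn α ^ 2 = S.md ρ)
    (hαK : S.K * S.md α < 1) (haK : S.K * S.md a ≤ 1) (hcK : S.K * S.md c ≤ 1)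
    (h : S.md a + S.md c - S.K * S.md a * S.md c = S.md ρ) :
    a ≤ ρ ∧ c ≤ ρ ∧ a + c ≤ 2 * α := by
  have ha0 := S.md_nonneg ha
  have hc0 := S.md_nonneg hc
  have hρ0 := S.md_nonneg hρ
  have key : S.md a ≤ S.md ρ ∧ S.md c ≤ S.md ρ := by constructor <;> nlinarith
  have hale : a ≤ ρ := (S.le_iff ha hρ).1 key.1
  have hcle : c ≤ ρ := (S.le_iff hc hρ).1 key.2
  refine ⟨hale, hcle, ?_⟩
  have ha' := S.nonneg_of_mem a ha
  have hc' := S.nonneg_of_mem c hc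
  set s := (a + c) / 2 with hs
  have hsd : s ∈ S.dom := S.mem_of_le hρ (by linarith) (by linarith)
  have hsρ : S.K * S.md s < 1 := S.K_md_lt_of_le one_pos hsd hρ (by linarith) hρK
  have h1 : 2 * S.sn s ^ 2 + S.md (a - c) = 2 * S.md ρ := by
    rw [← S.md_two_mul, show 2 * s = a + c by rw [hs]; ring, S.md_add, S.md_sub]
    linarith
  have h2 : 0 ≤ S.md (a - c) := by
    rcases le_total a c with hac | hac
    · have : S.md (a - c) = S.md (c - a) := by rw [S.md_sub, S.md_sub]; ring
      rw [this]
      exact S.md_nonneg (S.mem_of_le hc (by linarith) (by linarith))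
    · exact S.md_nonneg (S.mem_of_le ha (by linarith) (by linarith))
  have h3 : S.sn s ^ 2 ≤ S.sn α ^ 2 := by rw [hαρ]; linarith
  rw [S.sn_sq, S.sn_sq] at h3
  have h4 : S.md s ≤ S.md α := by
    by_contra! hlt
    nlinarith
  have := (S.le_iff hsd hα).1 h4
  linarith

end SpaceForm
end ConstCurv

namespace ConstCurv

/-! ### The enclosing shell -/

namespace SpaceForm

variable {X V : Type} [MetricSpace X] [NormedAddCommGroup V] [InnerProductSpace ℝ V]
variable (S : SpaceForm X V)

lemma K_md_lt_one_of_lt {s t : ℝ} (hs : s ∈ S.dom) (ht : t ∈ S.dom) (h : s < t)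
    (hK : S.K * S.md t ≤ 1) : S.K * S.md s < 1 := by
  have h1 := (S.lt_iff hs ht).2 h
  have h2 := S.md_nonneg hs
  rcases le_or_gt S.K 0 with hc | hc <;> nlinarith

/-- `D` contains the intersection of its supporting balls: a segment from an inner point `y` to a
point `x` outside `D` would meet the boundary at a point that is an inner point of all of them. -/
lemma mem_of_forall_frontier [Nontrivial V] {D : Set X} {R : ℝ} {x y : X} (hDc : IsClosed D)
    (hne : (frontier D).Nonempty) (hRd : R ∈ S.dom) (hRK : S.K * S.md R ≤ 1)
    (hy : y ∈ interior D)
    (h : ∀ P ∈ frontier D, ∃ Z, dist Z P = R ∧ (∀ p ∈ D, dist Z p ≤ R) ∧ dist Z x ≤ R) :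
    x ∈ D := by
  by_contra hx
  have hlt : ∀ Z, (∀ p ∈ D, dist Z p ≤ R) → S.F Z y < S.md R := fun Z hZ =>
    (S.dist_lt_iff hRd).1 (S.dist_lt_of_mem_interior (by linarith) hZ hy)
  have hK : S.K * S.F y x < 2 := by
    obtain ⟨P, hP⟩ := hne
    obtain ⟨Z, -, hZ, hZx⟩ := h P hP
    exact S.not_antipodal hRK (hlt Z hZ) ((S.dist_le_iff hRd).1 hZx)
  obtain ⟨t, ht, hf⟩ := S.exists_seg_mem_frontier hK hy (fun hx' => hx (interior_subset hx'))
  obtain ⟨Z, hZP, hZ, hZx⟩ := h _ hf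
  have h1 := S.seg_spec hK ht Z
  have hQ := S.K_mul_segQ_lt hK ht
  have hl1 := S.lam_eq hQ
  have hm := S.mu_nonneg (S.segQ_nonneg y x ht)
  have h2 : S.F (S.seg y x t) Z = S.md R := by rw [F, dist_comm, hZP]
  rw [h2] at h1
  have h3 := hlt Z hZ
  have h4 := (S.dist_le_iff hRd).1 hZx
  rw [S.F_comm] at h3 h4
  have ht1 : t < 1 := by
    refine lt_of_le_of_ne ht.2 ?_
    rintro rfl
    rw [S.seg_one hK] at hf
    exact hx (hDc.frontier_subset hf)
  rw [hl1] at h1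
  nlinarith [mul_lt_mul_of_pos_left h3 (sub_pos.2 ht1), mul_le_mul_of_nonneg_left h4 ht.1,
    mul_nonneg hm (sub_nonneg.2 hRK)]

/-- A pinched convex domain is enclosed in a shell of width at most `2 * α - (R₁ - R₂)`, where `α` is
the leg of the isosceles right-angled triangle with hypotenuse `R₁ - R₂`. -/
theorem exists_shell [ProperSpace X] [FiniteDimensional ℝ V] (hV : 2 ≤ Module.finrank ℝ V)
    {R₁ R₂ α : ℝ} (hR₂ : 0 < R₂) (hR : R₂ ≤ R₁) (hR₁ : R₁ ∈ S.dom) (hR₁K : S.K * S.md R₁ ≤ 1)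
    (hα : α ∈ S.dom) (hαρ : S.sn α ^ 2 = S.md (R₁ - R₂)) (hαK : S.K * S.md α < 1) {D : Set X}
    (hD : IsPinchedConvex dist (fun _ ρ κ => ρ = κ) R₁ R₂ D) :
    ∃ O r R, IsShell dist D O r R ∧ R ≤ R₁ ∧ R - r ≤ 2 * α - (R₁ - R₂) := by
  have : Nontrivial V := Module.nontrivial_of_finrank_pos (R := ℝ) (by omega)
  obtain ⟨⟨U, hUo, hUc, hDU⟩, hne, hpin⟩ := hD
  have hDc : IsClosed D := hDU ▸ isClosed_closure
  have hUD : U ⊆ interior D := interior_maximal (hDU ▸ subset_closure) hUo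
  have hconn : IsPreconnected (interior D) :=
    hUc.isPreconnected.subset_closure hUD (interior_subset.trans hDU.subset)
  have hcl : D ⊆ closure (interior D) := hDU.subset.trans (closure_mono hUD)
  have hin : HasInnerBalls D R₂ := by
    intro P hP
    obtain ⟨Z, O, _, _, rfl, rfl, -, hO, -, hev⟩ := hpin P hP
    exact ⟨O, hO, hev.mono fun x hx => hx.2.1⟩
  have hout : HasOuterBalls D R₁ := by
    intro P hP
    obtain ⟨Z, O, _, _, rfl, rfl, hZ, -, -, hev⟩ := hpin P hP
    exact ⟨Z, hZ, hev.mono fun x hx => hx.2.2⟩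
  have hR₁0 : 0 < R₁ := hR₂.trans_le hR
  have hsup : ∀ P ∈ frontier D, ∃ Z, dist Z P = R₁ ∧ ∀ p ∈ D, dist Z p ≤ R₁ := by
    intro P hP
    obtain ⟨Z, hZ, hev⟩ := hout P hP
    obtain ⟨O, hO, hOev⟩ := hin P hP
    obtain ⟨x, hx, hxP⟩ := S.exists_nearest_eq hP hR₂ hO hOev
    exact ⟨Z, hZ, S.dist_le_of_outer hV hout hcl hDc hconn hR₁0 hR₁ hR₁K hx hP hxP hZ hev⟩
  obtain ⟨P₀, hP₀⟩ := id hne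
  obtain ⟨Z₀, hZ₀P, hZ₀⟩ := hsup P₀ hP₀
  have hDcomp : IsCompact D := (isCompact_closedBall Z₀ R₁).of_isClosed_subset hDc
    fun p hp => by rw [Metric.mem_closedBall, dist_comm]; exact hZ₀ p hp
  obtain ⟨O₀, hO₀, hO₀in⟩ := hin P₀ hP₀
  obtain ⟨y, hy, -⟩ := S.exists_nearest_eq hP₀ hR₂ hO₀ hO₀in
  have hρd : R₁ - R₂ ∈ S.dom := S.mem_of_le hR₁ (by linarith) (by linarith)
  have hρK : S.K * S.md (R₁ - R₂) < 1 := S.K_md_lt_one_of_lt hρd hR₁ (by linarith) hR₁K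
  set A : Set X := {O | ∃ P ∈ frontier D, dist O P = R₂ ∧ ∀ᶠ p in 𝓝 P, dist O p ≤ R₂ → p ∈ D}
    with hA
  set B : Set X := {Z | ∃ P ∈ frontier D, dist Z P = R₁ ∧ ∀ p ∈ D, dist Z p ≤ R₁} with hB
  have hAB : ∀ O ∈ A, ∀ Z ∈ B, dist O Z ≤ R₁ - R₂ := by
    rintro O ⟨P, hP, hO, hOin⟩ Z ⟨Q, -, -, hZ⟩
    obtain ⟨W, hWP, hW⟩ := hsup P hP
    rw [dist_comm]
    exact S.dist_centers_le hV hDcomp hR₂ hR₁ hR₁K hin hP hO hOin hWP hW hZ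
  obtain ⟨O, a, ha, c, hc, hOA, hOB, haK, hcK, hac⟩ := S.exists_center (A := A) (B := B)
    ⟨O₀, P₀, hP₀, hO₀, hO₀in⟩ ⟨Z₀, P₀, hP₀, hZ₀P, hZ₀⟩ hρd hρK hAB
  obtain ⟨ha1, hc1, hsum⟩ := S.add_le_two_mul ha hc hα hρd hρK hαρ hαK haK hcK hac
  have hfr : ∀ P ∈ frontier D, R₁ - c ≤ dist O P ∧ dist O P ≤ a + R₂ := by
    intro P hP
    obtain ⟨W, hWP, hW⟩ := hsup P hP
    obtain ⟨C, hCP, hCin⟩ := hin P hP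
    have h1 := hOB W ⟨P, hP, hWP, hW⟩
    have h2 := hOA C ⟨P, hP, hCP, hCin⟩
    constructor
    · linarith [dist_triangle W O P, dist_comm W O]
    · linarith [dist_triangle O C P]
  -- the shell has width `a + c - (R₁ - R₂)`
  refine ⟨O, R₁ - c, a + R₂, ⟨by linarith, (hfr P₀ hP₀).1.trans (hfr P₀ hP₀).2, hfr, ?_, ?_⟩,
    by linarith, by linarith⟩
  · intro x hx
    refine S.mem_of_forall_frontier hDc hne hR₁ hR₁K hy fun P hP => ?_
    obtain ⟨W, hWP, hW⟩ := hsup P hP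
    refine ⟨W, hWP, hW, ?_⟩
    have h1 := hOB W ⟨P, hP, hWP, hW⟩
    have h2 : dist O x ≤ R₁ - c := hx
    linarith [dist_triangle W O x, dist_comm W O]
  · intro x hx
    obtain ⟨p, hp, hpf⟩ := exists_dist_eq_farDist hDcomp ⟨y, interior_subset hy⟩ O
    have hK : S.K * S.F O p < 2 := by
      refine S.not_antipodal (Z := Z₀) hR₁K ((S.dist_lt_iff hR₁).1 ?_)
        ((S.dist_le_iff hR₁).1 (hZ₀ p hp))
      have := hOB Z₀ ⟨P₀, hP₀, hZ₀P, hZ₀⟩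
      rw [dist_comm]
      linarith
    have hpfr : p ∈ frontier D := S.mem_frontier_of_farthest hK hp fun q hq => by
      rw [hpf]; exact dist_le_farDist hDcomp O hq
    have := dist_le_farDist hDcomp O hx
    change dist O x ≤ a + R₂
    linarith [(hfr p hpfr).2]

end SpaceForm
end ConstCurv

namespace ConstCurv

/-! ### Tangent vectors along segments, and balls -/

namespace SpaceForm

variable {X V : Type} [MetricSpace X] [NormedAddCommGroup V] [InnerProductSpace ℝ V]
variable (S : SpaceForm X V)

lemma sn_neg (b : ℝ) : S.sn (-b) = -S.sn b := by
  have := S.sn_sub 0 b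
  rw [S.sn_zero, S.md_zero, zero_sub] at this
  linarith

lemma md_neg (b : ℝ) : S.md (-b) = S.md b := by
  have := S.md_sub 0 b
  rw [S.sn_zero, S.md_zero, zero_sub] at this
  linarith

lemma sn_add (a b : ℝ) :
    S.sn (a + b) = S.sn a * (1 - S.K * S.md b) + (1 - S.K * S.md a) * S.sn b := by
  have := S.sn_sub a (-b)
  rw [sub_neg_eq_add, S.md_neg, S.sn_neg] at this
  linarith

/-- A linear relation between the functions `F a`, `F b` and `F y` passes to the tangent vectors at
any point `O`, as these are determined by their inner products with all `tan O W`. -/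
lemma smul_tan_add_eq [Nontrivial V] {a b y : X} {s t l κ : ℝ}
    (h : ∀ W, s * S.F a W + t * S.F b W = l * S.F y W + κ) (hl : l = s + t - S.K * κ) (O : X) :
    s • S.tan O a + t • S.tan O b = l • S.tan O y ∧
      s * (1 - S.K * S.F O a) + t * (1 - S.K * S.F O b) = l * (1 - S.K * S.F O y) := by
  have hO := h O
  rw [S.F_comm a, S.F_comm b, S.F_comm y] at hO
  have h2 : s * (1 - S.K * S.F O a) + t * (1 - S.K * S.F O b) = l * (1 - S.K * S.F O y) := by
    linear_combination (-S.K) * hO - hl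
  refine ⟨?_, h2⟩
  set d := s • S.tan O a + t • S.tan O b - l • S.tan O y with hd
  have hW : ∀ W, inner ℝ d (S.tan O W) = 0 := by
    intro W
    have h1 := h W
    rw [S.F_law O a, S.F_law O b, S.F_law O y] at h1
    rw [hd, inner_sub_left, inner_add_left, real_inner_smul_left, real_inner_smul_left,
      real_inner_smul_left]
    linear_combination hO - h1 + S.F O W * h2
  have : d = 0 := by
    by_contra hd0
    obtain ⟨t₀, ht₀, ht0, htK⟩ := S.exists_gt S.zero_mem (by rw [S.md_zero]; norm_num)
    obtain ⟨W, -, hWt⟩ := S.exists_exp O t₀ ht₀ (‖d‖⁻¹ • d) (norm_smul_inv_norm hd0)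
    have h1 := hW W
    rw [hWt, real_inner_smul_right, real_inner_smul_right, real_inner_self_eq_norm_sq] at h1
    have h3 := S.sn_pos ht₀ ht0 htK
    have h4 : 0 < ‖d‖ := norm_pos_iff.2 hd0
    have : 0 < S.sn t₀ * (‖d‖⁻¹ * ‖d‖ ^ 2) := by positivity
    linarith
  exact sub_eq_zero.1 this

/-- A point of a geodesic segment is a combination of the end points with non-negative
coefficients. The second equation is the one for the remaining coordinate `1 - K * F O x`, the
generalized cosine of `dist O x`. -/
lemma smul_tan_of_dist_add [Nontrivial V] {a b y : X} (h : dist a y + dist y b = dist a b)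
    (O : X) :
    S.sn (dist y b) • S.tan O a + S.sn (dist y a) • S.tan O b = S.sn (dist a b) • S.tan O y ∧
      S.sn (dist y b) * (1 - S.K * S.F O a) + S.sn (dist y a) * (1 - S.K * S.F O b)
        = S.sn (dist a b) * (1 - S.K * S.F O y) := by
  have hl : S.sn (dist a b) = S.sn (dist y b) * (1 - S.K * S.F y a)
      + S.sn (dist y a) * (1 - S.K * S.F y b) := by
    rw [← h, S.sn_add, dist_comm a y]
    simp only [F]
    ring
  refine S.smul_tan_add_eq (κ := S.sn (dist y b) * S.F y a + S.sn (dist y a) * S.F y b)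
    (fun W => ?_) (by rw [hl]; ring) O
  have h1 := congrArg (fun v => inner ℝ v (S.tan y W)) (S.tan_opposite h)
  simp only [inner_add_left, real_inner_smul_left, inner_zero_left] at h1
  rw [S.F_law y a, S.F_law y b, hl]
  linear_combination -h1

lemma smul_tan_seg [Nontrivial V] {x y : X} {t : ℝ} (h : S.K * S.F x y < 2)
    (ht : t ∈ Icc (0 : ℝ) 1) (O : X) :
    (1 - t) • S.tan O x + t • S.tan O y = S.lam (S.segQ x y t) • S.tan O (S.seg x y t) ∧
      (1 - t) * (1 - S.K * S.F O x) + t * (1 - S.K * S.F O y)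
        = S.lam (S.segQ x y t) * (1 - S.K * S.F O (S.seg x y t)) :=
  S.smul_tan_add_eq (fun W => S.seg_spec h ht W) (by rw [S.lam_eq (S.K_mul_segQ_lt h ht)]; ring) O

/-- If a ball lies in another one, the distance of the centres is at most the difference of the
radii. -/
lemma dist_add_le_of_ball_subset [Nontrivial V] {Z O : X} {r R : ℝ} (hr : 0 < r)
    (hR : R ∈ S.dom) (hRK : S.K * S.md R < 2) (h : ∀ x, dist O x ≤ r → dist Z x ≤ R) :
    dist Z O + r ≤ R := by
  by_contra! hlt
  obtain ⟨t, ht, hRt, -⟩ := S.exists_gt hR hRK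
  have hZO : dist Z O ≤ R := h O (by rw [dist_self]; exact hr.le)
  have hmin : R < min (dist Z O + r) t := lt_min hlt hRt
  obtain ⟨q, hq1, hq2⟩ := S.exists_extension Z O (r := min (dist Z O + r) t)
    (S.mem_of_le ht (by linarith [S.nonneg_of_mem R hR]) (min_le_right _ _)) (by linarith)
  have := h q (by rw [hq2]; linarith [min_le_left (dist Z O + r) t])
  linarith

/-- An end point of a segment whose other points lie in `T`. -/
lemma mem_closure_of_between [Nontrivial V] (S : SpaceForm X V) {a x : X} {T : Set X}
    (hax : a ≠ x) (h : ∀ w, w ≠ x → dist a w + dist w x = dist a x → w ∈ T) : x ∈ closure T := by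
  rw [Metric.mem_closure_iff]
  intro ε hε
  have h0 : 0 < dist x a := dist_pos.2 hax.symm
  have hm : 0 < min (ε / 2) (dist x a) := lt_min (by positivity) h0
  obtain ⟨w, hw1, hw2⟩ := S.exists_between_dist x a hm.le (min_le_right _ _)
  refine ⟨w, h w ?_ ?_, ?_⟩
  · rintro rfl
    rw [dist_self] at hw1
    linarith
  · rw [dist_comm a w, dist_comm w x, dist_comm a x]; linarith
  · rw [hw1]; linarith [min_le_left (ε / 2) (dist x a)]

/-- The pinching condition at `P` from inclusions, near `P`, between `D` and two nested balls. -/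
lemma pinched_of_balls {D : Set X} (hDc : IsClosed D) {P O₁ O₂ : X} {R₁ R₂ : ℝ}
    (h1 : dist O₁ P = R₁) (h2 : dist O₂ P = R₂) (h12 : dist O₁ O₂ ≤ R₁ - R₂)
    (hin : ∀ᶠ x in 𝓝 P, dist O₂ x ≤ R₂ → x ∈ D) (hout : ∀ᶠ x in 𝓝 P, x ∈ D → dist O₁ x ≤ R₁) :
    ∃ (O₁ O₂ : X) (ρ₁ ρ₂ : ℝ), ρ₁ = R₁ ∧ ρ₂ = R₂ ∧
      P ∈ gsphere dist O₁ ρ₁ ∧ P ∈ gsphere dist O₂ ρ₂ ∧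
      gball dist O₂ ρ₂ ⊆ gball dist O₁ ρ₁ ∧
      ∀ᶠ x in 𝓝 P,
        (x ∈ frontier D → dist O₁ x ≤ ρ₁ ∧ ρ₂ ≤ dist O₂ x) ∧
        (dist O₂ x ≤ ρ₂ → x ∈ D) ∧ (x ∈ D → dist O₁ x ≤ ρ₁) := by
  refine ⟨O₁, O₂, R₁, R₂, rfl, rfl, h1, h2, fun x hx => ?_, ?_⟩
  · have : dist O₂ x ≤ R₂ := hx
    change dist O₁ x ≤ R₁
    linarith [dist_triangle O₁ O₂ x]
  · filter_upwards [hin, hout, eventually_eventually_nhds.2 hin] with x hx1 hx2 hx3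
    refine ⟨fun hf => ⟨hx2 (hDc.frontier_subset hf), ?_⟩, hx1, hx2⟩
    by_contra! hlt
    apply hf.2
    rw [mem_interior_iff_mem_nhds]
    filter_upwards [hx3, (continuous_const.dist continuous_id).continuousAt.eventually_lt_const
      hlt] with y hy hy2
    exact hy hy2.le

/-- A ball is the degenerate spindle, which is needed for `R₁ = R₂`. -/
lemma isPinchedConvex_ball [ProperSpace X] [Nontrivial V] {R : ℝ} (hR : 0 < R) (hRd : R ∈ S.dom)
    (hRK : S.K * S.md R < 2) (O : X) :
    IsPinchedConvex dist (fun _ ρ κ => ρ = κ) R R (gball dist O R) := by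
  have hc : IsClosed (gball dist O R) :=
    isClosed_le (continuous_const.dist continuous_id) continuous_const
  have hsub : Metric.ball O R ⊆ gball dist O R := fun x hx => by
    rw [Metric.mem_ball, dist_comm] at hx; exact hx.le
  have hOK : ∀ x, dist O x < R → S.K * S.F O x < 2 := fun x hx =>
    S.K_md_lt_of_le two_pos (S.dist_mem O x) hRd hx.le hRK
  refine ⟨⟨Metric.ball O R, Metric.isOpen_ball, ⟨⟨O, Metric.mem_ball_self hR⟩, ?_⟩, ?_⟩, ?_, ?_⟩
  · refine isPreconnected_of_forall O fun x hx => ?_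
    rw [Metric.mem_ball, dist_comm] at hx
    refine ⟨S.seg O x '' Icc 0 1, ?_, ⟨0, ⟨le_rfl, zero_le_one⟩, S.seg_zero (hOK x hx)⟩,
      ⟨1, ⟨zero_le_one, le_rfl⟩, S.seg_one (hOK x hx)⟩,
      isPreconnected_Icc.image _ (S.continuousOn_seg_right (hOK x hx))⟩
    rintro _ ⟨t, ht, rfl⟩
    rw [Metric.mem_ball, dist_comm]
    linarith [S.seg_dist (hOK x hx) ht, dist_nonneg (x := S.seg O x t) (y := x)]
  · refine subset_antisymm (fun x hx => ?_) (closure_minimal hsub hc)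
    have hx' : dist O x ≤ R := hx
    rcases eq_or_ne O x with rfl | hne
    · exact subset_closure (Metric.mem_ball_self hR)
    · refine S.mem_closure_of_between hne fun w hw hadd => ?_
      rw [Metric.mem_ball, dist_comm]
      linarith [dist_pos.2 hw]
  · obtain ⟨v, hv⟩ := exists_norm_eq V (zero_le_one (α := ℝ))
    obtain ⟨P, hP, -⟩ := S.exists_exp O R hRd v hv
    refine ⟨P, S.mem_frontier_of_farthest (Z := O) (by rwa [F, hP]) hP.le fun p hp => ?_⟩
    rw [hP]; exact hp
  · intro P hP
    have hPR : dist O P = R := by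
      refine le_antisymm (hc.frontier_subset hP) ?_
      by_contra! hlt
      exact hP.2 (interior_maximal hsub Metric.isOpen_ball
        (by rwa [Metric.mem_ball, dist_comm]))
    exact pinched_of_balls hc hPR hPR (by simp) (Eventually.of_forall fun x hx => hx)
      (Eventually.of_forall fun x hx => hx)

end SpaceForm
end ConstCurv

namespace ConstCurv

/-! ### The axis of a spindle and its rim -/

namespace SpaceForm

variable {X V : Type} [MetricSpace X] [NormedAddCommGroup V] [InnerProductSpace ℝ V]

/-- The axis of a spindle, with midpoint `O` and direction `e` at `O`. The centres `C` and `C'` of the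
caps lie on it, in the directions `e` and `-e` at distance `α` from `O`. The number `ρ` is the
hypotenuse of the isosceles right-angled triangle with leg `α`. -/
structure Axis (S : SpaceForm X V) where
  O : X
  C : X
  C' : X
  e : V
  α : ℝ
  ρ : ℝ
  norm_e : ‖e‖ = 1
  α_pos : 0 < α
  two_mem : 2 * α ∈ S.dom
  ρ_mem : ρ ∈ S.dom
  sn_sq : S.sn α ^ 2 = S.md ρ
  K_lt : S.K * S.md α < 1
  dist_C : dist O C = α
  tan_C : S.tan O C = S.sn α • e
  dist_C' : dist O C' = α
  tan_C' : S.tan O C' = -(S.sn α • e)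

namespace Axis

variable {S : SpaceForm X V} (A : Axis S)

/-- The component of `tan O x` along the axis. -/
def p (x : X) : ℝ := inner ℝ A.e (S.tan A.O x)

/-- The component of `tan O x` perpendicular to the axis. -/
def n (x : X) : V := S.tan A.O x - A.p x • A.e

/-- The generalized cosine of the distance of `x` from `O`. -/
def h (x : X) : ℝ := 1 - S.K * S.F A.O x

/-- The generalized cosine of `α`. -/
def ca : ℝ := 1 - S.K * S.md A.α

/-- The generalized sine of `α`. -/
def sa : ℝ := S.sn A.α

/-- The sign of `σ x` tells whether `x` lies in the sector with apex `Z` between the rays from `Z`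
through `C` and `C'`, where `Z` is the point of the rim opposite to `x`: it is negative inside and
zero on the two rays. -/
def σ (x : X) : ℝ := (|A.p x| - ‖A.n x‖) * A.ca - A.sa * A.h x

/-- The modified distance of `x` from the farthest point of the rim (`exists_rim_far`). -/
def φ (x : X) : ℝ := S.md A.α + S.F A.O x * A.ca + A.sa * ‖A.n x‖

/-- The centres of the arcs of the spindle. They form the sphere of radius `α` about `O` in the
hyperplane through `O` orthogonal to the axis (`mem_rim_iff`). -/
def rim : Set X := {Z | dist Z A.C = A.ρ ∧ dist Z A.C' = A.ρ}

lemma α_mem : A.α ∈ S.dom :=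
  S.mem_of_le A.two_mem A.α_pos.le (by linarith [A.α_pos])

lemma sa_pos : 0 < A.sa := S.sn_pos A.α_mem A.α_pos (by linarith [A.K_lt])

lemma ca_pos : 0 < A.ca := by unfold ca; linarith [A.K_lt]

lemma md_ρ : S.md A.ρ = S.md A.α + S.md A.α * A.ca := by
  rw [← A.sn_sq, S.sn_sq, ca]; ring

lemma α_le_ρ : A.α ≤ A.ρ := by
  rw [← S.le_iff A.α_mem A.ρ_mem, A.md_ρ]
  nlinarith [S.md_nonneg A.α_mem, A.ca_pos]

lemma tan_eq (x : X) : S.tan A.O x = A.n x + A.p x • A.e := by rw [n]; abel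

lemma inner_e_n (x : X) : inner ℝ A.e (A.n x) = 0 := by
  rw [n, inner_sub_right, real_inner_smul_right, real_inner_self_eq_norm_sq, A.norm_e, p]; ring

lemma F_C (x : X) : S.F A.C x = S.md A.α + S.F A.O x * A.ca - A.sa * A.p x := by
  rw [S.F_law A.O, A.tan_C, real_inner_smul_left, F, A.dist_C, ca, sa, p]; ring

lemma F_C' (x : X) : S.F A.C' x = S.md A.α + S.F A.O x * A.ca + A.sa * A.p x := by
  rw [S.F_law A.O, A.tan_C', inner_neg_left, real_inner_smul_left, F, A.dist_C', ca, sa, p]; ring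

lemma p_C : A.p A.C = A.sa := by
  rw [p, A.tan_C, real_inner_smul_right, real_inner_self_eq_norm_sq, A.norm_e, sa]; ring

lemma p_C' : A.p A.C' = -A.sa := by
  rw [p, A.tan_C', inner_neg_right, real_inner_smul_right, real_inner_self_eq_norm_sq, A.norm_e,
    sa]; ring

lemma n_C : A.n A.C = 0 := by rw [n, A.p_C, A.tan_C, sa, sub_self]

lemma n_C' : A.n A.C' = 0 := by rw [n, A.p_C', A.tan_C', sa, neg_smul, sub_self]

lemma h_C : A.h A.C = A.ca := by rw [h, ca, F, A.dist_C]

lemma h_C' : A.h A.C' = A.ca := by rw [h, ca, F, A.dist_C']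

lemma dist_C_C' : dist A.C A.C' = 2 * A.α := by
  apply S.dist_eq_of_F A.two_mem
  rw [A.F_C, A.p_C', S.md_two_mul, F, A.dist_C', ← sa, ca]
  have := S.sn_sq A.α
  rw [← sa] at this
  linear_combination -this

lemma mem_rim_iff {Z : X} : Z ∈ A.rim ↔ dist A.O Z = A.α ∧ A.p Z = 0 := by
  have h1 := A.F_C Z
  have h2 := A.F_C' Z
  have h3 := A.md_ρ
  have h4 := A.ca_pos
  have h5 := A.sa_pos
  constructor
  · rintro ⟨hC, hC'⟩
    rw [F, dist_comm, hC] at h1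
    rw [F, dist_comm, hC'] at h2
    have hp : A.p Z = 0 := by
      have : A.sa * A.p Z = 0 := by linarith
      exact (mul_eq_zero.1 this).resolve_left h5.ne'
    refine ⟨S.dist_eq_of_F A.α_mem ?_, hp⟩
    rw [hp] at h1
    have : (S.F A.O Z - S.md A.α) * A.ca = 0 := by linarith
    linarith [(mul_eq_zero.1 this).resolve_right h4.ne']
  · rintro ⟨hd, hp⟩
    rw [hp, F, F, hd] at h1 h2
    constructor
    · rw [dist_comm]
      exact S.dist_eq_of_F A.ρ_mem (by rw [F]; linarith)
    · rw [dist_comm]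
      exact S.dist_eq_of_F A.ρ_mem (by rw [F]; linarith)

section Rim

variable {A} {Z x y : X}

lemma tan_rim (hZ : Z ∈ A.rim) : S.tan A.O Z = A.n Z := by
  rw [A.tan_eq, (A.mem_rim_iff.1 hZ).2, zero_smul, add_zero]

lemma norm_n_rim (hZ : Z ∈ A.rim) : ‖A.n Z‖ = A.sa := by
  rw [← tan_rim hZ, S.norm_tan, (A.mem_rim_iff.1 hZ).1, sa]

lemma h_rim (hZ : Z ∈ A.rim) : A.h Z = A.ca := by rw [h, F, (A.mem_rim_iff.1 hZ).1, ca]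

lemma F_rim (hZ : Z ∈ A.rim) (x : X) :
    S.F Z x = S.md A.α + S.F A.O x * A.ca - inner ℝ (A.n Z) (A.n x) := by
  have hin : inner ℝ (S.tan A.O Z) (S.tan A.O x) = inner ℝ (A.n Z) (A.n x) := by
    rw [tan_rim hZ, A.tan_eq x, inner_add_right, real_inner_smul_right, real_inner_comm A.e,
      A.inner_e_n]; ring
  rw [S.F_law A.O, hin, F, (A.mem_rim_iff.1 hZ).1, ca]; ring

lemma F_rim_le (hZ : Z ∈ A.rim) (x : X) : S.F Z x ≤ A.φ x := by
  rw [F_rim hZ, φ, ← norm_n_rim hZ]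
  have := real_inner_le_norm (-A.n Z) (A.n x)
  rw [inner_neg_left, norm_neg] at this
  linarith

/-- The bound `F Z x ≤ φ x` is attained if `Z` and `x` are on opposite sides of the axis. -/
lemma F_rim_eq (hZ : Z ∈ A.rim) {s t : ℝ} (ht : 0 < t) (hs : 0 ≤ s)
    (h : s • A.n Z + t • A.n x = 0) : S.F Z x = A.φ x ∧ t * ‖A.n x‖ = s * A.sa := by
  have h1 : t * ‖A.n x‖ = s * A.sa := by
    have := congrArg norm (eq_neg_of_add_eq_zero_right h)
    rwa [norm_neg, norm_smul, norm_smul, Real.norm_of_nonneg ht.le, Real.norm_of_nonneg hs,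
      norm_n_rim hZ] at this
  refine ⟨?_, h1⟩
  have h2 : inner ℝ (A.n Z) (s • A.n Z + t • A.n x) = 0 := by rw [h, inner_zero_right]
  rw [inner_add_right, real_inner_smul_right, real_inner_smul_right, real_inner_self_eq_norm_sq,
    norm_n_rim hZ] at h2
  rw [F_rim hZ, φ]
  have : t * (A.sa * ‖A.n x‖ + inner ℝ (A.n Z) (A.n x)) = 0 := by
    linear_combination A.sa * h1 + h2
  linarith [(mul_eq_zero.1 this).resolve_left ht.ne']

variable (A) in
/-- A point of the rim that is farthest from `x`; it is opposite to `x` with respect to the axis. -/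
lemma exists_rim_far (hV : 2 ≤ Module.finrank ℝ V) (x : X) :
    ∃ Z ∈ A.rim, S.F Z x = A.φ x ∧ ‖A.n x‖ • A.n Z + A.sa • A.n x = 0 := by
  obtain ⟨v, hv, hev, hx⟩ : ∃ v : V, ‖v‖ = 1 ∧ inner ℝ A.e v = 0 ∧ A.n x = ‖A.n x‖ • v := by
    by_cases h0 : A.n x = 0
    · obtain ⟨v, hv, hev⟩ := exists_unit_orthogonal hV A.e
      exact ⟨v, hv, hev, by rw [h0]; simp⟩
    · refine ⟨‖A.n x‖⁻¹ • A.n x, norm_smul_inv_norm h0, ?_, ?_⟩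
      · rw [real_inner_smul_right, A.inner_e_n, mul_zero]
      · rw [smul_smul, mul_inv_cancel₀ (norm_ne_zero_iff.2 h0), one_smul]
  obtain ⟨Z, hZ, hZt⟩ := S.exists_exp A.O A.α A.α_mem (-v) (by rw [norm_neg, hv])
  have hpZ : A.p Z = 0 := by
    rw [p, hZt, real_inner_smul_right, inner_neg_right, hev]; ring
  have hZr : Z ∈ A.rim := A.mem_rim_iff.2 ⟨hZ, hpZ⟩
  have hrel : ‖A.n x‖ • A.n Z + A.sa • A.n x = 0 := by
    rw [← tan_rim hZr, hZt, ← sa]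
    conv_lhs => rw [hx, norm_smul, hv, norm_norm, mul_one]
    module
  exact ⟨Z, hZr, (F_rim_eq hZr A.sa_pos (norm_nonneg _) hrel).1, hrel⟩

lemma proj_of_smul {a b y : X} {s t l : ℝ}
    (h : s • S.tan A.O a + t • S.tan A.O b = l • S.tan A.O y) :
    s * A.p a + t * A.p b = l * A.p y ∧ s • A.n a + t • A.n b = l • A.n y := by
  have h1 : s * A.p a + t * A.p b = l * A.p y := by
    have := congrArg (fun v => inner ℝ A.e v) h
    simpa only [p, inner_add_right, real_inner_smul_right] using this
  refine ⟨h1, ?_⟩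
  simp only [n, smul_sub, smul_smul, ← h, ← h1]
  module

/-- The points of the segment from `C` to `C'` in terms of the coordinates. -/
lemma axis_of_dist (hy : dist A.C y + dist y A.C' = dist A.C A.C') [Nontrivial V] :
    A.n y = 0 ∧ |A.p y| * A.ca ≤ A.sa * A.h y := by
  obtain ⟨h1, h2⟩ := S.smul_tan_of_dist_add hy A.O
  obtain ⟨h3, h4⟩ := A.proj_of_smul h1
  have hl : 0 < S.sn (dist A.C A.C') := by
    rw [A.dist_C_C', two_mul, S.sn_add]
    have := mul_pos A.sa_pos A.ca_pos
    simp only [sa, ca] at this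
    linarith
  have hs := S.sn_nonneg _ (S.dist_mem y A.C')
  have ht := S.sn_nonneg _ (S.dist_mem y A.C)
  have h2' : S.sn (dist y A.C') * A.h A.C + S.sn (dist y A.C) * A.h A.C'
      = S.sn (dist A.C A.C') * A.h y := h2
  rw [A.h_C, A.h_C'] at h2'
  rw [A.p_C, A.p_C'] at h3
  rw [A.n_C, A.n_C', smul_zero, smul_zero, add_zero] at h4
  refine ⟨(smul_eq_zero.1 h4.symm).resolve_left hl.ne', ?_⟩
  have h5 : S.sn (dist A.C A.C') * |A.p y| ≤
      (S.sn (dist y A.C') + S.sn (dist y A.C)) * A.sa := by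
    rw [← abs_of_pos hl, ← abs_mul, ← h3, abs_le]
    have h6 := mul_nonneg hs A.sa_pos.le
    have h7 := mul_nonneg ht A.sa_pos.le
    constructor <;> linarith
  have h6 := mul_le_mul_of_nonneg_right h5 A.ca_pos.le
  have h7 : S.sn (dist A.C A.C') * (|A.p y| * A.ca) ≤ S.sn (dist A.C A.C') * (A.sa * A.h y) := by
    linear_combination h6 + A.sa * h2'
  exact le_of_mul_le_mul_left h7 hl

/-- The converse of `axis_of_dist`. Equality holds for the end points of the segment only. -/
lemma dist_of_axis (hn : A.n y = 0) (hp : |A.p y| * A.ca ≤ A.sa * A.h y) :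
    dist A.O y ≤ A.α ∧ dist A.C y + dist y A.C' = dist A.C A.C' ∧
      (|A.p y| * A.ca = A.sa * A.h y → y = A.C ∨ y = A.C') := by
  have hpn : |A.p y| = S.sn (dist A.O y) := by
    rw [← S.norm_tan, A.tan_eq, hn, zero_add, norm_smul, A.norm_e, mul_one, Real.norm_eq_abs]
  have hsub : S.sn (A.α - dist A.O y) = A.sa * A.h y - |A.p y| * A.ca := by
    rw [S.sn_sub, hpn, sa, h, ca, F]; ring
  have hle : dist A.O y ≤ A.α :=
    S.le_of_sn_sub_nonneg (S.dist_mem _ _) A.α_pos (by rw [hsub]; linarith)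
  have hnn := dist_nonneg (x := A.O) (y := y)
  have hm : A.α - dist A.O y ∈ S.dom := S.mem_of_le A.α_mem (by linarith) (by linarith)
  have hM : A.α + dist A.O y ∈ S.dom :=
    S.mem_of_le A.two_mem (by linarith [A.α_pos]) (by linarith)
  have e1 := S.md_sub A.α (dist A.O y)
  have e2 := S.md_add A.α (dist A.O y)
  have c1 := A.F_C y
  have c2 := A.F_C' y
  have heq : |A.p y| * A.ca = A.sa * A.h y → dist A.O y = A.α := by
    intro heq
    by_contra hne
    have h0 : 0 < A.α - dist A.O y := sub_pos.2 (lt_of_le_of_ne hle hne)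
    have hK := S.K_md_lt_of_le one_pos hm A.α_mem (by linarith) A.K_lt
    have := S.sn_pos hm h0 (by linarith)
    rw [hsub] at this
    linarith
  refine ⟨hle, ?_⟩
  rcases le_total 0 (A.p y) with h0 | h0
  · rw [abs_of_nonneg h0] at hpn
    rw [hpn] at c1 c2
    have d1 : dist A.C y = A.α - dist A.O y := S.dist_eq_of_F hm (by
      rw [c1, e1, ca, sa]; simp only [F]; ring)
    have d2 : dist A.C' y = A.α + dist A.O y := S.dist_eq_of_F hM (by
      rw [c2, e2, ca, sa]; simp only [F]; ring)
    refine ⟨by rw [A.dist_C_C', dist_comm y, d1, d2]; ring, fun h => Or.inl ?_⟩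
    rw [heq h, sub_self] at d1
    exact (dist_eq_zero.1 d1).symm
  · rw [abs_of_nonpos h0] at hpn
    rw [show A.p y = -S.sn (dist A.O y) by linarith] at c1 c2
    have d1 : dist A.C y = A.α + dist A.O y := S.dist_eq_of_F hM (by
      rw [c1, e2, ca, sa]; simp only [F]; ring)
    have d2 : dist A.C' y = A.α - dist A.O y := S.dist_eq_of_F hm (by
      rw [c2, e1, ca, sa]; simp only [F]; ring)
    refine ⟨by rw [A.dist_C_C', dist_comm y, d1, d2]; ring, fun h => Or.inr ?_⟩
    rw [heq h, sub_self] at d2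
    exact (dist_eq_zero.1 d2).symm

lemma φ_axis_le (hn : A.n y = 0) (hy : dist A.O y ≤ A.α) : A.φ y ≤ S.md A.ρ := by
  rw [φ, hn, norm_zero, mul_zero, add_zero, A.md_ρ]
  have := mul_le_mul_of_nonneg_right ((S.dist_le_iff A.α_mem).1 hy) A.ca_pos.le
  linarith

/-- If the segment from a point `Z` of the rim to `x` meets the segment from `C` to `C'`, then `Z` is
the point of the rim farthest from `x`, and `x` lies in the sector of `Z`. -/
lemma sector_of_dist [Nontrivial V] (hZ : Z ∈ A.rim)
    (hyC : dist A.C y + dist y A.C' = dist A.C A.C')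
    (hyZ : dist Z y + dist y x = dist Z x) (hK : S.K * S.F Z x < 2) :
    S.F Z x = A.φ x ∧ A.σ x ≤ 0 := by
  obtain ⟨hyn, hyp⟩ := A.axis_of_dist hyC
  obtain ⟨h1, h2⟩ := S.smul_tan_of_dist_add hyZ A.O
  obtain ⟨h3, h4⟩ := A.proj_of_smul h1
  have hs := S.sn_nonneg _ (S.dist_mem y x)
  have hl := S.sn_nonneg _ (S.dist_mem Z x)
  have hne : y ≠ Z := by
    rintro rfl
    have := norm_n_rim hZ
    rw [hyn, norm_zero] at this
    exact A.sa_pos.ne this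
  have ht : 0 < S.sn (dist y Z) := by
    refine S.sn_pos (S.dist_mem _ _) (dist_pos.2 hne) ?_
    exact S.K_md_lt_of_le two_pos (S.dist_mem _ _) (S.dist_mem Z x)
      (by rw [dist_comm]; linarith [dist_nonneg (x := y) (y := x)]) hK
  have h2' : S.sn (dist y x) * A.h Z + S.sn (dist y Z) * A.h x = S.sn (dist Z x) * A.h y := h2
  rw [h_rim hZ] at h2'
  rw [(A.mem_rim_iff.1 hZ).2, mul_zero, zero_add] at h3
  rw [hyn, smul_zero] at h4
  obtain ⟨h5, h6⟩ := F_rim_eq hZ ht hs h4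
  refine ⟨h5, ?_⟩
  have h7 : S.sn (dist y Z) * |A.p x| = S.sn (dist Z x) * |A.p y| := by
    have := congrArg abs h3
    rwa [abs_mul, abs_mul, abs_of_pos ht, abs_of_nonneg hl] at this
  have h8 := mul_le_mul_of_nonneg_left hyp hl
  have : S.sn (dist y Z) * A.σ x ≤ 0 := by
    rw [σ]
    linear_combination h8 + A.ca * h7 - A.ca * h6 + (-A.sa) * h2'
  by_contra! hpos
  linarith [mul_pos ht hpos]

variable (A) in
/-- The converse of `sector_of_dist`: if `x` lies in the sector of the point `Z` of the rim farthest
from it, then the segment from `Z` to `x` meets the segment from `C` to `C'`, and it does so in an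
end point if `x` lies on a ray bounding the sector. -/
lemma exists_of_sector (hV : 2 ≤ Module.finrank ℝ V) {R : ℝ}
    (hRK : S.K * S.md R ≤ 1) (hσ : A.σ x ≤ 0) (hφ : A.φ x ≤ S.md R) :
    ∃ Z ∈ A.rim, ∃ y, S.F Z x = A.φ x ∧ dist A.C y + dist y A.C' = dist A.C A.C' ∧
      dist Z y + dist y x = dist Z x ∧ (A.σ x = 0 → y = A.C ∨ y = A.C') := by
  have : Nontrivial V := Module.nontrivial_of_finrank_pos (R := ℝ) (by omega)
  obtain ⟨Z, hZ, hF, hrel⟩ := A.exists_rim_far hV x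
  have hK : S.K * S.F Z x < 2 := by
    rcases le_or_gt S.K 0 with hc | hc
    · nlinarith [S.F_nonneg Z x]
    · nlinarith
  have hsa := A.sa_pos
  have hden : 0 < ‖A.n x‖ + A.sa := by positivity
  set t := A.sa / (‖A.n x‖ + A.sa) with ht
  have ht0 : 0 < t := div_pos hsa hden
  have ht1 : t ≤ 1 := by rw [ht, div_le_one hden]; linarith [norm_nonneg (A.n x)]
  have htm : t ∈ Icc (0 : ℝ) 1 := ⟨ht0.le, ht1⟩
  -- the chord from `Z` to `x` meets the axis at the parameter `t`
  have hte : t * ‖A.n x‖ = (1 - t) * A.sa := by rw [ht]; field_simp; ring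
  obtain ⟨h1, h2⟩ := S.smul_tan_seg hK htm A.O
  obtain ⟨h3, h4⟩ := A.proj_of_smul h1
  set y := S.seg Z x t with hy
  have hl := S.lam_pos (S.K_mul_segQ_lt hK htm)
  set l := S.lam (S.segQ Z x t) with hldef
  have h2' : (1 - t) * A.h Z + t * A.h x = l * A.h y := h2
  rw [h_rim hZ] at h2'
  rw [(A.mem_rim_iff.1 hZ).2, mul_zero, zero_add] at h3
  have hyn : A.n y = 0 := by
    have : A.sa • l • A.n y = 0 := by
      rw [← h4, smul_add, smul_smul, smul_smul, mul_comm A.sa, ← hte, mul_comm A.sa, mul_smul,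
        mul_smul, ← smul_add, hrel, smul_zero]
    exact (smul_eq_zero.1 ((smul_eq_zero.1 this).resolve_left hsa.ne')).resolve_left hl.ne'
  have h7 : t * |A.p x| = l * |A.p y| := by
    have := congrArg abs h3
    rwa [abs_mul, abs_mul, abs_of_pos ht0, abs_of_pos hl] at this
  have key : l * (|A.p y| * A.ca - A.sa * A.h y) = t * A.σ x := by
    rw [σ]
    linear_combination (-A.ca) * h7 + A.sa * h2' + A.ca * hte
  have hyp : |A.p y| * A.ca ≤ A.sa * A.h y := by
    by_contra! hlt
    have := mul_pos hl (sub_pos.2 hlt)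
    rw [key] at this
    nlinarith
  obtain ⟨-, h8, h9⟩ := A.dist_of_axis hyn hyp
  refine ⟨Z, hZ, y, hF, h8, S.seg_dist hK htm, fun h0 => h9 ?_⟩
  rw [h0, mul_zero] at key
  linarith [(mul_eq_zero.1 key).resolve_left hl.ne']

end Rim

end Axis
end SpaceForm
end ConstCurv

namespace ConstCurv

/-! ### The rounded spindle -/

namespace SpaceForm

variable {X V : Type} [MetricSpace X] [NormedAddCommGroup V] [InnerProductSpace ℝ V]
variable {S : SpaceForm X V}

variable (S) in
lemma continuous_tan (P : X) : Continuous (S.tan P) := by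
  have key : ∀ x y, ‖S.tan P x - S.tan P y‖ ^ 2 = 2 * S.F x y - S.K * (S.F P x - S.F P y) ^ 2 := by
    intro x y
    rw [norm_sub_sq_real, S.norm_tan_sq, S.norm_tan_sq, S.F_law P x y]
    ring
  rw [continuous_iff_continuousAt]
  intro y
  rw [ContinuousAt, tendsto_iff_norm_sub_tendsto_zero]
  have h1 : Continuous fun x => √(2 * S.F x y - S.K * (S.F P x - S.F P y) ^ 2) := by
    have h2 := S.continuous_F continuous_id (continuous_const (y := y))
    have h3 := S.continuous_F (continuous_const (y := P)) continuous_id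
    simp only [id] at h2 h3
    fun_prop
  have h2 := h1.tendsto y
  rw [S.F_self, sub_self] at h2
  simp only [← key, Real.sqrt_sq (norm_nonneg _)] at h2
  simpa using h2

lemma joinedIn_of_between [Nontrivial V] {U : Set X} {a b : X} (hK : S.K * S.F a b < 2)
    (h : ∀ w, dist a w + dist w b = dist a b → w ∈ U) : JoinedIn U a b := by
  refine JoinedIn.ofLine (f := S.seg a b) (S.continuousOn_seg_right hK) (S.seg_zero hK)
    (S.seg_one hK) ?_
  rintro _ ⟨t, ht, rfl⟩
  exact h _ (S.seg_dist hK ht)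

namespace Axis

variable (A : Axis S)

lemma continuous_p : Continuous A.p := continuous_const.inner (S.continuous_tan A.O)

lemma continuous_n : Continuous A.n :=
  (S.continuous_tan A.O).sub (A.continuous_p.smul continuous_const)

lemma continuous_F_O : Continuous fun x => S.F A.O x :=
  S.continuous_F continuous_const continuous_id

lemma continuous_σ : Continuous A.σ := by
  have h1 := A.continuous_p
  have h2 := A.continuous_n
  have h3 := A.continuous_F_O
  unfold σ h
  fun_prop

lemma continuous_φ : Continuous A.φ := by
  have h2 := A.continuous_n
  have h3 := A.continuous_F_O
  unfold φ
  fun_prop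

/-- The domain bounded by the rounded spindle with caps of radius `r` and arcs of radius
`ρ + r`. -/
def spindle (r : ℝ) : Set X :=
  gball dist A.C r ∪ gball dist A.C' r ∪ {x | A.σ x ≤ 0 ∧ A.φ x ≤ S.md (A.ρ + r)}

/-- The set given by the strict inequalities. Its closure is the spindle. -/
def openSpindle (r : ℝ) : Set X :=
  {x | dist A.C x < r} ∪ {x | dist A.C' x < r} ∪ {x | A.σ x < 0 ∧ A.φ x < S.md (A.ρ + r)}

variable {A} {r : ℝ}

lemma ρ_pos : 0 < A.ρ := A.α_pos.trans_le A.α_le_ρ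

lemma φ_le_of_mem (hV : 2 ≤ Module.finrank ℝ V) (hd : A.ρ + r ∈ S.dom) {x : X}
    (hx : x ∈ A.spindle r) : A.φ x ≤ S.md (A.ρ + r) := by
  obtain ⟨Z, hZ, hF, -⟩ := A.exists_rim_far hV x
  rcases hx with (hx | hx) | hx
  · rw [← hF, ← S.dist_le_iff hd]
    have : dist A.C x ≤ r := hx
    linarith [dist_triangle Z A.C x, hZ.1]
  · rw [← hF, ← S.dist_le_iff hd]
    have : dist A.C' x ≤ r := hx
    linarith [dist_triangle Z A.C' x, hZ.2]
  · exact hx.2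

lemma dist_rim_le (hV : 2 ≤ Module.finrank ℝ V) (hd : A.ρ + r ∈ S.dom) {x Z : X}
    (hx : x ∈ A.spindle r) (hZ : Z ∈ A.rim) : dist Z x ≤ A.ρ + r := by
  rw [S.dist_le_iff hd]
  exact (F_rim_le hZ x).trans (φ_le_of_mem hV hd hx)

lemma isClosed_spindle : IsClosed (A.spindle r) :=
  ((isClosed_le (continuous_const.dist continuous_id) continuous_const).union
    (isClosed_le (continuous_const.dist continuous_id) continuous_const)).union
    ((isClosed_le A.continuous_σ continuous_const).inter
      (isClosed_le A.continuous_φ continuous_const))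

lemma isOpen_openSpindle : IsOpen (A.openSpindle r) :=
  ((isOpen_lt (continuous_const.dist continuous_id) continuous_const).union
    (isOpen_lt (continuous_const.dist continuous_id) continuous_const)).union
    ((isOpen_lt A.continuous_σ continuous_const).inter
      (isOpen_lt A.continuous_φ continuous_const))

lemma openSpindle_subset : A.openSpindle r ⊆ A.spindle r := by
  rintro x ((hx | hx) | hx)
  · exact Or.inl (Or.inl (le_of_lt (α := ℝ) hx))
  · exact Or.inl (Or.inr (le_of_lt (α := ℝ) hx))
  · exact Or.inr ⟨hx.1.le, hx.2.le⟩

/-- The rays bounding the sectors belong to the open spindle, as they run through the caps. -/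
lemma mem_openSpindle (hV : 2 ≤ Module.finrank ℝ V) (hd : A.ρ + r ∈ S.dom)
    (hK : S.K * S.md (A.ρ + r) ≤ 1) {x : X} (h1 : A.σ x ≤ 0) (h2 : A.φ x < S.md (A.ρ + r)) :
    x ∈ A.openSpindle r := by
  rcases h1.lt_or_eq with h | h
  · exact Or.inr ⟨h, h2⟩
  obtain ⟨Z, hZ, y, hF, -, hZy, hy⟩ := A.exists_of_sector hV hK h1 h2.le
  rw [← hF, ← S.dist_lt_iff hd] at h2
  refine Or.inl ?_
  rcases hy h with rfl | rfl
  · left; change dist A.C x < r; linarith [hZ.1]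
  · right; change dist A.C' x < r; linarith [hZ.2]

lemma axis_mem_openSpindle (hV : 2 ≤ Module.finrank ℝ V) (hr : 0 < r) (hd : A.ρ + r ∈ S.dom)
    (hK : S.K * S.md (A.ρ + r) ≤ 1) {y : X} (hy : dist A.C y + dist y A.C' = dist A.C A.C') :
    y ∈ A.openSpindle r := by
  have : Nontrivial V := Module.nontrivial_of_finrank_pos (R := ℝ) (by omega)
  obtain ⟨h1, h2⟩ := axis_of_dist hy
  refine mem_openSpindle hV hd hK ?_ ?_
  · rw [σ, h1, norm_zero]; linarith
  · exact (φ_axis_le h1 (dist_of_axis h1 h2).1).trans_lt ((S.lt_iff A.ρ_mem hd).2 (by linarith))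

lemma spindle_eq_closure (hV : 2 ≤ Module.finrank ℝ V) (hr : 0 < r) (hd : A.ρ + r ∈ S.dom)
    (hK : S.K * S.md (A.ρ + r) ≤ 1) : A.spindle r = closure (A.openSpindle r) := by
  have : Nontrivial V := Module.nontrivial_of_finrank_pos (R := ℝ) (by omega)
  refine subset_antisymm ?_ (closure_minimal openSpindle_subset isClosed_spindle)
  have hball : ∀ c x : X, dist c x ≤ r → x ∈ closure {x | dist c x < r} := by
    intro c x hx
    rcases eq_or_ne c x with rfl | hne
    · refine subset_closure ?_
      change dist c c < r
      rwa [dist_self]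
    · refine S.mem_closure_of_between hne fun w hw hadd => ?_
      change dist c w < r
      linarith [dist_pos.2 hw]
  rintro x ((hx | hx) | ⟨h1, h2⟩)
  · exact closure_mono (fun w hw => Or.inl (Or.inl hw)) (hball _ x hx)
  · exact closure_mono (fun w hw => Or.inl (Or.inr hw)) (hball _ x hx)
  · obtain ⟨Z, hZ, y, hF, hyC, hZy, -⟩ := A.exists_of_sector hV hK h1 h2
    have hZx : dist Z x ≤ A.ρ + r := by rwa [S.dist_le_iff hd, hF]
    rcases eq_or_ne y x with rfl | hne
    · exact subset_closure (axis_mem_openSpindle hV hr hd hK hyC)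
    · refine S.mem_closure_of_between hne fun w hw hadd => ?_
      have hw0 := dist_pos.2 hw
      have t1 := dist_triangle Z y w
      have t2 := dist_triangle Z w x
      have hKw : S.K * S.F Z w < 2 :=
        S.K_md_lt_of_le two_pos (S.dist_mem Z w) hd (by linarith) (by linarith)
      obtain ⟨h3, h4⟩ := sector_of_dist hZ hyC (x := w) (by linarith) hKw
      refine mem_openSpindle hV hd hK h4 ?_
      rw [← h3, ← S.dist_lt_iff hd]
      linarith

lemma isConnected_openSpindle (hV : 2 ≤ Module.finrank ℝ V) (hr : 0 < r) (hd : A.ρ + r ∈ S.dom)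
    (hK : S.K * S.md (A.ρ + r) ≤ 1) : IsConnected (A.openSpindle r) := by
  have : Nontrivial V := Module.nontrivial_of_finrank_pos (R := ℝ) (by omega)
  have hCC : S.K * S.F A.C A.C' < 2 := by
    have h1 := S.K_md_lt_one_of_lt A.ρ_mem hd (by linarith) hK
    rw [F, A.dist_C_C', S.md_two_mul, A.sn_sq]
    linarith
  have hlt : ∀ a b, dist a b ≤ A.ρ + r → S.K * S.F a b < 2 := fun a b hab =>
    S.K_md_lt_of_le two_pos (S.dist_mem a b) hd hab (by linarith)
  have haxis : ∀ y, dist A.C y + dist y A.C' = dist A.C A.C' →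
      JoinedIn (A.openSpindle r) A.C y := by
    intro y hy
    refine S.joinedIn_of_between (S.K_md_lt_of_le two_pos (S.dist_mem _ _) (S.dist_mem _ _) ?_ hCC)
      fun w hw => axis_mem_openSpindle hV hr hd hK ?_
    · linarith [dist_nonneg (x := y) (y := A.C')]
    · refine le_antisymm ?_ (dist_triangle _ _ _)
      linarith [dist_triangle w y A.C']
  have hρ := A.ρ_pos
  refine IsPathConnected.isConnected ⟨A.C, axis_mem_openSpindle hV hr hd hK (by simp), ?_⟩
  rintro x ((hx | hx) | ⟨h1, h2⟩)
  · have hx' : dist A.C x < r := hx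
    refine S.joinedIn_of_between (hlt _ _ (by linarith)) fun w hw => Or.inl (Or.inl ?_)
    change dist A.C w < r
    linarith [dist_nonneg (x := w) (y := x)]
  · have hx' : dist A.C' x < r := hx
    refine (haxis A.C' (by simp)).trans
      (S.joinedIn_of_between (hlt _ _ (by linarith)) fun w hw => Or.inl (Or.inr ?_))
    change dist A.C' w < r
    linarith [dist_nonneg (x := w) (y := x)]
  · obtain ⟨Z, hZ, y, hF, hyC, hZy, -⟩ := A.exists_of_sector hV hK h1.le h2.le
    have hZx : dist Z x < A.ρ + r := by rwa [S.dist_lt_iff hd, hF]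
    have hZy0 := dist_nonneg (x := Z) (y := y)
    refine (haxis y hyC).trans
      (S.joinedIn_of_between (hlt _ _ (by linarith)) fun w hw => ?_)
    have t0 := dist_nonneg (x := w) (y := x)
    have t1 := dist_triangle Z y w
    have t2 := dist_triangle Z w x
    obtain ⟨h3, h4⟩ := sector_of_dist hZ hyC (x := w) (by linarith) (hlt _ _ (by linarith))
    refine mem_openSpindle hV hd hK h4 ?_
    rw [← h3, ← S.dist_lt_iff hd]
    linarith

lemma isRoundedSpindle_spindle (hV : 2 ≤ Module.finrank ℝ V) (hd : A.ρ + r ∈ S.dom)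
    (hK : S.K * S.md (A.ρ + r) ≤ 1) : IsRoundedSpindle dist (A.ρ + r) r (A.spindle r) := by
  have : Nontrivial V := Module.nontrivial_of_finrank_pos (R := ℝ) (by omega)
  obtain ⟨Z, hZ, -⟩ := A.exists_rim_far hV A.C
  refine ⟨A.C, A.C', ⟨Z, ?_⟩, ?_⟩
  · rw [add_sub_cancel_right]; exact hZ
  rw [add_sub_cancel_right, spindle]
  congr 1
  ext x
  constructor
  · rintro ⟨h1, h2⟩
    obtain ⟨Z, hZ, y, hF, hyC, hZy, -⟩ := A.exists_of_sector hV hK h1 h2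
    exact ⟨Z, y, hZ.1, hZ.2, hyC, hZy, by rwa [S.dist_le_iff hd, hF]⟩
  · rintro ⟨Z, y, h1, h2, hyC, hZy, hZx⟩
    have hZ : Z ∈ A.rim := ⟨h1, h2⟩
    obtain ⟨h3, h4⟩ := sector_of_dist hZ hyC hZy
      (S.K_md_lt_of_le two_pos (S.dist_mem _ _) hd hZx (by linarith))
    refine ⟨h4, ?_⟩
    rwa [← h3, ← S.dist_le_iff hd]

lemma frontier_spindle_nonempty [ProperSpace X] (hV : 2 ≤ Module.finrank ℝ V) (hr : 0 < r)
    (hd : A.ρ + r ∈ S.dom) (hK : S.K * S.md (A.ρ + r) ≤ 1) :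
    (frontier (A.spindle r)).Nonempty := by
  have : Nontrivial V := Module.nontrivial_of_finrank_pos (R := ℝ) (by omega)
  obtain ⟨Z, hZ, -⟩ := A.exists_rim_far hV A.C
  have hb := fun x (hx : x ∈ A.spindle r) => dist_rim_le hV hd hx hZ
  have hcomp : IsCompact (A.spindle r) := by
    refine Metric.isCompact_of_isClosed_isBounded isClosed_spindle
      ((Metric.isBounded_closedBall (x := Z) (r := A.ρ + r)).subset fun x hx => ?_)
    rw [Metric.mem_closedBall, dist_comm]
    exact hb x hx
  have hne : (A.spindle r).Nonempty :=
    ⟨A.C, openSpindle_subset (axis_mem_openSpindle hV hr hd hK (by simp))⟩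
  obtain ⟨P, hP, hmax⟩ := hcomp.exists_isMaxOn hne
    (f := fun x => dist Z x) (by fun_prop : Continuous fun x => dist Z x).continuousOn
  exact ⟨P, S.mem_frontier_of_farthest (S.K_md_lt_of_le two_pos (S.dist_mem _ _) hd (hb P hP)
    (by linarith)) hP hmax⟩

/-- At a boundary point `P` with `σ P ≤ 0`, the outer ball is the one about the farthest point `Z` of
the rim, and the inner ball is the one of radius `r` tangent to it at `P`. If `0 < σ P`, then one of
the two balls about `C` and `C'` is the inner ball, and the spindle coincides with it near `P`. -/
lemma pinched_spindle (hV : 2 ≤ Module.finrank ℝ V) (hr : 0 < r)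
    (hd : A.ρ + r ∈ S.dom) (hK : S.K * S.md (A.ρ + r) ≤ 1) {P : X}
    (hP : P ∈ frontier (A.spindle r)) :
    ∃ O₁ O₂, dist O₁ P = A.ρ + r ∧ dist O₂ P = r ∧ dist O₁ O₂ ≤ A.ρ ∧
      (∀ᶠ x in 𝓝 P, dist O₂ x ≤ r → x ∈ A.spindle r) ∧
      ∀ᶠ x in 𝓝 P, x ∈ A.spindle r → dist O₁ x ≤ A.ρ + r := by
  have : Nontrivial V := Module.nontrivial_of_finrank_pos (R := ℝ) (by omega)
  have hρ := A.ρ_pos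
  have hPD : P ∈ A.spindle r := isClosed_spindle.frontier_subset hP
  have hPU : P ∉ A.openSpindle r := fun h =>
    hP.2 (interior_maximal openSpindle_subset isOpen_openSpindle h)
  have hφ := φ_le_of_mem hV hd hPD
  rcases le_or_gt (A.σ P) 0 with hσ | hσ
  · have hφ' : A.φ P = S.md (A.ρ + r) :=
      hφ.antisymm (not_lt.1 fun h => hPU (mem_openSpindle hV hd hK hσ h))
    obtain ⟨Z, hZ, y, hF, hyC, hZy, hy⟩ := A.exists_of_sector hV hK hσ hφ
    have hZP : dist Z P = A.ρ + r := S.dist_eq_of_F hd (hF.trans hφ')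
    have hout : ∀ᶠ x in 𝓝 P, x ∈ A.spindle r → dist Z x ≤ A.ρ + r :=
      Eventually.of_forall fun x hx => dist_rim_le hV hd hx hZ
    rcases hσ.lt_or_eq with hlt | h0
    -- The centre `O₂` of the inner ball lies on the segment from `Z` to `P` beyond the axis, so it has
    -- distance at most `ρ` from all points of the rim.
    · obtain ⟨h1, h2⟩ := axis_of_dist hyC
      have hZyρ : dist Z y ≤ A.ρ := by
        rw [S.dist_le_iff A.ρ_mem]
        exact (F_rim_le hZ y).trans (φ_axis_le h1 (dist_of_axis h1 h2).1)
      obtain ⟨O₂, hO1, hO2⟩ := S.exists_between_dist y P (r := A.ρ - dist Z y) (by linarith)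
        (by linarith)
      have hZO : dist Z O₂ = A.ρ := by
        linarith [dist_triangle Z y O₂, dist_triangle Z O₂ P]
      have hφO : A.φ O₂ = S.md A.ρ := by
        rw [← (sector_of_dist hZ hyC (x := O₂) (by linarith)
          (S.K_md_lt_of_le two_pos (S.dist_mem _ _) hd (by linarith) (by linarith))).1, F, hZO]
      refine ⟨Z, O₂, hZP, by linarith, hZO.le, ?_, hout⟩
      filter_upwards [A.continuous_σ.continuousAt.eventually_lt_const hlt] with x hx hxO
      refine Or.inr ⟨hx.le, ?_⟩
      obtain ⟨W, hW, hWF, -⟩ := A.exists_rim_far hV x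
      rw [← hWF, ← S.dist_le_iff hd]
      have : dist W O₂ ≤ A.ρ := by
        rw [S.dist_le_iff A.ρ_mem, ← hφO]; exact F_rim_le hW O₂
      linarith [dist_triangle W O₂ x]
    · rcases hy h0 with rfl | rfl
      · exact ⟨Z, A.C, hZP, by linarith [hZ.1], hZ.1.le,
          Eventually.of_forall fun x hx => Or.inl (Or.inl hx), hout⟩
      · exact ⟨Z, A.C', hZP, by linarith [hZ.2], hZ.2.le,
          Eventually.of_forall fun x hx => Or.inl (Or.inr hx), hout⟩
  · have hrd : r ∈ S.dom := S.mem_of_le hd hr.le (by linarith)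
    have key : ∀ c, dist c P = r → (∀ x, dist c x ≤ r → x ∈ A.spindle r) →
        (∀ᶠ x in 𝓝 P, x ∈ A.spindle r → dist c x ≤ r) →
        ∃ O₁ O₂, dist O₁ P = A.ρ + r ∧ dist O₂ P = r ∧ dist O₁ O₂ ≤ A.ρ ∧
          (∀ᶠ x in 𝓝 P, dist O₂ x ≤ r → x ∈ A.spindle r) ∧
          ∀ᶠ x in 𝓝 P, x ∈ A.spindle r → dist O₁ x ≤ A.ρ + r := by
      intro c hc hin hloc
      obtain ⟨O₁, h1, h2⟩ := S.exists_extension P c hd (by rw [dist_comm, hc]; linarith)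
      rw [dist_comm P c, hc] at h2
      refine ⟨O₁, c, by rw [dist_comm, h1], hc, by rw [dist_comm, h2]; linarith,
        Eventually.of_forall hin, ?_⟩
      filter_upwards [hloc] with x hx hxD
      linarith [dist_triangle O₁ c x, hx hxD, dist_comm O₁ c]
    have hσ' : ∀ᶠ x in 𝓝 P, 0 < A.σ x := A.continuous_σ.continuousAt.eventually_const_lt hσ
    -- where `0 < σ`, the spindle is the union of the two balls, and the sign of `p` decides which of
    -- them is nearer
    have hcases : ∀ x ∈ A.spindle r, 0 < A.σ x → dist A.C x ≤ r ∨ dist A.C' x ≤ r := by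
      rintro x (hx | hx) hx'
      · exact hx
      · exact absurd hx.1 hx'.not_ge
    have hnC : r ≤ dist A.C P := not_lt.1 fun h => hPU (Or.inl (Or.inl h))
    have hnC' : r ≤ dist A.C' P := not_lt.1 fun h => hPU (Or.inl (Or.inr h))
    have hh : 0 ≤ A.h P := by
      have : dist A.O P ≤ A.ρ + r := by
        rcases hcases P hPD hσ with h | h
        · linarith [dist_triangle A.O A.C P, A.dist_C, A.α_le_ρ]
        · linarith [dist_triangle A.O A.C' P, A.dist_C', A.α_le_ρ]
      have := S.K_md_le_of_le zero_le_one (S.dist_mem A.O P) hd this hK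
      rw [h, F]; linarith
    have hp : A.p P ≠ 0 := by
      intro hp
      rw [σ, hp, abs_zero] at hσ
      nlinarith [A.ca_pos, A.sa_pos, norm_nonneg (A.n P), mul_nonneg A.sa_pos.le hh,
        mul_nonneg A.ca_pos.le (norm_nonneg (A.n P))]
    rcases hp.lt_or_gt with hp | hp
    · have hloc : ∀ x, A.p x < 0 → 0 < A.σ x → x ∈ A.spindle r → dist A.C' x ≤ r := by
        intro x h1 h2 h3
        rcases hcases x h3 h2 with h4 | h4
        · rw [S.dist_le_iff hrd] at h4 ⊢
          rw [A.F_C] at h4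
          rw [A.F_C']
          linarith [mul_neg_of_pos_of_neg A.sa_pos h1]
        · exact h4
      refine key A.C' (le_antisymm (hloc P hp hσ hPD) hnC') (fun x hx => Or.inl (Or.inr hx)) ?_
      filter_upwards [hσ', A.continuous_p.continuousAt.eventually_lt_const hp] with x h1 h2
      exact hloc x h2 h1
    · have hloc : ∀ x, 0 < A.p x → 0 < A.σ x → x ∈ A.spindle r → dist A.C x ≤ r := by
        intro x h1 h2 h3
        rcases hcases x h3 h2 with h4 | h4
        · exact h4
        · rw [S.dist_le_iff hrd] at h4 ⊢
          rw [A.F_C'] at h4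
          rw [A.F_C]
          linarith [mul_pos A.sa_pos h1]
      refine key A.C (le_antisymm (hloc P hp hσ hPD) hnC) (fun x hx => Or.inl (Or.inl hx)) ?_
      filter_upwards [hσ', A.continuous_p.continuousAt.eventually_const_lt hp] with x h1 h2
      exact hloc x h2 h1

lemma isPinchedConvex_spindle [ProperSpace X] (hV : 2 ≤ Module.finrank ℝ V) (hr : 0 < r)
    (hd : A.ρ + r ∈ S.dom) (hK : S.K * S.md (A.ρ + r) ≤ 1) :
    IsPinchedConvex dist (fun _ ρ κ => ρ = κ) (A.ρ + r) r (A.spindle r) := by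
  refine ⟨⟨A.openSpindle r, isOpen_openSpindle, isConnected_openSpindle hV hr hd hK,
    spindle_eq_closure hV hr hd hK⟩, frontier_spindle_nonempty hV hr hd hK, fun P hP => ?_⟩
  obtain ⟨O₁, O₂, h1, h2, h3, h4, h5⟩ := pinched_spindle hV hr hd hK hP
  exact pinched_of_balls isClosed_spindle h1 h2 (by linarith) h4 h5

lemma dist_exp_opposite {P x y : X} {s : ℝ} {v : V} (hv : ‖v‖ = 1)
    (h2s : 2 * s ∈ S.dom) (hx : dist P x = s) (hx' : S.tan P x = S.sn s • v)
    (hy : dist P y = s) (hy' : S.tan P y = S.sn s • -v) : dist x y = 2 * s := by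
  apply S.dist_eq_of_F h2s
  rw [S.F_law P, F, F, hx, hy, hx', hy', two_mul s, S.md_add, real_inner_smul_left,
    real_inner_smul_right, inner_neg_right, real_inner_self_eq_norm_sq, hv]
  ring

/-- The tips of the spindle bound the outer radius of an enclosing shell from below, and opposite
points of the rim bound the inner radius from above. -/
lemma le_of_isShell (hV : 2 ≤ Module.finrank ℝ V) (hr : 0 < r)
    (hd : A.ρ + r ∈ S.dom) (h2d : 2 * (A.ρ + r) ∈ S.dom) (hK : S.K * S.md (A.ρ + r) ≤ 1)
    {O : X} {r₀ R₀ : ℝ} (hs : IsShell dist (A.spindle r) O r₀ R₀) :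
    2 * A.α - A.ρ ≤ R₀ - r₀ := by
  have : Nontrivial V := Module.nontrivial_of_finrank_pos (R := ℝ) (by omega)
  have hα := A.α_pos
  have hαρ := A.α_le_ρ
  -- the tips of the spindle have distance `2 * (A.α + r)`
  have hR₀ : A.α + r ≤ R₀ := by
    have hs2 : 2 * (A.α + r) ∈ S.dom := S.mem_of_le h2d (by linarith) (by linarith)
    have hs1 : A.α + r ∈ S.dom := S.mem_of_le h2d (by linarith) (by linarith)
    have hrd : r ∈ S.dom := S.mem_of_le h2d (by linarith) (by linarith)
    have hr' : S.md r = S.md (A.α + r - A.α) := by rw [add_sub_cancel_left]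
    obtain ⟨T, hT, hT'⟩ := S.exists_exp A.O _ hs1 A.e A.norm_e
    obtain ⟨W, hW, hW'⟩ := S.exists_exp A.O _ hs1 (-A.e) (by rw [norm_neg, A.norm_e])
    have hTW := dist_exp_opposite A.norm_e hs2 hT hT' hW hW'
    have hTD : T ∈ A.spindle r := Or.inl (Or.inl (le_of_eq (S.dist_eq_of_F hrd (by
      rw [A.F_C, F, hT, p, hT', real_inner_smul_right, real_inner_self_eq_norm_sq, A.norm_e, hr',
        S.md_sub, ca, sa]; ring))))
    have hWD : W ∈ A.spindle r := Or.inl (Or.inr (le_of_eq (S.dist_eq_of_F hrd (by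
      rw [A.F_C', F, hW, p, hW', real_inner_smul_right, inner_neg_right,
        real_inner_self_eq_norm_sq, A.norm_e, hr', S.md_sub, ca, sa]; ring))))
    have h1 : dist O T ≤ R₀ := hs.subset_outer hTD
    have h2 : dist O W ≤ R₀ := hs.subset_outer hWD
    linarith [dist_triangle_left T W O]
  -- opposite points of the rim have distance `2 * A.α`
  have hr₀ : A.α ≤ A.ρ + r - r₀ := by
    obtain ⟨v, hv, hev⟩ := exists_unit_orthogonal hV A.e
    obtain ⟨Z, hZ, hZ'⟩ := S.exists_exp A.O _ A.α_mem v hv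
    obtain ⟨W, hW, hW'⟩ := S.exists_exp A.O _ A.α_mem (-v) (by rw [norm_neg, hv])
    have hZW := dist_exp_opposite hv A.two_mem hZ hZ' hW hW'
    have hZr : Z ∈ A.rim := A.mem_rim_iff.2 ⟨hZ, by
      rw [p, hZ', real_inner_smul_right, hev, mul_zero]⟩
    have hWr : W ∈ A.rim := A.mem_rim_iff.2 ⟨hW, by
      rw [p, hW', real_inner_smul_right, inner_neg_right, hev, neg_zero, mul_zero]⟩
    have h1 := S.dist_add_le_of_ball_subset hs.pos hd (by linarith) fun x hx =>
      dist_rim_le hV hd (hs.inner_subset hx) hZr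
    have h2 := S.dist_add_le_of_ball_subset hs.pos hd (by linarith) fun x hx =>
      dist_rim_le hV hd (hs.inner_subset hx) hWr
    linarith [dist_triangle_right Z W O]
  linarith

end Axis

variable (S) in
/-- The upper bound for the width, and a spindle for which it is attained. For `R₁ = R₂` the latter
is a ball. -/
theorem shell_and_spindle [ProperSpace X] [Nonempty X] [FiniteDimensional ℝ V]
    (hV : 2 ≤ Module.finrank ℝ V) {R₁ R₂ α : ℝ} (hR₂ : 0 < R₂) (hR : R₂ ≤ R₁)
    (h2R : 2 * R₁ ∈ S.dom) (hK : S.K * S.md R₁ ≤ 1)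
    (hα : α ∈ S.dom) (hαρ : S.sn α ^ 2 = S.md (R₁ - R₂)) (hαK : S.K * S.md α < 1) :
    (∀ D : Set X, IsPinchedConvex dist (fun _ ρ κ => ρ = κ) R₁ R₂ D →
      ∃ O r R, IsShell dist D O r R ∧ R ≤ R₁ ∧ R - r ≤ 2 * α - (R₁ - R₂)) ∧
    ∃ D : Set X, IsRoundedSpindle dist R₁ R₂ D ∧
      IsPinchedConvex dist (fun _ ρ κ => ρ = κ) R₁ R₂ D ∧
      (∃ O r R, IsShell dist D O r R ∧ R ≤ R₁ ∧ R - r = 2 * α - (R₁ - R₂)) ∧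
      ∀ O r R, IsShell dist D O r R → 2 * α - (R₁ - R₂) ≤ R - r := by
  have hnt : Nontrivial V := Module.nontrivial_of_finrank_pos (R := ℝ) (by omega)
  have hR₁ : R₁ ∈ S.dom := S.mem_of_le h2R (by linarith) (by linarith)
  have ha : ∀ D : Set X, IsPinchedConvex dist (fun _ ρ κ => ρ = κ) R₁ R₂ D →
      ∃ O r R, IsShell dist D O r R ∧ R ≤ R₁ ∧ R - r ≤ 2 * α - (R₁ - R₂) := fun D hD =>
    S.exists_shell hV hR₂ hR hR₁ hK hα hαρ hαK hD
  refine ⟨ha, ?_⟩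
  suffices h : ∃ D : Set X, IsRoundedSpindle dist R₁ R₂ D ∧
      IsPinchedConvex dist (fun _ ρ κ => ρ = κ) R₁ R₂ D ∧
      ∀ O r R, IsShell dist D O r R → 2 * α - (R₁ - R₂) ≤ R - r by
    obtain ⟨D, h1, h2, h3⟩ := h
    obtain ⟨O, r, R, h4, h5, h6⟩ := ha D h2
    exact ⟨D, h1, h2, ⟨O, r, R, h4, h5, h6.antisymm (h3 O r R h4)⟩, h3⟩
  obtain ⟨O⟩ := ‹Nonempty X›
  rcases hR.eq_or_lt with rfl | hlt
  · have hα0 : α = 0 := by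
      by_contra hne
      have := S.sn_pos hα (lt_of_le_of_ne (S.nonneg_of_mem α hα) (Ne.symm hne)) (by linarith)
      rw [sub_self, S.md_zero, sq_eq_zero_iff] at hαρ
      linarith
    refine ⟨gball dist O R₂, ⟨O, O, ⟨O, by simp, by simp⟩, ?_⟩,
      S.isPinchedConvex_ball hR₂ hR₁ (by linarith) O, fun O' r R h => ?_⟩
    · rw [union_self]
      refine (union_eq_left.2 ?_).symm
      rintro x ⟨Z, y, hZ, -, -, -, hx⟩
      rw [sub_self, dist_eq_zero] at hZ
      rwa [hZ] at hx
    · rw [hα0]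
      linarith [h.le]
  · have hρm : R₁ - R₂ ∈ S.dom := S.mem_of_le hR₁ (by linarith) (by linarith)
    have hα0 : 0 < α := by
      refine lt_of_le_of_ne (S.nonneg_of_mem α hα) ?_
      rintro rfl
      rw [S.sn_zero] at hαρ
      have := S.md_pos hρm (by linarith)
      norm_num at hαρ
      linarith
    have hαle : α ≤ R₁ - R₂ := by
      rw [← S.le_iff hα hρm, ← hαρ, S.sn_sq]
      nlinarith [S.md_nonneg hα]
    obtain ⟨v, hv⟩ := exists_norm_eq V (zero_le_one (α := ℝ))
    obtain ⟨C, hC, hC'⟩ := S.exists_exp O α hα v hv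
    obtain ⟨W, hW, hW'⟩ := S.exists_exp O α hα (-v) (by rw [norm_neg, hv])
    let A : Axis S := ⟨O, C, W, v, α, R₁ - R₂, hv, hα0,
      S.mem_of_le h2R (by linarith) (by linarith), hρm, hαρ, hαK, hC, hC', hW, by
        rw [hW', smul_neg]⟩
    have hA : A.ρ + R₂ = R₁ := sub_add_cancel _ _
    have h1 := A.isRoundedSpindle_spindle (r := R₂) hV (by rwa [hA]) (by rwa [hA])
    have h2 := A.isPinchedConvex_spindle (r := R₂) hV hR₂ (by rwa [hA]) (by rwa [hA])
    rw [hA] at h1 h2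
    exact ⟨A.spindle R₂, h1, h2, fun O r R h =>
      A.le_of_isShell hV hR₂ (by rwa [hA]) (by rwa [hA]) (by rwa [hA]) h⟩

end SpaceForm
end ConstCurv

namespace ConstCurv

/-! ### Quadrics as space forms -/

/-- A description of `X` as the quadric `B x x = 1 / K` in the vector space `E`, with the embedding
`ι` and the geodesic distance `d`, for which `md (d x y) = 1 / K - B x y`. The metric of `X` is the
chordal one; it is used for its topology only. The map `frame P` identifies the model space `V`
with the tangent space at `P`, the orthogonal complement of `P` with respect to `B`, and
`exists_point` provides the geodesics. -/
structure Quadric (T : Trigonometry) (X E V : Type) [MetricSpace X] [NormedAddCommGroup E]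
    [NormedSpace ℝ E] [NormedAddCommGroup V] [InnerProductSpace ℝ V] where
  K_ne : T.K ≠ 0
  ι : X → E
  B : E →L[ℝ] E →L[ℝ] ℝ
  d : X → X → ℝ
  frame : X → V →L[ℝ] E
  dist_eq : ∀ x y, dist x y = ‖ι x - ι y‖
  B_comm : ∀ v w, B v w = B w v
  B_self : ∀ x, B (ι x) (ι x) = 1 / T.K
  d_mem : ∀ x y, d x y ∈ T.dom
  md_d : ∀ x y, T.md (d x y) = 1 / T.K - B (ι x) (ι y)
  continuous_d : ∀ x, Continuous (d x)
  frame_inner : ∀ P v w, B (frame P v) (frame P w) = inner ℝ v w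
  frame_orth : ∀ P v, B (ι P) (frame P v) = 0
  exists_frame : ∀ P w, B (ι P) w = 0 → ∃ v, frame P v = w
  exists_point : ∀ P, ∀ s ∈ T.dom, ∀ v, ‖v‖ = 1 →
    ∃ x, ι x = (1 - T.K * T.md s) • ι P + T.sn s • frame P v

namespace Quadric

variable {T : Trigonometry} {X E V : Type} [MetricSpace X] [NormedAddCommGroup E]
  [NormedSpace ℝ E] [NormedAddCommGroup V] [InnerProductSpace ℝ V] (Q : Quadric T X E V)

lemma B_eq (x y : X) : Q.B (Q.ι x) (Q.ι y) = 1 / T.K - T.md (Q.d x y) := by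
  rw [Q.md_d]; ring

lemma d_self (x : X) : Q.d x x = 0 := by
  refine T.strictMonoOn_md.injOn (Q.d_mem x x) T.zero_mem ?_
  rw [Q.md_d, Q.B_self, sub_self, T.md_zero]

lemma d_comm (x y : X) : Q.d x y = Q.d y x := by
  refine T.strictMonoOn_md.injOn (Q.d_mem x y) (Q.d_mem y x) ?_
  rw [Q.md_d, Q.md_d, Q.B_comm]

lemma exists_tan (P x : X) :
    ∃ τ, Q.ι x = (1 - T.K * T.md (Q.d P x)) • Q.ι P + Q.frame P τ := by
  obtain ⟨v, hv⟩ := Q.exists_frame P (Q.ι x - (1 - T.K * T.md (Q.d P x)) • Q.ι P) (by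
    rw [map_sub, map_smul, smul_eq_mul, Q.B_self, Q.B_eq]
    field_simp [Q.K_ne]
    ring)
  exact ⟨v, by rw [hv]; abel⟩

/-- The tangent vector at `P` that points to `x`, of length `sn (d P x)`: the component of `x`
orthogonal to `P`, transported to `V`. -/
noncomputable def tan (P x : X) : V := (Q.exists_tan P x).choose

lemma ι_eq (P x : X) : Q.ι x = (1 - T.K * T.md (Q.d P x)) • Q.ι P + Q.frame P (Q.tan P x) :=
  (Q.exists_tan P x).choose_spec

lemma law (P x y : X) : T.md (Q.d x y) = T.md (Q.d P x) + T.md (Q.d P y)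
    - T.K * T.md (Q.d P x) * T.md (Q.d P y) - inner ℝ (Q.tan P x) (Q.tan P y) := by
  rw [Q.md_d, Q.ι_eq P x, Q.ι_eq P y]
  simp only [map_add, map_smul, add_apply, smul_apply, smul_eq_mul, Q.B_self, Q.frame_inner,
    Q.frame_orth, Q.B_comm (Q.frame P _) (Q.ι P)]
  field_simp [Q.K_ne]
  ring

lemma norm_tan (P x : X) : ‖Q.tan P x‖ = T.sn (Q.d P x) := by
  have h := Q.law P x x
  have h2 := T.md_sub (Q.d P x) (Q.d P x)
  rw [Q.d_self, real_inner_self_eq_norm_sq] at h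
  rw [sub_self] at h2
  refine (pow_left_inj₀ (norm_nonneg _) (T.sn_nonneg _ (Q.d_mem P x)) two_ne_zero).1 ?_
  linarith

lemma d_triangle (x y z : X) : Q.d x z ≤ Q.d x y + Q.d y z := by
  have h0 := T.nonneg_of_mem _ (Q.d_mem x y)
  have h1 := T.nonneg_of_mem _ (Q.d_mem y z)
  by_cases hmem : Q.d x y + Q.d y z ∈ T.dom
  · rw [← T.strictMonoOn_md.le_iff_le (Q.d_mem x z) hmem, T.md_add, Q.law y x z, Q.d_comm x y,
      ← Q.norm_tan, ← Q.norm_tan]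
    have := real_inner_le_norm (-Q.tan y x) (Q.tan y z)
    rw [inner_neg_left, norm_neg] at this
    linarith
  · by_contra! hlt
    exact hmem (T.ordConnected_dom.out T.zero_mem (Q.d_mem x z) ⟨by linarith, hlt.le⟩)

/-- The chordal distance tends to `0` with the geodesic distance. -/
lemma dist_le (x y : X) : dist x y ≤
    |T.K * T.md (Q.d x y)| * ‖Q.ι x‖ + ‖Q.frame x‖ * |T.sn (Q.d x y)| := by
  have h : Q.ι y - Q.ι x = -(T.K * T.md (Q.d x y)) • Q.ι x + Q.frame x (Q.tan x y) := by
    rw [Q.ι_eq x y]; module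
  rw [dist_comm, Q.dist_eq, h]
  refine (norm_add_le _ _).trans (add_le_add ?_ ?_)
  · rw [norm_smul, norm_neg, Real.norm_eq_abs]
  · rw [← Q.norm_tan, abs_norm]
    exact (Q.frame x).le_opNorm _

lemma sn_zero (T : Trigonometry) : T.sn 0 = 0 := by
  have := T.md_sub 0 0
  rw [sub_self, T.md_zero] at this
  simpa using this

lemma continuous_bound (x : X) :
    Continuous fun s => |T.K * T.md s| * ‖Q.ι x‖ + ‖Q.frame x‖ * |T.sn s| := by
  have h1 := T.continuous_md
  have h2 := T.continuous_sn
  fun_prop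

lemma eq_of_d_eq_zero (x y : X) (h : Q.d x y = 0) : x = y := by
  have := Q.dist_le x y
  rw [h, sn_zero, T.md_zero] at this
  simpa using this

lemma isOpen_iff (s : Set X) : IsOpen s ↔ ∀ x ∈ s, ∃ ε > 0, ∀ y, Q.d x y < ε → y ∈ s := by
  constructor
  · intro hs x hx
    obtain ⟨δ, hδ, hsub⟩ := Metric.isOpen_iff.1 hs x hx
    have hg := (Q.continuous_bound x).tendsto 0
    rw [sn_zero, T.md_zero] at hg
    simp only [mul_zero, abs_zero, zero_mul, add_zero] at hg
    obtain ⟨ε, hε, h⟩ := Metric.eventually_nhds_iff.1 (hg.eventually_lt_const hδ)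
    refine ⟨ε, hε, fun y hy => hsub ?_⟩
    rw [Metric.mem_ball, dist_comm]
    refine (Q.dist_le x y).trans_lt (h ?_)
    rwa [Real.dist_0_eq_abs, abs_of_nonneg (T.nonneg_of_mem _ (Q.d_mem x y))]
  · intro h
    rw [isOpen_iff_mem_nhds]
    intro x hx
    obtain ⟨ε, hε, h⟩ := h x hx
    have := (Q.continuous_d x).continuousAt (x := x) |>.eventually_lt_const (u := ε)
      (by rwa [Q.d_self])
    exact mem_of_superset this h

lemma isCompact_ball [ProperSpace X] (x : X) (r : ℝ) : IsCompact {y | Q.d x y ≤ r} := by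
  refine Metric.isCompact_of_isClosed_isBounded
    (isClosed_le (Q.continuous_d x) continuous_const) ?_
  obtain ⟨M, hM⟩ := (isCompact_Icc (a := 0) (b := r)).bddAbove_image
    (Q.continuous_bound x).continuousOn
  refine (Metric.isBounded_closedBall (x := x) (r := M)).subset fun y hy => ?_
  rw [Metric.mem_closedBall, dist_comm]
  exact (Q.dist_le x y).trans (hM ⟨_, ⟨T.nonneg_of_mem _ (Q.d_mem x y), hy⟩, rfl⟩)

lemma exists_exp (P : X) {s : ℝ} (hs : s ∈ T.dom) {v : V} (hv : ‖v‖ = 1) :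
    ∃ x, Q.d P x = s ∧ Q.tan P x = T.sn s • v ∧
      Q.ι x = (1 - T.K * T.md s) • Q.ι P + T.sn s • Q.frame P v := by
  obtain ⟨x, hx⟩ := Q.exists_point P s hs v hv
  have hd : Q.d P x = s := by
    refine T.strictMonoOn_md.injOn (Q.d_mem P x) hs ?_
    rw [Q.md_d, hx, map_add, map_smul, map_smul, Q.frame_orth, Q.B_self]
    simp only [smul_eq_mul]
    field_simp [Q.K_ne]
    ring
  refine ⟨x, hd, ?_, hx⟩
  have h := Q.ι_eq P x
  rw [hx, hd, add_right_inj, ← map_smul] at h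
  have h0 : Q.frame P (Q.tan P x - T.sn s • v) = 0 := by rw [map_sub, ← h, sub_self]
  have h1 := Q.frame_inner P (Q.tan P x - T.sn s • v) (Q.tan P x - T.sn s • v)
  rw [h0, map_zero] at h1
  exact sub_eq_zero.1 (inner_self_eq_zero (𝕜 := ℝ).1 h1.symm)

/-- The geodesic distance as a metric, with the given topology. -/
noncomputable abbrev metric : MetricSpace X :=
  MetricSpace.ofDistTopology Q.d Q.d_self Q.d_comm Q.d_triangle Q.isOpen_iff Q.eq_of_d_eq_zero

/-- A quadric with its geodesic distance is a space form. -/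
noncomputable def spaceForm : @SpaceForm X V Q.metric _ _ :=
  @SpaceForm.mk X V Q.metric _ _ T Q.tan Q.d_mem Q.law fun P _ hs _ hv =>
    let ⟨x, h1, h2, _⟩ := Q.exists_exp P hs hv
    ⟨x, h1, h2⟩

/-- The result for space forms in terms of the geodesic distance `d` and the given topology. -/
theorem shell_and_spindle [ProperSpace X] [Nonempty X] [FiniteDimensional ℝ V]
    (hV : 2 ≤ Module.finrank ℝ V) {R₁ R₂ α : ℝ} (hR₂ : 0 < R₂) (hR : R₂ ≤ R₁)
    (h2R : 2 * R₁ ∈ T.dom) (hK : T.K * T.md R₁ ≤ 1)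
    (hα : α ∈ T.dom) (hαρ : T.sn α ^ 2 = T.md (R₁ - R₂)) (hαK : T.K * T.md α < 1) :
    (∀ D : Set X, IsPinchedConvex Q.d (fun _ ρ κ => ρ = κ) R₁ R₂ D →
      ∃ O r R, IsShell Q.d D O r R ∧ R ≤ R₁ ∧ R - r ≤ 2 * α - (R₁ - R₂)) ∧
    ∃ D : Set X, IsRoundedSpindle Q.d R₁ R₂ D ∧
      IsPinchedConvex Q.d (fun _ ρ κ => ρ = κ) R₁ R₂ D ∧
      (∃ O r R, IsShell Q.d D O r R ∧ R ≤ R₁ ∧ R - r = 2 * α - (R₁ - R₂)) ∧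
      ∀ O r R, IsShell Q.d D O r R → 2 * α - (R₁ - R₂) ≤ R - r := by
  have hprop : @ProperSpace X Q.metric.toPseudoMetricSpace := by
    refine @ProperSpace.mk X Q.metric.toPseudoMetricSpace fun x r => ?_
    have := Q.isCompact_ball x r
    simp only [Q.d_comm x] at this
    exact this
  exact @SpaceForm.shell_and_spindle X V Q.metric _ _ Q.spaceForm hprop _ _ hV R₁ R₂ α hR₂ hR h2R hK hα hαρ hαK

end Quadric
end ConstCurv

namespace ConstCurv

/-! ### Normal curvature of geodesic spheres -/

section Curves

variable {E : Type} [NormedAddCommGroup E] [NormedSpace ℝ E]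

lemma hasDerivAt_of_contDiff_two {c : ℝ → E} (hc : ContDiff ℝ 2 c) (t : ℝ) :
    HasDerivAt c (deriv c t) t ∧ HasDerivAt (deriv c) (iteratedDeriv 2 c t) t := by
  refine ⟨(hc.differentiable (by norm_num) t).hasDerivAt, ?_⟩
  rw [iteratedDeriv_succ, iteratedDeriv_one]
  have : ContDiff ℝ 1 (deriv c) := by
    have h2 : ContDiff ℝ (1 + 1) c := by norm_num; exact hc
    exact (contDiff_succ_iff_deriv.1 h2).2.2
  exact (this.differentiable (by norm_num) t).hasDerivAt

/-- If the linear form `l` is constant along `c`, it vanishes on the acceleration. -/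
lemma map_iteratedDeriv_two_eq_zero {c : ℝ → E} (hc : ContDiff ℝ 2 c) (l : E →L[ℝ] ℝ) {a : ℝ}
    (h : ∀ t, l (c t) = a) (t : ℝ) : l (iteratedDeriv 2 c t) = 0 := by
  have h1 : ∀ t, l (deriv c t) = 0 := fun t => by
    have := l.hasFDerivAt.comp_hasDerivAt t (hasDerivAt_of_contDiff_two hc t).1
    rw [show l ∘ c = fun _ => a from funext h] at this
    exact this.unique (hasDerivAt_const t a)
  have := l.hasFDerivAt.comp_hasDerivAt t (hasDerivAt_of_contDiff_two hc t).2
  rw [show l ∘ deriv c = fun _ => 0 from funext h1] at this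
  exact this.unique (hasDerivAt_const t 0)

/-- On a curve in a quadric, the product of acceleration and position is minus the squared speed. -/
lemma bilin_iteratedDeriv_two {c : ℝ → E} (hc : ContDiff ℝ 2 c) {B : E →L[ℝ] E →L[ℝ] ℝ}
    (hB : ∀ v w, B v w = B w v) {a : ℝ} (h : ∀ t, B (c t) (c t) = a) (t : ℝ) :
    B (iteratedDeriv 2 c t) (c t) = -B (deriv c t) (deriv c t) := by
  have h1 : ∀ t, B (deriv c t) (c t) = 0 := fun t => by
    have hd := (hasDerivAt_of_contDiff_two hc t).1
    have := (B.hasFDerivAt.comp_hasDerivAt t hd).clm_apply hd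
    simp only [Function.comp_apply, h] at this
    have := this.unique (hasDerivAt_const t a)
    rw [hB (c t)] at this
    linarith
  obtain ⟨hd, hd2⟩ := hasDerivAt_of_contDiff_two hc t
  have := (B.hasFDerivAt.comp_hasDerivAt t hd2).clm_apply hd
  simp only [Function.comp_apply, h1] at this
  have := this.unique (hasDerivAt_const t 0)
  linarith

/-- The circle with centre `a` and radius `s` in the plane spanned by `u` and `v`, parametrized with
unit speed if `u` and `v` are orthonormal. -/
noncomputable def circle (a u v : E) (s t : ℝ) : E :=
  a + s • (Real.cos (t / s) • u + Real.sin (t / s) • v)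

lemma contDiff_circle (a u v : E) (s : ℝ) : ContDiff ℝ 2 (circle a u v s) := by
  unfold circle
  fun_prop

lemma deriv_circle (a u v : E) {s : ℝ} (hs : s ≠ 0) (t : ℝ) :
    deriv (circle a u v s) t = -Real.sin (t / s) • u + Real.cos (t / s) • v := by
  have h0 : HasDerivAt (fun t : ℝ => t / s) (1 / s) t := (hasDerivAt_id t).div_const s
  have h1 := (h0.cos.smul_const u).add (h0.sin.smul_const v)
  have h2 : HasDerivAt (circle a u v s) _ t := (h1.const_smul s).const_add a
  rw [h2.deriv, smul_add, smul_smul, smul_smul]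
  congr 2 <;> field_simp

lemma bilin_deriv_circle {B : E →L[ℝ] E →L[ℝ] ℝ} (a : E) {u v : E} {s : ℝ} (hs : s ≠ 0)
    (hu : B u u = 1) (hv : B v v = 1) (huv : B u v = 0) (hvu : B v u = 0) (t : ℝ) :
    B (deriv (circle a u v s) t) (deriv (circle a u v s) t) = 1 := by
  rw [deriv_circle a u v hs]
  simp only [map_add, map_smul, add_apply, smul_apply, smul_eq_mul, hu, hv, huv, hvu]
  linear_combination Real.sin_sq_add_cos_sq (t / s)

end Curves

lemma exists_orthonormal_pair {V : Type} [NormedAddCommGroup V] [InnerProductSpace ℝ V]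
    (hV : 2 ≤ Module.finrank ℝ V) : ∃ u v : V, ‖u‖ = 1 ∧ ‖v‖ = 1 ∧ inner ℝ u v = 0 := by
  have : Nontrivial V := Module.nontrivial_of_finrank_pos (R := ℝ) (by omega)
  obtain ⟨u, hu⟩ := exists_norm_eq V (zero_le_one (α := ℝ))
  obtain ⟨v, hv, huv⟩ := exists_unit_orthogonal hV u
  exact ⟨u, v, hu, hv, huv⟩

lemma norm_cos_smul_add_sin_smul {V : Type} [NormedAddCommGroup V] [InnerProductSpace ℝ V]
    {u v : V} (hu : ‖u‖ = 1) (hv : ‖v‖ = 1) (huv : inner ℝ u v = 0) (t : ℝ) :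
    ‖Real.cos t • u + Real.sin t • v‖ = 1 := by
  rw [← sq_eq_sq₀ (norm_nonneg _) zero_le_one, norm_add_sq_real, norm_smul, norm_smul,
    real_inner_smul_left, real_inner_smul_right, huv, hu, hv, Real.norm_eq_abs,
    Real.norm_eq_abs, mul_one, mul_one, sq_abs, sq_abs]
  linear_combination Real.sin_sq_add_cos_sq t

/-- A sphere which carries a curve of unit speed has at most one constant normal curvature. -/
lemma hasConstNormalCurvature_iff {X E : Type} [NormedAddCommGroup E] [NormedSpace ℝ E]
    {ι : X → E} {β : E → E → ℝ} {S : Set X} {N : X → E} {κ₀ κ : ℝ}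
    (h : HasConstNormalCurvature ι β S N κ₀)
    (hγ : ∃ γ : ℝ → X, ContDiff ℝ 2 (fun t => ι (γ t)) ∧ (∀ t, γ t ∈ S) ∧
      ∀ t, β (deriv (fun s => ι (γ s)) t) (deriv (fun s => ι (γ s)) t) = 1) :
    HasConstNormalCurvature ι β S N κ ↔ κ = κ₀ := by
  constructor
  · intro h'
    obtain ⟨γ, h1, h2, h3⟩ := hγ
    rw [← h γ h1 h2 h3 0, ← h' γ h1 h2 h3 0]
  · rintro rfl
    exact h

namespace Quadric

variable {T : Trigonometry} {X E V : Type} [MetricSpace X] [NormedAddCommGroup E]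
  [NormedSpace ℝ E] [NormedAddCommGroup V] [InnerProductSpace ℝ V] (Q : Quadric T X E V)

/-- The geodesic sphere of radius `ρ` of a quadric has normal curvature `sn' ρ / sn ρ`. It is an affine
section of the quadric: `B O` is constant on it. -/
theorem curvature_iff (hV : 2 ≤ Module.finrank ℝ V) (O : X) {ρ κ : ℝ} (hρ : ρ ∈ T.dom)
    (hs : T.sn ρ ≠ 0) :
    HasConstNormalCurvature Q.ι (fun v w => Q.B v w) (gsphere Q.d O ρ)
      (fun x => (T.sn ρ)⁻¹ • (Q.ι O - (1 - T.K * T.md ρ) • Q.ι x)) κ ↔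
      κ = (1 - T.K * T.md ρ) / T.sn ρ := by
  apply hasConstNormalCurvature_iff
  · intro γ hγ hmem hsp t
    have h1 := bilin_iteratedDeriv_two hγ Q.B_comm (fun t => Q.B_self (γ t)) t
    have h2 := map_iteratedDeriv_two_eq_zero hγ (Q.B (Q.ι O)) (a := 1 / T.K - T.md ρ)
      (fun t => by rw [Q.B_eq, hmem t]) t
    rw [Q.B_comm] at h2
    simp only [hsp t] at h1
    simp only [map_smul, map_sub, smul_eq_mul, h1, h2]
    ring
  · obtain ⟨u, v, hu, hv, huv⟩ := exists_orthonormal_pair hV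
    have huv' : inner ℝ v u = 0 := by rw [real_inner_comm, huv]
    choose γ hγ _ hγι using fun t => Q.exists_exp O hρ
      (norm_cos_smul_add_sin_smul hu hv huv (t / T.sn ρ))
    have hc : (fun t => Q.ι (γ t)) = circle ((1 - T.K * T.md ρ) • Q.ι O) (Q.frame O u)
        (Q.frame O v) (T.sn ρ) := by
      funext t
      rw [hγι t, circle, map_add, map_smul, map_smul]
    refine ⟨γ, ?_, hγ, ?_⟩
    · rw [hc]; exact contDiff_circle _ _ _ _
    · rw [hc]
      refine bilin_deriv_circle _ hs ?_ ?_ ?_ ?_ <;> rw [Q.frame_inner]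
      · rw [real_inner_self_eq_norm_sq, hu, one_pow]
      · rw [real_inner_self_eq_norm_sq, hv, one_pow]
      · exact huv
      · exact huv'

end Quadric

/-- Normal curvatures may be replaced by the radii of the spheres that have them. -/
lemma IsPinchedConvex.congr {X : Type} [TopologicalSpace X] {d : X → X → ℝ}
    {curv curv' : X → ℝ → ℝ → Prop} {κ₁ κ₂ κ₁' κ₂' : ℝ} {D : Set X}
    (h₁ : ∀ O ρ, curv O ρ κ₁ ↔ curv' O ρ κ₁') (h₂ : ∀ O ρ, curv O ρ κ₂ ↔ curv' O ρ κ₂') :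
    IsPinchedConvex d curv κ₁ κ₂ D ↔ IsPinchedConvex d curv' κ₁' κ₂' D := by
  constructor
  · rintro ⟨h, h', h''⟩
    exact ⟨h, h', by simpa only [h₁, h₂] using h''⟩
  · rintro ⟨h, h', h''⟩
    exact ⟨h, h', by simpa only [h₁, h₂] using h''⟩

end ConstCurv

namespace ConstCurv

/-! ### Euclidean space -/

/-- The trigonometry of curvature `0`. -/
noncomputable def eucTrigonometry : Trigonometry where
  K := 0
  md t := t ^ 2 / 2
  sn t := t
  dom := Ici 0
  md_zero := by norm_num
  md_add a b := by ring
  md_sub a b := by ring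
  sn_sub a b := by ring
  continuous_md := by fun_prop
  continuous_sn := continuous_id
  zero_mem := self_mem_Ici
  ordConnected_dom := ordConnected_Ici
  nonneg_of_mem s hs := hs
  strictMonoOn_md a ha b hb hab := by
    have : (0 : ℝ) ≤ a := ha
    change a ^ 2 / 2 < b ^ 2 / 2
    nlinarith
  sn_nonneg s hs := hs
  exists_md_eq f hf _ := ⟨√(2 * f), Real.sqrt_nonneg _, by
    rw [Real.sq_sqrt (by linarith)]; ring⟩

/-- Euclidean space as a space form: the law of cosines is the usual one, divided by `2`. -/
noncomputable def eucSpaceForm (m : ℕ) : SpaceForm (Euc m) (Euc m) where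
  toTrigonometry := eucTrigonometry
  tan P x := x - P
  dist_mem x y := dist_nonneg
  law P x y := by
    change dist x y ^ 2 / 2 = dist P x ^ 2 / 2 + dist P y ^ 2 / 2
      - 0 * (dist P x ^ 2 / 2) * (dist P y ^ 2 / 2) - inner ℝ (x - P) (y - P)
    rw [dist_comm P x, dist_comm P y, dist_eq_norm, dist_eq_norm, dist_eq_norm,
      show x - y = (x - P) - (y - P) by abel, norm_sub_sq_real]
    ring
  exists_exp P s hs v hv := ⟨P + s • v, by
    have : (0 : ℝ) ≤ s := hs
    rw [dist_self_add_right, norm_smul, hv, mul_one, Real.norm_of_nonneg this],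
    add_sub_cancel_left P _⟩

lemma eucCurv_iff {m : ℕ} (hm : 2 ≤ m) {κ : ℝ} (hκ : 0 < κ) (O : Euc m) (ρ : ℝ) :
    eucCurv O ρ κ ↔ ρ = κ⁻¹ := by
  have key : 0 < ρ → (HasConstNormalCurvature (fun x : Euc m => x) (fun v w => inner ℝ v w)
      (gsphere eucDist O ρ) (fun x => ρ⁻¹ • (O - x)) κ ↔ κ = ρ⁻¹) := by
    intro hρ
    apply hasConstNormalCurvature_iff
    · intro γ hγ hmem hsp t
      have hd : deriv (fun t => γ t - O) = deriv γ := by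
        funext t; exact deriv_sub_const _
      have hd2 : iteratedDeriv 2 (fun t => γ t - O) = iteratedDeriv 2 γ := by
        rw [iteratedDeriv_succ, iteratedDeriv_one, iteratedDeriv_succ, iteratedDeriv_one, hd]
      have h1 := bilin_iteratedDeriv_two (c := fun t => γ t - O) (hγ.sub contDiff_const)
        (B := innerSL ℝ) (fun v w => real_inner_comm w v) (a := ρ ^ 2) (fun t => by
          have : dist O (γ t) = ρ := hmem t
          rw [innerSL_apply_apply, real_inner_self_eq_norm_sq, ← dist_eq_norm, dist_comm, this]) t
      have h2 : inner ℝ (deriv γ t) (deriv γ t) = 1 := hsp t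
      rw [hd, hd2, innerSL_apply_apply, innerSL_apply_apply, h2] at h1
      change inner ℝ (iteratedDeriv 2 γ t) (ρ⁻¹ • (O - γ t)) = ρ⁻¹
      rw [real_inner_smul_right, ← neg_sub, inner_neg_right, h1]
      ring
    · obtain ⟨u, v, hu, hv, huv⟩ := exists_orthonormal_pair (V := Euc m) (by simpa using hm)
      have huv' : inner ℝ v u = 0 := by rw [real_inner_comm, huv]
      refine ⟨circle O u v ρ, contDiff_circle _ _ _ _, fun t => ?_, fun t => ?_⟩
      · change dist O (circle O u v ρ t) = ρ
        rw [circle, dist_self_add_right, norm_smul,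
          norm_cos_smul_add_sin_smul hu hv huv, mul_one, Real.norm_of_nonneg hρ.le]
      · refine bilin_deriv_circle (B := innerSL ℝ) O hρ.ne' ?_ ?_ ?_ ?_ t <;>
          rw [innerSL_apply_apply]
        · rw [real_inner_self_eq_norm_sq, hu, one_pow]
        · rw [real_inner_self_eq_norm_sq, hv, one_pow]
        · exact huv
        · exact huv'
  constructor
  · rintro ⟨hρ, h⟩
    rw [(key hρ).1 h, inv_inv]
  · rintro rfl
    exact ⟨inv_pos.2 hκ, (key (inv_pos.2 hκ)).2 (inv_inv κ).symm⟩

/-! ### Spherical and hyperbolic trigonometry -/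

/-- The trigonometry of curvature `k ^ 2`. -/
noncomputable def sphTrigonometry {k : ℝ} (hk : 0 < k) : Trigonometry where
  K := k ^ 2
  md t := (1 - Real.cos (k * t)) / k ^ 2
  sn t := Real.sin (k * t) / k
  dom := Icc 0 (Real.pi / k)
  md_zero := by simp
  md_add a b := by
    rw [mul_add, Real.cos_add]; field_simp; ring
  md_sub a b := by
    rw [mul_sub, Real.cos_sub]; field_simp; ring
  sn_sub a b := by
    rw [mul_sub, Real.sin_sub]; field_simp; ring
  continuous_md := by fun_prop
  continuous_sn := by fun_prop
  zero_mem := ⟨le_rfl, by positivity⟩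
  ordConnected_dom := ordConnected_Icc
  nonneg_of_mem s hs := hs.1
  strictMonoOn_md a ha b hb hab := by
    have h1 : k * b ≤ Real.pi := by
      have := hb.2; rw [le_div_iff₀ hk] at this; linarith
    have h2 : Real.cos (k * b) < Real.cos (k * a) :=
      Real.strictAntiOn_cos ⟨mul_nonneg hk.le ha.1, by nlinarith⟩ ⟨mul_nonneg hk.le hb.1, h1⟩
        (by nlinarith)
    change (1 - Real.cos (k * a)) / k ^ 2 < (1 - Real.cos (k * b)) / k ^ 2
    gcongr
  sn_nonneg s hs := by
    have h1 : k * s ≤ Real.pi := by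
      have := hs.2; rw [le_div_iff₀ hk] at this; linarith
    exact div_nonneg (Real.sin_nonneg_of_nonneg_of_le_pi (mul_nonneg hk.le hs.1) h1) hk.le
  exists_md_eq f hf h := by
    have h2 : k ^ 2 * f ≤ 2 := by
      rcases hf.eq_or_lt with rfl | h0
      · norm_num
      · by_contra! hc
        nlinarith
    refine ⟨Real.arccos (1 - k ^ 2 * f) / k, ⟨div_nonneg (Real.arccos_nonneg _) hk.le, ?_⟩, ?_⟩
    · have := Real.arccos_le_pi (1 - k ^ 2 * f)
      gcongr
    · rw [mul_div_cancel₀ _ hk.ne', Real.cos_arccos (by linarith) (by nlinarith)]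
      field_simp
      ring

/-- The trigonometry of curvature `-k ^ 2`. -/
noncomputable def hypTrigonometry {k : ℝ} (hk : 0 < k) : Trigonometry where
  K := -k ^ 2
  md t := (Real.cosh (k * t) - 1) / k ^ 2
  sn t := Real.sinh (k * t) / k
  dom := Ici 0
  md_zero := by simp
  md_add a b := by
    rw [mul_add, Real.cosh_add]; field_simp; ring
  md_sub a b := by
    rw [mul_sub, Real.cosh_sub]; field_simp; ring
  sn_sub a b := by
    rw [mul_sub, Real.sinh_sub]; field_simp; ring
  continuous_md := by fun_prop
  continuous_sn := by fun_prop
  zero_mem := self_mem_Ici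
  ordConnected_dom := ordConnected_Ici
  nonneg_of_mem s hs := hs
  strictMonoOn_md a ha b hb hab := by
    have h2 : Real.cosh (k * a) < Real.cosh (k * b) :=
      Real.cosh_strictMonoOn (mul_nonneg hk.le ha) (mul_nonneg hk.le hb) (by nlinarith)
    change (Real.cosh (k * a) - 1) / k ^ 2 < (Real.cosh (k * b) - 1) / k ^ 2
    gcongr
  sn_nonneg s hs := div_nonneg (Real.sinh_nonneg_iff.2 (mul_nonneg hk.le hs)) hk.le
  exists_md_eq f hf h := by
    have h1 : 1 ≤ 1 + k ^ 2 * f := by nlinarith [mul_nonneg (sq_nonneg k) hf]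
    refine ⟨Real.arcosh (1 + k ^ 2 * f) / k, div_nonneg (Real.arcosh_nonneg h1) hk.le, ?_⟩
    rw [mul_div_cancel₀ _ hk.ne', Real.cosh_arcosh h1]
    field_simp
    ring

end ConstCurv

namespace ConstCurv

/-! ### The sphere -/

section Sphere

variable {m : ℕ} {k : ℝ}

lemma norm_sph (x : Sph m k) : ‖(x : EuclideanSpace ℝ (Fin (m + 1)))‖ = 1 / k :=
  mem_sphere_zero_iff_norm.1 x.2

lemma sph_ne_zero (hk : 0 < k) (x : Sph m k) : (x : EuclideanSpace ℝ (Fin (m + 1))) ≠ 0 := by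
  rw [← norm_ne_zero_iff, norm_sph]
  positivity

instance fact_finrank_euclideanSpace (m : ℕ) :
    Fact (Module.finrank ℝ (EuclideanSpace ℝ (Fin (m + 1))) = m + 1) :=
  ⟨by simp⟩

/-- The identification of `ℝᵐ` with the tangent space of the sphere at `P` by an orthonormal basis of
the orthogonal complement of `P`. -/
noncomputable def sphFrame (hk : 0 < k) (P : Sph m k) :
    EuclideanSpace ℝ (Fin m) →ₗᵢ[ℝ] EuclideanSpace ℝ (Fin (m + 1)) :=
  (ℝ ∙ (P : EuclideanSpace ℝ (Fin (m + 1))))ᗮ.subtypeₗᵢ.comp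
    (OrthonormalBasis.fromOrthogonalSpanSingleton (𝕜 := ℝ) m
      (sph_ne_zero hk P)).repr.symm.toLinearIsometry

lemma inner_sphFrame (hk : 0 < k) (P : Sph m k) (v : EuclideanSpace ℝ (Fin m)) :
    inner ℝ (P : EuclideanSpace ℝ (Fin (m + 1))) (sphFrame hk P v) = 0 :=
  Submodule.mem_orthogonal_singleton_iff_inner_right.1 (Subtype.prop
    ((OrthonormalBasis.fromOrthogonalSpanSingleton (𝕜 := ℝ) m (sph_ne_zero hk P)).repr.symm v))

lemma exists_sphFrame (hk : 0 < k) (P : Sph m k) {w : EuclideanSpace ℝ (Fin (m + 1))}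
    (h : inner ℝ (P : EuclideanSpace ℝ (Fin (m + 1))) w = 0) : ∃ v, sphFrame hk P v = w := by
  refine ⟨(OrthonormalBasis.fromOrthogonalSpanSingleton (𝕜 := ℝ) m (sph_ne_zero hk P)).repr
    ⟨w, Submodule.mem_orthogonal_singleton_iff_inner_right.2 h⟩, ?_⟩
  simp [sphFrame]

lemma sphTrigonometry_K_md (hk : 0 < k) (t : ℝ) :
    1 - (sphTrigonometry hk).K * (sphTrigonometry hk).md t = Real.cos (k * t) := by
  change 1 - k ^ 2 * ((1 - Real.cos (k * t)) / k ^ 2) = _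
  field_simp
  ring

lemma inner_sph_self (x : Sph m k) :
    inner ℝ (x : EuclideanSpace ℝ (Fin (m + 1))) x = 1 / k ^ 2 := by
  rw [real_inner_self_eq_norm_sq, norm_sph]
  ring

/-- The sphere as a quadric, with the Euclidean inner product as bilinear form. -/
noncomputable def sphQuadric (m : ℕ) {k : ℝ} (hk : 0 < k) :
    Quadric (sphTrigonometry hk) (Sph m k) (EuclideanSpace ℝ (Fin (m + 1)))
      (EuclideanSpace ℝ (Fin m)) where
  K_ne := (pow_pos hk 2).ne'
  ι x := x
  B := innerSL ℝ
  d := sphDist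
  frame P := (sphFrame hk P).toContinuousLinearMap
  dist_eq x y := by rw [Subtype.dist_eq, dist_eq_norm]
  B_comm v w := real_inner_comm w v
  B_self x := inner_sph_self x
  d_mem x y := ⟨div_nonneg (InnerProductGeometry.angle_nonneg _ _) hk.le,
    div_le_div_of_nonneg_right (InnerProductGeometry.angle_le_pi _ _) hk.le⟩
  md_d x y := by
    change (1 - Real.cos (k * (InnerProductGeometry.angle _ _ / k))) / k ^ 2
      = 1 / k ^ 2 - inner ℝ (x : EuclideanSpace ℝ (Fin (m + 1))) y
    rw [mul_div_cancel₀ _ hk.ne', InnerProductGeometry.cos_angle, norm_sph, norm_sph]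
    field_simp
  continuous_d x := by
    rw [continuous_iff_continuousAt]
    intro y
    have h := InnerProductGeometry.continuousAt_angle
      (x := ((x : EuclideanSpace ℝ (Fin (m + 1))), (y : EuclideanSpace ℝ (Fin (m + 1)))))
      (sph_ne_zero hk x) (sph_ne_zero hk y)
    have h2 : ContinuousAt (fun y : Sph m k =>
      ((x : EuclideanSpace ℝ (Fin (m + 1))), (y : EuclideanSpace ℝ (Fin (m + 1))))) y := by
      fun_prop
    exact (ContinuousAt.comp (f := fun y : Sph m k =>
      ((x : EuclideanSpace ℝ (Fin (m + 1))), (y : EuclideanSpace ℝ (Fin (m + 1))))) h h2).div_const k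
  frame_inner P v w := (sphFrame hk P).inner_map_map v w
  frame_orth P v := inner_sphFrame hk P v
  exists_frame P w hw := exists_sphFrame hk P hw
  exists_point P s hs v hv := by
    rw [sphTrigonometry_K_md]
    refine ⟨⟨Real.cos (k * s) • (P : EuclideanSpace ℝ (Fin (m + 1)))
      + (Real.sin (k * s) / k) • sphFrame hk P v, ?_⟩, rfl⟩
    rw [mem_sphere_zero_iff_norm, ← sq_eq_sq₀ (norm_nonneg _) (by positivity), norm_add_sq_real,
      norm_smul, norm_smul, real_inner_smul_left, real_inner_smul_right, inner_sphFrame,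
      norm_sph, LinearIsometry.norm_map, hv, Real.norm_eq_abs, Real.norm_eq_abs, mul_one,
      mul_pow, sq_abs, sq_abs]
    linear_combination Real.sin_sq_add_cos_sq (k * s) / k ^ 2

/-- The radius is `arccot (κ / k) / k`. -/
lemma sphCurv_iff (hm : 2 ≤ m) (hk : 0 < k) {κ : ℝ} (O : Sph m k) (ρ : ℝ) :
    sphCurv O ρ κ ↔ ρ = (Real.pi / 2 - Real.arctan (κ / k)) / k := by
  have h1 := Real.arctan_lt_pi_div_two (κ / k)
  have h2 := Real.neg_pi_div_two_lt_arctan (κ / k)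
  have key : 0 < ρ → ρ < Real.pi / k → (HasConstNormalCurvature
      (fun x : Sph m k => (x : EuclideanSpace ℝ (Fin (m + 1))))
      (fun v w => inner ℝ v w) (gsphere sphDist O ρ)
      (fun x => (k / Real.sin (k * ρ)) •
        ((O : EuclideanSpace ℝ (Fin (m + 1))) - Real.cos (k * ρ) • (x : EuclideanSpace ℝ (Fin (m + 1)))))
      κ ↔ ρ = (Real.pi / 2 - Real.arctan (κ / k)) / k) := by
    intro hρ hρ'
    have hρπ : k * ρ < Real.pi := by rw [lt_div_iff₀ hk] at hρ'; linarith
    have hsin : 0 < Real.sin (k * ρ) := Real.sin_pos_of_pos_of_lt_pi (by positivity) hρπ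
    have h := (sphQuadric m hk).curvature_iff (by simpa using hm) O (ρ := ρ) (κ := κ)
      ⟨hρ.le, hρ'.le⟩ (div_pos hsin hk).ne'
    rw [sphTrigonometry_K_md, show (sphTrigonometry hk).sn ρ = Real.sin (k * ρ) / k from rfl,
      inv_div] at h
    refine h.trans ?_
    constructor
    · intro hκ
      have h3 : κ / k = Real.tan (Real.pi / 2 - k * ρ) := by
        rw [hκ, Real.tan_eq_sin_div_cos, Real.sin_pi_div_two_sub, Real.cos_pi_div_two_sub]
        field_simp
      have h4 : 0 < k * ρ := by positivity
      rw [h3, Real.arctan_tan (by linarith) (by linarith), sub_sub_cancel,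
        mul_div_cancel_left₀ _ hk.ne']
    · intro hρκ
      have h3 : k * ρ = Real.pi / 2 - Real.arctan (κ / k) := by
        rw [hρκ, mul_div_cancel₀ _ hk.ne']
      have h4 := Real.tan_arctan (κ / k)
      rw [h3, Real.cos_pi_div_two_sub, Real.sin_pi_div_two_sub, div_div_eq_mul_div,
        mul_div_right_comm, ← Real.tan_eq_sin_div_cos, h4, div_mul_cancel₀ _ hk.ne']
  constructor
  · rintro ⟨h3, h4, h5⟩
    exact (key h3 h4).1 h5
  · rintro rfl
    have h3 : 0 < (Real.pi / 2 - Real.arctan (κ / k)) / k := div_pos (by linarith) hk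
    have h4 : (Real.pi / 2 - Real.arctan (κ / k)) / k < Real.pi / k := by gcongr; linarith
    exact ⟨h3, h4, (key h3 h4).2 rfl⟩

end Sphere

/-! ### The hyperboloid -/

section Hyperboloid

variable {m : ℕ} {k : ℝ}

/-- The Lorentz form as a continuous bilinear form. -/
noncomputable def lorentzL (m : ℕ) : (ℝ × EuclideanSpace ℝ (Fin m)) →L[ℝ]
    (ℝ × EuclideanSpace ℝ (Fin m)) →L[ℝ] ℝ :=
  (innerSL ℝ).bilinearComp (ContinuousLinearMap.snd ℝ ℝ _) (ContinuousLinearMap.snd ℝ ℝ _)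
    - (ContinuousLinearMap.mul ℝ ℝ).bilinearComp (ContinuousLinearMap.fst ℝ ℝ _)
      (ContinuousLinearMap.fst ℝ ℝ _)

lemma lorentzL_apply (v w : ℝ × EuclideanSpace ℝ (Fin m)) : lorentzL m v w = lorentz v w := rfl

lemma lorentz_comm (v w : ℝ × EuclideanSpace ℝ (Fin m)) : lorentz v w = lorentz w v := by
  rw [lorentz, lorentz, real_inner_comm, mul_comm]

lemma hyp_norm_sq (x : Hyp m k) : ‖x.1.2‖ ^ 2 = x.1.1 ^ 2 - 1 / k ^ 2 := by
  have := x.2.1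
  rw [lorentz, real_inner_self_eq_norm_sq] at this
  linarith

lemma hyp_norm_lt (hk : 0 < k) (x : Hyp m k) : ‖x.1.2‖ < x.1.1 := by
  have h1 := hyp_norm_sq x
  have h2 : 0 < 1 / k ^ 2 := by positivity
  exact lt_of_pow_lt_pow_left₀ 2 x.2.2.le (by linarith)

/-- The reversed Cauchy-Schwarz inequality. -/
lemma lorentz_hyp_le (x y : Hyp m k) : lorentz x.1 y.1 ≤ -(1 / k ^ 2) := by
  have hx := hyp_norm_sq x
  have hy := hyp_norm_sq y
  have hxy := real_inner_le_norm x.1.2 y.1.2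
  have h0 : 0 ≤ 1 / k ^ 2 := by positivity
  have : ‖x.1.2‖ * ‖y.1.2‖ + 1 / k ^ 2 ≤ x.1.1 * y.1.1 := by
    rw [← sq_le_sq₀ (by positivity) (mul_nonneg x.2.2.le y.2.2.le), mul_pow x.1.1,
      show x.1.1 ^ 2 = ‖x.1.2‖ ^ 2 + 1 / k ^ 2 by linarith,
      show y.1.1 ^ 2 = ‖y.1.2‖ ^ 2 + 1 / k ^ 2 by linarith]
    linear_combination (1 / k ^ 2) * sq_nonneg (‖x.1.2‖ - ‖y.1.2‖)
  rw [lorentz]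
  linarith

lemma one_le_of_hyp (hk : 0 < k) (x y : Hyp m k) : 1 ≤ -(k ^ 2 * lorentz x.1 y.1) := by
  have := lorentz_hyp_le x y
  rw [le_neg, div_le_iff₀ (by positivity)] at this
  linarith

/-- A timelike or null vector with negative product with a point of the upper sheet points upwards. -/
lemma pos_of_lorentz_neg (hk : 0 < k) (P : Hyp m k) {z : ℝ × EuclideanSpace ℝ (Fin m)}
    (hz : lorentz z z ≤ 0) (h : lorentz P.1 z < 0) : 0 < z.1 := by
  by_contra! h0
  rw [lorentz, real_inner_self_eq_norm_sq] at hz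
  have h1 : ‖z.2‖ ≤ -z.1 := abs_le_of_sq_le_sq' (by linarith) (by linarith) |>.2
  have h2 := real_inner_le_norm (-P.1.2) z.2
  rw [inner_neg_left, norm_neg] at h2
  have h3 := hyp_norm_lt hk P
  rw [lorentz] at h
  nlinarith [mul_le_mul h3.le h1 (norm_nonneg _) P.2.2.le]

/-- The identification of `ℝᵐ` with the tangent space of the hyperboloid at `P`: the restriction to
`0 × ℝᵐ` of the boost that takes `(1 / k, 0)` to `P`. -/
noncomputable def hypFrame (k : ℝ) (P : Hyp m k) :
    EuclideanSpace ℝ (Fin m) →L[ℝ] ℝ × EuclideanSpace ℝ (Fin m) :=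
  (innerSL ℝ (k • P.1.2)).prod (ContinuousLinearMap.id ℝ _ +
    ((1 + k * P.1.1)⁻¹ • innerSL ℝ (k • P.1.2)).smulRight (k • P.1.2))

lemma hypFrame_apply (P : Hyp m k) (v : EuclideanSpace ℝ (Fin m)) :
    hypFrame k P v = (k * inner ℝ P.1.2 v,
      v + ((1 + k * P.1.1)⁻¹ * (k * inner ℝ P.1.2 v) * k) • P.1.2) := by
  simp only [hypFrame, ContinuousLinearMap.prod_apply, innerSL_apply_apply, real_inner_smul_left,
    add_apply, ContinuousLinearMap.id_apply, ContinuousLinearMap.smulRight_apply, smul_apply,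
    smul_eq_mul, smul_smul]

lemma hypTrigonometry_K_md (hk : 0 < k) (t : ℝ) :
    1 - (hypTrigonometry hk).K * (hypTrigonometry hk).md t = Real.cosh (k * t) := by
  change 1 - -k ^ 2 * ((Real.cosh (k * t) - 1) / k ^ 2) = _
  field_simp
  ring

lemma lorentz_hypFrame_left (hk : 0 < k) (P : Hyp m k) (v : EuclideanSpace ℝ (Fin m)) :
    lorentz P.1 (hypFrame k P v) = 0 := by
  have h := hyp_norm_sq P
  have h0 : 0 < 1 + k * P.1.1 := by have := P.2.2; positivity
  rw [hypFrame_apply, lorentz, inner_add_right, real_inner_smul_right, real_inner_self_eq_norm_sq, h]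
  field_simp
  ring

lemma lorentz_hypFrame (hk : 0 < k) (P : Hyp m k) (v w : EuclideanSpace ℝ (Fin m)) :
    lorentz (hypFrame k P v) (hypFrame k P w) = inner ℝ v w := by
  have h := hyp_norm_sq P
  have h0 : 0 < 1 + k * P.1.1 := by have := P.2.2; positivity
  rw [hypFrame_apply, hypFrame_apply, lorentz]
  simp only [inner_add_right, inner_add_left, real_inner_smul_right, real_inner_smul_left,
    real_inner_self_eq_norm_sq, h, real_inner_comm P.1.2 v]
  field_simp
  ring

lemma exists_hypFrame (hk : 0 < k) (P : Hyp m k) {w : ℝ × EuclideanSpace ℝ (Fin m)}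
    (h : lorentz P.1 w = 0) : ∃ v, hypFrame k P v = w := by
  have hn := hyp_norm_sq P
  have h0 : 0 < 1 + k * P.1.1 := by have := P.2.2; positivity
  rw [lorentz] at h
  have h1 : k * inner ℝ P.1.2 (w.2 - ((1 + k * P.1.1)⁻¹ * w.1 * k) • P.1.2) = w.1 := by
    rw [inner_sub_right, real_inner_smul_right, real_inner_self_eq_norm_sq, hn,
      sub_eq_zero.1 h]
    field_simp
    ring
  refine ⟨w.2 - ((1 + k * P.1.1)⁻¹ * w.1 * k) • P.1.2, ?_⟩
  rw [hypFrame_apply, h1, sub_add_cancel]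

/-- The condition `0 ≤ x.1` is closed, and is equivalent to `0 < x.1` on the hyperboloid. -/
lemma isClosed_hyp (m : ℕ) (k : ℝ) : IsClosed {x : ℝ × EuclideanSpace ℝ (Fin m) |
    lorentz x x = -(1 / k ^ 2) ∧ 0 ≤ x.1} := by
  have h : Continuous fun x : ℝ × EuclideanSpace ℝ (Fin m) => lorentz x x := by
    unfold lorentz
    fun_prop
  exact (isClosed_eq h continuous_const).inter (isClosed_le continuous_const continuous_fst)

lemma properSpace_hyp (m : ℕ) {k : ℝ} (hk : 0 < k) : ProperSpace (Hyp m k) := by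
  have h : {x : ℝ × EuclideanSpace ℝ (Fin m) | lorentz x x = -(1 / k ^ 2) ∧ 0 < x.1} =
      {x | lorentz x x = -(1 / k ^ 2) ∧ 0 ≤ x.1} := by
    ext x
    refine and_congr_right fun hx => ⟨fun h : 0 < x.1 => h.le, fun h => lt_of_le_of_ne h fun h0 => ?_⟩
    rw [lorentz, ← h0, real_inner_self_eq_norm_sq] at hx
    have : 0 < 1 / k ^ 2 := by positivity
    nlinarith [sq_nonneg ‖x.2‖]
  have hc := isClosed_hyp m k
  rw [← h] at hc
  exact ProperSpace.of_isClosed hc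

/-- The hyperboloid as a quadric, with the Lorentz form as bilinear form. -/
noncomputable def hypQuadric (m : ℕ) {k : ℝ} (hk : 0 < k) :
    Quadric (hypTrigonometry hk) (Hyp m k) (ℝ × EuclideanSpace ℝ (Fin m))
      (EuclideanSpace ℝ (Fin m)) where
  K_ne := neg_ne_zero.2 (pow_pos hk 2).ne'
  ι x := x.1
  B := lorentzL m
  d := hypDist
  frame P := hypFrame k P
  dist_eq x y := by rw [Subtype.dist_eq, dist_eq_norm]
  B_comm v w := lorentz_comm v w
  B_self x := by
    change lorentz x.1 x.1 = 1 / -k ^ 2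
    rw [x.2.1, div_neg]
  d_mem x y := div_nonneg (Real.arcosh_nonneg (one_le_of_hyp hk x y)) hk.le
  md_d x y := by
    change (Real.cosh (k * (Real.arcosh (-(k ^ 2 * lorentz x.1 y.1)) / k)) - 1) / k ^ 2
      = 1 / -k ^ 2 - lorentz x.1 y.1
    rw [mul_div_cancel₀ _ hk.ne', Real.cosh_arcosh (one_le_of_hyp hk x y)]
    field_simp
    ring
  continuous_d x := by
    have h : Continuous fun y : Hyp m k => -(k ^ 2 * lorentz x.1 y.1) := by
      unfold lorentz
      fun_prop
    exact (Real.continuousOn_arcosh.comp_continuous h fun y => one_le_of_hyp hk x y).div_const k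
  frame_inner P v w := lorentz_hypFrame hk P v w
  frame_orth P v := lorentz_hypFrame_left hk P v
  exists_frame P w hw := exists_hypFrame hk P hw
  exists_point P s hs v hv := by
    rw [hypTrigonometry_K_md]
    have h1 : lorentz (hypFrame k P v) P.1 = 0 := by
      rw [lorentz_comm, lorentz_hypFrame_left hk]
    have h2 := lorentz_hypFrame hk P v v
    have h3 := lorentz_hypFrame_left hk P v
    have h4 := P.2.1
    rw [real_inner_self_eq_norm_sq, hv] at h2
    rw [← lorentzL_apply] at h1 h2 h3 h4
    have hz : lorentz (Real.cosh (k * s) • P.1 + (Real.sinh (k * s) / k) • hypFrame k P v)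
        (Real.cosh (k * s) • P.1 + (Real.sinh (k * s) / k) • hypFrame k P v) = -(1 / k ^ 2) := by
      rw [← lorentzL_apply]
      simp only [map_add, map_smul, add_apply, smul_apply, smul_eq_mul, h1, h2, h3, h4]
      field_simp
      linear_combination -Real.cosh_sq_sub_sinh_sq (k * s)
    refine ⟨⟨Real.cosh (k * s) • P.1 + (Real.sinh (k * s) / k) • hypFrame k P v, hz, ?_⟩, rfl⟩
    have h0 : 0 < 1 / k ^ 2 := by positivity
    refine pos_of_lorentz_neg hk P (by rw [hz]; linarith) ?_
    rw [← lorentzL_apply]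
    simp only [map_add, map_smul, smul_eq_mul, h3, h4]
    nlinarith [Real.cosh_pos (k * s)]

end Hyperboloid

end ConstCurv

namespace ConstCurv

/-! ### Curvature of hyperbolic spheres, and the three cases -/

/-- The radius is `arcoth (κ / k) / k`, written with a logarithm. -/
lemma hypCurv_iff {m : ℕ} {k : ℝ} (hm : 2 ≤ m) (hk : 0 < k) {κ : ℝ} (hκ : k < κ) (O : Hyp m k)
    (ρ : ℝ) : hypCurv O ρ κ ↔ ρ = Real.log ((κ + k) / (κ - k)) / (2 * k) := by
  have hκ0 : 0 < κ - k := by linarith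
  have h1 : 1 < (κ + k) / (κ - k) := by rw [one_lt_div hκ0]; linarith
  have key : 0 < ρ → (HasConstNormalCurvature (fun x : Hyp m k => x.1) lorentz
      (gsphere hypDist O ρ)
      (fun x => (k / Real.sinh (k * ρ)) • (O.1 - Real.cosh (k * ρ) • x.1)) κ ↔
        ρ = Real.log ((κ + k) / (κ - k)) / (2 * k)) := by
    intro hρ
    have hsinh : 0 < Real.sinh (k * ρ) := Real.sinh_pos_iff.2 (by positivity)
    have h := (hypQuadric m hk).curvature_iff (by simpa using hm) O (ρ := ρ) (κ := κ)
      hρ.le (div_pos hsinh hk).ne'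
    rw [hypTrigonometry_K_md, show (hypTrigonometry hk).sn ρ = Real.sinh (k * ρ) / k from rfl,
      inv_div] at h
    refine h.trans ?_
    have hexp : Real.exp (2 * (k * ρ)) = Real.exp (k * ρ) * Real.exp (k * ρ) := by
      rw [two_mul, Real.exp_add]
    have hinv : Real.exp (k * ρ) * Real.exp (-(k * ρ)) = 1 := by
      rw [← Real.exp_add, add_neg_cancel, Real.exp_zero]
    have hlog : ρ = Real.log ((κ + k) / (κ - k)) / (2 * k) ↔
        Real.exp (2 * (k * ρ)) = (κ + k) / (κ - k) := by
      rw [eq_div_iff (by positivity : 2 * k ≠ 0), show ρ * (2 * k) = 2 * (k * ρ) by ring]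
      constructor
      · intro h
        rw [h, Real.exp_log (by linarith)]
      · intro h
        rw [← h, Real.log_exp]
    rw [hlog, eq_div_iff hκ0.ne', eq_div_iff (div_pos hsinh hk).ne', hexp, mul_div_assoc',
      div_eq_iff hk.ne', Real.cosh_eq, Real.sinh_eq]
    have hpos := Real.exp_pos (k * ρ)
    have hneg := Real.exp_pos (-(k * ρ))
    constructor
    · intro h
      linear_combination (2 * Real.exp (k * ρ)) * h + (κ + k) * hinv
    · intro h
      linear_combination (Real.exp (-(k * ρ)) / 2) * h
        - ((κ - k) * Real.exp (k * ρ) / 2) * hinv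
  constructor
  · rintro ⟨h3, h5⟩
    exact (key h3).1 h5
  · rintro rfl
    have h3 : 0 < Real.log ((κ + k) / (κ - k)) / (2 * k) := div_pos (Real.log_pos h1) (by positivity)
    exact ⟨h3, (key h3).2 rfl⟩

end ConstCurv

theorem theorem1 (m : ℕ) (hm : 2 ≤ m) (κ₁ κ₂ : ℝ) (hκ : κ₁ ≤ κ₂) :
    -- curvature `0`
    (0 < κ₁ →
      ∃ R₁ R₂ : ℝ,
        (∀ (O : ConstCurv.Euc m) (ρ : ℝ), ConstCurv.eucCurv O ρ κ₁ ↔ ρ = R₁) ∧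
        (∀ (O : ConstCurv.Euc m) (ρ : ℝ), ConstCurv.eucCurv O ρ κ₂ ↔ ρ = R₂) ∧
        (∀ D : Set (ConstCurv.Euc m),
          ConstCurv.IsPinchedConvex ConstCurv.eucDist ConstCurv.eucCurv κ₁ κ₂ D →
          ∃ (O : ConstCurv.Euc m) (r R : ℝ), ConstCurv.IsShell ConstCurv.eucDist D O r R ∧
            R - r ≤ (√2 - 1) * (R₁ - R₂)) ∧
        (∃ D : Set (ConstCurv.Euc m),
          ConstCurv.IsRoundedSpindle ConstCurv.eucDist R₁ R₂ D ∧
          ConstCurv.IsPinchedConvex ConstCurv.eucDist ConstCurv.eucCurv κ₁ κ₂ D ∧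
          (∃ (O : ConstCurv.Euc m) (r R : ℝ), ConstCurv.IsShell ConstCurv.eucDist D O r R ∧
            R - r = (√2 - 1) * (R₁ - R₂)) ∧
          (∀ (O : ConstCurv.Euc m) (r R : ℝ), ConstCurv.IsShell ConstCurv.eucDist D O r R →
            (√2 - 1) * (R₁ - R₂) ≤ R - r))) ∧
    -- curvature `k ^ 2`
    (∀ k : ℝ, 0 < k → 0 ≤ κ₁ →
      ∃ R₁ R₂ : ℝ,
        (∀ (O : ConstCurv.Sph m k) (ρ : ℝ), ConstCurv.sphCurv O ρ κ₁ ↔ ρ = R₁) ∧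
        (∀ (O : ConstCurv.Sph m k) (ρ : ℝ), ConstCurv.sphCurv O ρ κ₂ ↔ ρ = R₂) ∧
        (∀ D : Set (ConstCurv.Sph m k),
          ConstCurv.IsPinchedConvex ConstCurv.sphDist ConstCurv.sphCurv κ₁ κ₂ D →
          ∃ (O : ConstCurv.Sph m k) (r R : ℝ), ConstCurv.IsShell ConstCurv.sphDist D O r R ∧
            R < Real.pi / k ∧
            R - r ≤ 2 / k * Real.arccos (√(Real.cos (k * (R₁ - R₂)))) - (R₁ - R₂)) ∧
        (∃ D : Set (ConstCurv.Sph m k),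
          ConstCurv.IsRoundedSpindle ConstCurv.sphDist R₁ R₂ D ∧
          ConstCurv.IsPinchedConvex ConstCurv.sphDist ConstCurv.sphCurv κ₁ κ₂ D ∧
          (∃ (O : ConstCurv.Sph m k) (r R : ℝ), ConstCurv.IsShell ConstCurv.sphDist D O r R ∧
            R < Real.pi / k ∧
            R - r = 2 / k * Real.arccos (√(Real.cos (k * (R₁ - R₂)))) - (R₁ - R₂)) ∧
          (∀ (O : ConstCurv.Sph m k) (r R : ℝ), ConstCurv.IsShell ConstCurv.sphDist D O r R →
            2 / k * Real.arccos (√(Real.cos (k * (R₁ - R₂)))) - (R₁ - R₂) ≤ R - r))) ∧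
    -- curvature `-k ^ 2`
    (∀ k : ℝ, 0 < k → k < κ₁ →
      ∃ R₁ R₂ : ℝ,
        (∀ (O : ConstCurv.Hyp m k) (ρ : ℝ), ConstCurv.hypCurv O ρ κ₁ ↔ ρ = R₁) ∧
        (∀ (O : ConstCurv.Hyp m k) (ρ : ℝ), ConstCurv.hypCurv O ρ κ₂ ↔ ρ = R₂) ∧
        (∀ D : Set (ConstCurv.Hyp m k),
          ConstCurv.IsPinchedConvex ConstCurv.hypDist ConstCurv.hypCurv κ₁ κ₂ D →
          ∃ (O : ConstCurv.Hyp m k) (r R : ℝ), ConstCurv.IsShell ConstCurv.hypDist D O r R ∧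
            R - r ≤ 2 / k * Real.arcosh (√(Real.cosh (k * (R₁ - R₂)))) - (R₁ - R₂)) ∧
        (∃ D : Set (ConstCurv.Hyp m k),
          ConstCurv.IsRoundedSpindle ConstCurv.hypDist R₁ R₂ D ∧
          ConstCurv.IsPinchedConvex ConstCurv.hypDist ConstCurv.hypCurv κ₁ κ₂ D ∧
          (∃ (O : ConstCurv.Hyp m k) (r R : ℝ), ConstCurv.IsShell ConstCurv.hypDist D O r R ∧
            R - r = 2 / k * Real.arcosh (√(Real.cosh (k * (R₁ - R₂)))) - (R₁ - R₂)) ∧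
          (∀ (O : ConstCurv.Hyp m k) (r R : ℝ), ConstCurv.IsShell ConstCurv.hypDist D O r R →
            2 / k * Real.arcosh (√(Real.cosh (k * (R₁ - R₂)))) - (R₁ - R₂) ≤ R - r))) := by
  have hfin : 2 ≤ Module.finrank ℝ (EuclideanSpace ℝ (Fin m)) := by simpa using hm
  refine ⟨fun h₁ => ?_, fun k hk h₁ => ?_, fun k hk h₁ => ?_⟩
  · have h₂ : 0 < κ₂ := h₁.trans_le hκ
    have e₁ := ConstCurv.eucCurv_iff hm h₁
    have e₂ := ConstCurv.eucCurv_iff hm h₂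
    have hR : κ₂⁻¹ ≤ κ₁⁻¹ := inv_anti₀ h₁ hκ
    have hR₂ : 0 < κ₂⁻¹ := inv_pos.2 h₂
    have hα : 0 ≤ (κ₁⁻¹ - κ₂⁻¹) / √2 := div_nonneg (by linarith) (Real.sqrt_nonneg 2)
    obtain ⟨ha, D, hD, hDc, ⟨O, r, R, hs, -, hw⟩, hle⟩ :=
      (ConstCurv.eucSpaceForm m).shell_and_spindle hfin (R₁ := κ₁⁻¹) (R₂ := κ₂⁻¹) (α := (κ₁⁻¹ - κ₂⁻¹) / √2)
        hR₂ hR (mul_nonneg two_pos.le (hR₂.le.trans hR)) (by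
          change 0 * (κ₁⁻¹ ^ 2 / 2) ≤ (1 : ℝ)
          norm_num) hα (by
          change ((κ₁⁻¹ - κ₂⁻¹) / √2) ^ 2 = (κ₁⁻¹ - κ₂⁻¹) ^ 2 / 2
          rw [div_pow, Real.sq_sqrt two_pos.le]) (by
          change 0 * (((κ₁⁻¹ - κ₂⁻¹) / √2) ^ 2 / 2) < (1 : ℝ)
          norm_num)
    -- the leg of the isosceles right-angled triangle is `(R₁ - R₂) / √2`
    have hwid : 2 * ((κ₁⁻¹ - κ₂⁻¹) / √2) - (κ₁⁻¹ - κ₂⁻¹) = (√2 - 1) * (κ₁⁻¹ - κ₂⁻¹) := by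
      have : 2 / √2 = √2 := Real.div_sqrt
      linear_combination (κ₁⁻¹ - κ₂⁻¹) * this
    simp only [hwid] at ha hw hle
    refine ⟨κ₁⁻¹, κ₂⁻¹, e₁, e₂, fun D hD => ?_, D, hD,
      (ConstCurv.IsPinchedConvex.congr e₁ e₂).2 hDc, ⟨O, r, R, hs, hw⟩, hle⟩
    obtain ⟨O, r, R, hs, -, hw⟩ := ha D ((ConstCurv.IsPinchedConvex.congr e₁ e₂).1 hD)
    exact ⟨O, r, R, hs, hw⟩
  · have e₁ := ConstCurv.sphCurv_iff hm hk (κ := κ₁)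
    have e₂ := ConstCurv.sphCurv_iff hm hk (κ := κ₂)
    set R₁ := (Real.pi / 2 - Real.arctan (κ₁ / k)) / k with hR₁
    set R₂ := (Real.pi / 2 - Real.arctan (κ₂ / k)) / k with hR₂
    have hR : R₂ ≤ R₁ := by
      have : Real.arctan (κ₁ / k) ≤ Real.arctan (κ₂ / k) :=
        Real.arctan_mono (div_le_div_of_nonneg_right hκ hk.le)
      rw [hR₁, hR₂]
      gcongr
    have hR₂0 : 0 < R₂ := div_pos (by linarith [Real.arctan_lt_pi_div_two (κ₂ / k)]) hk
    have hR₁π : k * R₁ ≤ Real.pi / 2 := by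
      rw [hR₁, mul_div_cancel₀ _ hk.ne']
      linarith [Real.arctan_nonneg.2 (div_nonneg h₁ hk.le)]
    have hkR₂ : 0 < k * R₂ := mul_pos hk hR₂0
    have hkρ : 0 ≤ k * (R₁ - R₂) := mul_nonneg hk.le (by linarith)
    have hcos : 0 < Real.cos (k * (R₁ - R₂)) :=
      Real.cos_pos_of_mem_Ioo ⟨by linarith [Real.pi_pos], by linarith⟩
    have hsq : √(Real.cos (k * (R₁ - R₂))) ≤ 1 := Real.sqrt_le_one.2 (Real.cos_le_one _)
    set β := Real.arccos √(Real.cos (k * (R₁ - R₂))) with hβ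
    have hkβ : k * (β / k) = β := mul_div_cancel₀ _ hk.ne'
    have hcosβ : Real.cos β = √(Real.cos (k * (R₁ - R₂))) :=
      Real.cos_arccos (by linarith [Real.sqrt_nonneg (Real.cos (k * (R₁ - R₂)))]) hsq
    have hR₁lt : R₁ < Real.pi / k := by
      rw [lt_div_iff₀ hk]; linarith [Real.pi_pos]
    have hne : Nonempty (ConstCurv.Sph m k) := by
      obtain ⟨v, hv⟩ := exists_norm_eq (EuclideanSpace ℝ (Fin (m + 1)))
        (by positivity : (0 : ℝ) ≤ 1 / k)
      exact ⟨⟨v, mem_sphere_zero_iff_norm.2 hv⟩⟩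
    obtain ⟨ha, D, hD, hDc, ⟨O, r, R, hs, hRle, hw⟩, hle⟩ :=
      (ConstCurv.sphQuadric m hk).shell_and_spindle hfin (R₁ := R₁) (R₂ := R₂) (α := β / k) hR₂0 hR
        ⟨by linarith, by rw [le_div_iff₀ hk]; linarith⟩ (by
          have := ConstCurv.sphTrigonometry_K_md hk R₁
          have := Real.cos_nonneg_of_mem_Icc (x := k * R₁) ⟨by nlinarith [Real.pi_pos], hR₁π⟩
          linarith)
        ⟨div_nonneg (Real.arccos_nonneg _) hk.le,
          div_le_div_of_nonneg_right (Real.arccos_le_pi _) hk.le⟩ (by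
          change (Real.sin (k * (β / k)) / k) ^ 2 = (1 - Real.cos (k * (R₁ - R₂))) / k ^ 2
          rw [hkβ, div_pow, Real.sin_sq, hcosβ, Real.sq_sqrt hcos.le]) (by
          have := ConstCurv.sphTrigonometry_K_md hk (β / k)
          rw [hkβ, hcosβ] at this
          linarith [Real.sqrt_pos.2 hcos])
    have hwid : 2 * (β / k) - (R₁ - R₂) = 2 / k * β - (R₁ - R₂) := by ring
    simp only [hwid] at ha hw hle
    refine ⟨R₁, R₂, e₁, e₂, fun D hD => ?_, D, hD,
      (ConstCurv.IsPinchedConvex.congr e₁ e₂).2 hDc, ⟨O, r, R, hs, hRle.trans_lt hR₁lt, hw⟩, hle⟩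
    obtain ⟨O, r, R, hs, hRle, hw⟩ := ha D ((ConstCurv.IsPinchedConvex.congr e₁ e₂).1 hD)
    exact ⟨O, r, R, hs, hRle.trans_lt hR₁lt, hw⟩
  · have h₂ : k < κ₂ := h₁.trans_le hκ
    have e₁ := ConstCurv.hypCurv_iff hm hk h₁
    have e₂ := ConstCurv.hypCurv_iff hm hk h₂
    set R₁ := Real.log ((κ₁ + k) / (κ₁ - k)) / (2 * k) with hR₁
    set R₂ := Real.log ((κ₂ + k) / (κ₂ - k)) / (2 * k) with hR₂
    have hk₁ : 0 < κ₁ - k := by linarith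
    have hk₂ : 0 < κ₂ - k := by linarith
    have hq₂ : 1 < (κ₂ + k) / (κ₂ - k) := by rw [one_lt_div hk₂]; linarith
    have hR : R₂ ≤ R₁ := by
      have : (κ₂ + k) / (κ₂ - k) ≤ (κ₁ + k) / (κ₁ - k) := by
        rw [div_le_div_iff₀ hk₂ hk₁]
        nlinarith
      rw [hR₁, hR₂]
      have := Real.log_le_log (by linarith) this
      gcongr
    have hR₂0 : 0 < R₂ := div_pos (Real.log_pos hq₂) (by linarith)
    have hc := Real.one_le_cosh (k * (R₁ - R₂))
    have hsq : 1 ≤ √(Real.cosh (k * (R₁ - R₂))) := Real.one_le_sqrt.2 hc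
    set β := Real.arcosh √(Real.cosh (k * (R₁ - R₂))) with hβ
    have hkβ : k * (β / k) = β := mul_div_cancel₀ _ hk.ne'
    have hcoshβ : Real.cosh β = √(Real.cosh (k * (R₁ - R₂))) := Real.cosh_arcosh hsq
    have hproper := ConstCurv.properSpace_hyp m hk
    have hne : Nonempty (ConstCurv.Hyp m k) :=
      ⟨⟨(1 / k, 0), by simp [ConstCurv.lorentz]; ring, by positivity⟩⟩
    have hdom : ∀ s, 0 ≤ s → s ∈ (ConstCurv.hypTrigonometry hk).dom := fun s hs => hs
    have hKmd : ∀ s, (ConstCurv.hypTrigonometry hk).K * (ConstCurv.hypTrigonometry hk).md s ≤ 0 :=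
      fun s => by
        have := ConstCurv.hypTrigonometry_K_md hk s
        linarith [Real.one_le_cosh (k * s)]
    obtain ⟨ha, D, hD, hDc, ⟨O, r, R, hs, -, hw⟩, hle⟩ :=
      (ConstCurv.hypQuadric m hk).shell_and_spindle hfin (R₁ := R₁) (R₂ := R₂) (α := β / k) hR₂0 hR
        (hdom _ (by linarith)) ((hKmd R₁).trans zero_le_one)
        (hdom _ (div_nonneg (Real.arcosh_nonneg hsq) hk.le)) (by
          change (Real.sinh (k * (β / k)) / k) ^ 2 = (Real.cosh (k * (R₁ - R₂)) - 1) / k ^ 2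
          rw [hkβ, div_pow, Real.sinh_sq, hcoshβ, Real.sq_sqrt (by linarith)])
        ((hKmd _).trans_lt one_pos)
    have hwid : 2 * (β / k) - (R₁ - R₂) = 2 / k * β - (R₁ - R₂) := by ring
    simp only [hwid] at ha hw hle
    refine ⟨R₁, R₂, e₁, e₂, fun D hD => ?_, D, hD,
      (ConstCurv.IsPinchedConvex.congr e₁ e₂).2 hDc, ⟨O, r, R, hs, hw⟩, hle⟩
    obtain ⟨O, r, R, hs, -, hw⟩ := ha D ((ConstCurv.IsPinchedConvex.congr e₁ e₂).1 hD)
    exact ⟨O, r, R, hs, hw⟩
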